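/- \textbf{Conventions.} Diagrams lie on the oriented sphere, up to isotopy. A \emph{reduced alternating diagram of a prime link} is an alternating diagram without nugatory crossings whose underlying 4-regular plane graph remains connected after the deletion of any one or two edges. A \emph{2-subgroup} is a face of degree two with two distinct vertices. A \emph{twist} of size $k\ge1$ is a row of $k$ distinct crossings, consecutive ones being joined by the two edges of a 2-subgroup; it has two legs at each of its two ends. A \emph{group} is a twist that is not part of a longer one; a group of size $1$ (a crossing that lies on no 2-subgroup) is a \emph{loner}. The \emph{condensation} of $D$ is the 4-regular plane graph obtained by collapsing every group of $D$ to one vertex. The operation $T$ turns a group of size at least $2$ (as a 4-tangle) by a quarter turn. An \emph{$ots$-triangle} is a triangular face with three distinct vertices, no two of them joined by more than one edge. Let the pairs of legs leaving it at its three vertices be, in cyclic order, $(6,1),(2,3),(4,5)$; the operation $ots$ replaces it by a triangle whose vertices carry the pairs $(1,2),(3,4),(5,6)$. The operation $OTS$ does this to three crossings of an alternating diagram. In $T$ and $OTS$ over and under are exchanged inside the tangle, so that the diagram stays alternating. \textbf{Proposition.} Let $D$ be a reduced alternating diagram of a prime link whose condensation $G$ is a simple graph. (1) Let $O$ be an $ots$-triangle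 of $G$, one of whose vertices represents a loner $A$ of $D$. Then there is a finite sequence of $T$ and $OTS$ operations that transforms $D$ into a reduced alternating diagram $D'$ of a prime link, such that collapsing in $D'$ the 2-subgroups that correspond to those of $D$ (that is, collapsing the groups of $D$ in their new positions) gives the graph $ots(G)$ obtained from $G$ by applying $ots$ to $O$. If no two legs of $O$ that leave it at the two ends of one of its sides, on the outer side of that side, arrive at neighbouring edge-ends of one crossing of $D$, then the condensation of $D'$ is $ots(G)$. (2) More precisely, suppose that $A$ and groups $B$, $C$ of sizes $b,c\ge 1$ of $D$ are arranged counterclockwise $A,B,C$ around a central face, with one end of each group pointing to that face, its two legs there being joined to the two other groups, and with the outer legs numbered clockwise $1,\dots,6$ so that $A$ has the outer legs $6,1$, $C$ has $2,3$, and $B$ has $4,5$. Then there is a finite sequence of $T$ and $OTS$ operations, all carried out inside the 6-tangle formed by $A$, $B$, $C$, that transforms $D$ into a reduced alternating diagram $D'$ of a prime link, identical with $D$ outside this tangle, in which the tangle has become again three twists around a central face, with one end of each pointing to that face and joined to the two others, as follows. \quad (a) If $b$ is odd, the twists are in counterclockwise order a single crossing $A$ with outer legs $3,4$, a twist $B$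 of size $b$ with outer legs $1,2$, and a twist $C$ of size $c$ with outer legs $5,6$. \quad (b) If $b$ is even, the twists are in counterclockwise order a single crossing $A$ with outer legs $5,6$, a twist $C$ of size $c$ with outer legs $3,4$, and a twist $B$ of size $b$ with outer legs $1,2$. Here $A,B,C$ represent the vertices of an $ots$-triangle of $G$, and both conclusions of (1) about collapsing and about the condensation hold for this $D'$ and this triangle. -/

import Mathlib

open Equiv

/-!
Plane graphs and link diagrams are represented by combinatorial maps.  The elements of the
finite type `X` are the darts (edge-ends).  The permutation `σ` sends a dart to the next dart,
counterclockwise, at the same vertex; the involution `α` sends a dart to the other end of its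
edge.  Vertices are the cycles of `σ`, edges the cycles of `α`, faces the cycles of
`φ = σ⁻¹ ∘ α` (the face lying to the left of a dart).
-/

section FirstReturn

variable {X : Type*} [Finite X]

theorem exists_return (τ : Perm X) (p : X → Prop) (x : {x // p x}) :
    ∃ n : ℕ, p ((τ ^ (n + 1)) x) := by
  refine ⟨orderOf τ - 1, ?_⟩
  have h : orderOf τ - 1 + 1 = orderOf τ := Nat.sub_add_cancel (orderOf_pos τ)
  rw [h, pow_orderOf_eq_one]
  exact x.2

open Classical in
/-- The first point of the orbit `τ x, τ² x, …` that satisfies `p`. -/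
noncomputable def firstReturnFun (τ : Perm X) (p : X → Prop) (x : {x // p x}) : {x // p x} :=
  ⟨(τ ^ (Nat.find (exists_return τ p x) + 1)) x, Nat.find_spec (exists_return τ p x)⟩

theorem firstReturnFun_injective (τ : Perm X) (p : X → Prop) :
    Function.Injective (firstReturnFun τ p) := by
  classical
  have key : ∀ x y : {x // p x},
      Nat.find (exists_return τ p x) ≤ Nat.find (exists_return τ p y) →
      firstReturnFun τ p x = firstReturnFun τ p y → x = y := by
    intro x y hle h
    have h' := congrArg Subtype.val h
    simp only [firstReturnFun] at h'
    obtain ⟨d, hd⟩ := Nat.exists_eq_add_of_le hle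
    have e : Nat.find (exists_return τ p y) + 1
        = (Nat.find (exists_return τ p x) + 1) + d := by omega
    have e2 : (τ ^ (Nat.find (exists_return τ p y) + 1)) (y : X)
        = (τ ^ (Nat.find (exists_return τ p x) + 1)) ((τ ^ d) y) := by
      rw [← Perm.mul_apply, ← pow_add, e]
    have h2 : (x : X) = (τ ^ d) y :=
      (τ ^ (Nat.find (exists_return τ p x) + 1)).injective (h'.trans e2)
    cases d with
    | zero => exact Subtype.ext (by simpa using h2)
    | succ m =>
      exfalso
      have hm : m < Nat.find (exists_return τ p y) := by omega
      exact Nat.find_min (exists_return τ p y) hm (h2 ▸ x.2)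
  intro x y h
  rcases le_total (Nat.find (exists_return τ p x)) (Nat.find (exists_return τ p y)) with hle | hle
  · exact key x y hle h
  · exact (key y x hle h.symm).symm

/-- The first return permutation of `τ` on the points that satisfy `p`. -/
noncomputable def firstReturn (τ : Perm X) (p : X → Prop) : Perm {x // p x} :=
  Equiv.ofBijective (firstReturnFun τ p)
    (Finite.injective_iff_bijective.mp (firstReturnFun_injective τ p))

end FirstReturn

/-- A combinatorial map (a graph embedded in an oriented surface) with set of darts `X`. -/
structure CMap (X : Type*) where
  /-- next dart, counterclockwise, at the same vertex -/
  σ : Perm X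
  /-- other end of the edge -/
  α : Perm X
  α_invol : ∀ x, α (α x) = x
  α_ne : ∀ x, α x ≠ x

namespace CMap

variable {X Y : Type*}

/-- The next dart along the face that lies to the left of a dart. -/
def φ (M : CMap X) : Perm X := M.σ⁻¹ * M.α

/-- Two darts have the same initial vertex. -/
def SameVertex (M : CMap X) (x y : X) : Prop := M.σ.SameCycle x y

/-- Every vertex has degree four. -/
def FourRegular (M : CMap X) : Prop :=
  ∀ x, M.σ (M.σ (M.σ (M.σ x))) = x ∧ M.σ (M.σ x) ≠ x

/-- Euler's formula `V + F = E + 2`: a connected map with this property lies in the sphere. -/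
def EulerSphere (M : CMap X) : Prop :=
  Nat.card (Quotient (Perm.SameCycle.setoid M.σ)) + Nat.card (Quotient (Perm.SameCycle.setoid M.φ))
    = Nat.card (Quotient (Perm.SameCycle.setoid M.α)) + 2

/-- Deleting the (at most two) edges of the darts `e`, `f` leaves a connected graph. -/
def ConnectedAvoiding (M : CMap X) (e f : X) : Prop :=
  ∀ x y, Relation.EqvGen
    (fun u v => v = M.σ u ∨ (v = M.α u ∧ u ≠ e ∧ u ≠ M.α e ∧ u ≠ f ∧ u ≠ M.α f)) x y

/-- The graph is connected and remains so after the deletion of any one or two edges. -/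
def ThreeEdgeConnected (M : CMap X) : Prop := ∀ e f, M.ConnectedAvoiding e f

/-- No loops and no multiple edges. -/
def IsSimple (M : CMap X) : Prop :=
  (∀ x, ¬ M.SameVertex x (M.α x)) ∧
  ∀ x y, M.SameVertex x y → M.SameVertex (M.α x) (M.α y) → x = y

/-- The vertices of the darts `x` and `y` are joined by at least two edges. -/
def MultiplyConnected (M : CMap X) (x y : X) : Prop :=
  ∃ u v, u ≠ v ∧ M.SameVertex x u ∧ M.SameVertex x v ∧
    M.SameVertex y (M.α u) ∧ M.SameVertex y (M.α v)

/-- The face to the left of `x` is bounded by a 2-(sub)group: it has degree two and its two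
vertices are distinct. -/
def IsBigon (M : CMap X) (x : X) : Prop := M.φ (M.φ x) = x ∧ ¬ M.SameVertex x (M.φ x)

/-- The darts of all edges that belong to 2-(sub)groups. -/
def bigonDarts (M : CMap X) : Set X := {x | M.IsBigon x ∨ M.IsBigon (M.α x)}

/-- Isomorphism of maps that preserves the orientation of the surface. -/
def Iso (M : CMap X) (N : CMap Y) : Prop :=
  ∃ e : X ≃ Y, (∀ x, e (M.σ x) = N.σ (e x)) ∧ ∀ x, e (M.α x) = N.α (e x)

/-- Keep all vertices, and let the edge-ends be permuted by `ρ`: wherever the edge joined `x`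
to `y` it now joins `ρ x` to `ρ y`. -/
def rewire (M : CMap X) (ρ : Perm X) : CMap X where
  σ := M.σ
  α := ρ * M.α * ρ⁻¹
  α_invol x := by simp [Perm.mul_apply, M.α_invol]
  α_ne x h := M.α_ne (ρ⁻¹ x) (by
    have := congrArg (ρ⁻¹ : Perm X) h
    simpa [Perm.mul_apply] using this)

/-- An `ots`-triangle: the face to the left of `t` is a 3-cycle, no two of whose vertices are
multiply connected. -/
def IsOtsTriangle (M : CMap X) (t : X) : Prop :=
  M.φ (M.φ (M.φ t)) = t ∧
  ¬ M.SameVertex t (M.φ t) ∧ ¬ M.SameVertex (M.φ t) (M.φ (M.φ t)) ∧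
  ¬ M.SameVertex (M.φ (M.φ t)) t ∧
  ¬ M.MultiplyConnected t (M.φ t) ∧ ¬ M.MultiplyConnected (M.φ t) (M.φ (M.φ t)) ∧
  ¬ M.MultiplyConnected (M.φ (M.φ t)) t

/-- Let `t₀, t₁, t₂` be the darts of the triangle with its interior on their left, and let
`pᵢ = σ² tᵢ`, `qᵢ = σ³ tᵢ` be the two darts that leave the triangle at the vertex of `tᵢ`.
Counterclockwise around the triangle the six legs are `p₀, q₀, p₁, q₁, p₂, q₂`; this permutation
is the half turn of the legs. -/
def otsPerm [DecidableEq X] (M : CMap X) (t : X) : Perm X :=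
  let p : X → X := fun x => M.σ (M.σ x)
  let q : X → X := fun x => M.σ (M.σ (M.σ x))
  swap (p t) (q (M.φ t)) * swap (p (M.φ t)) (q (M.φ (M.φ t))) * swap (p (M.φ (M.φ t))) (q t)

/-- The `ots` operation on a triangle of a 4-regular plane graph.  If the edges that arrive
at the three vertices of the triangle are, in cyclic order, `(6,1), (5,4), (3,2)`, then the
edges that arrive at the three vertices of the new triangle are `(6,5), (4,3), (2,1)`.
As the triangle with its six legs is invariant under rotations by a third of a full turn,
the new triangle is placed by turning it through half a turn. -/
def ots [DecidableEq X] (M : CMap X) (t : X) : CMap X := M.rewire (M.otsPerm t)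

/-- The darts that survive when the edges of the darts in `S` are collapsed. -/
def Rest (M : CMap X) (S : Set X) : Type _ := {x : X // ¬ (x ∈ S ∨ M.α x ∈ S)}

instance [DecidableEq X] (M : CMap X) (S : Set X) : DecidableEq (M.Rest S) :=
  inferInstanceAs (DecidableEq {x : X // ¬ (x ∈ S ∨ M.α x ∈ S)})

open Classical in
/-- The involution `α` on the edges that meet `S`, the identity on all other darts. -/
noncomputable def crossPerm (M : CMap X) (S : Set X) : Perm X :=
  Function.Involutive.toPerm (fun x => if x ∈ S ∨ M.α x ∈ S then M.α x else x) (by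
    intro x
    dsimp only
    by_cases h : x ∈ S ∨ M.α x ∈ S
    · have h' : M.α x ∈ S ∨ M.α (M.α x) ∈ S := by rw [M.α_invol]; exact h.symm
      rw [if_pos h, if_pos h', M.α_invol]
    · rw [if_neg h, if_neg h])

/-- The result of shrinking all edges of the darts in `S`: the vertices that they join are
merged, and the cyclic order at a new vertex is obtained by walking counterclockwise around
the connected set of shrunken edges. -/
noncomputable def collapse [Finite X] (M : CMap X) (S : Set X) : CMap (M.Rest S) where
  σ := firstReturn (M.σ * M.crossPerm S) (fun x => ¬ (x ∈ S ∨ M.α x ∈ S))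
  α := Function.Involutive.toPerm
    (fun x => ⟨M.α x.1, by rw [M.α_invol]; exact fun h => x.2 h.symm⟩)
    (fun x => Subtype.ext (M.α_invol x.1))
  α_invol x := Subtype.ext (M.α_invol x.1)
  α_ne x h := M.α_ne x.1 (congrArg Subtype.val h)

/-- The condensation: every group (maximal chain of 2-subgroups) is replaced by one vertex. -/
noncomputable def condensation [Finite X] (M : CMap X) : CMap (M.Rest M.bigonDarts) :=
  M.collapse M.bigonDarts

end CMap

/-- A link diagram: a 4-regular map with, at each crossing, one of the two pairs of opposite
darts marked as belonging to the overcrossing strand. -/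
structure Diagram (X : Type*) extends CMap X where
  four : toCMap.FourRegular
  isOver : X → Bool
  isOver_σ : ∀ x, isOver (σ x) = !isOver x

namespace Diagram

variable {X : Type*}

/-- Along every edge one passes from an overcrossing to an undercrossing or conversely. -/
def Alternating (D : Diagram X) : Prop := ∀ x, D.isOver (D.α x) = !D.isOver x

/-- No nugatory crossing: no face occupies two opposite corners of a crossing. -/
def Reduced (D : Diagram X) : Prop := ∀ x, ¬ D.φ.SameCycle x (D.σ (D.σ x))

/-- A nonempty reduced alternating diagram of a prime link on the sphere.  A diagram is prime
if a simple closed curve that meets it in two points of edges cuts off only a trivial arc,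
that is, if its graph is 3-edge-connected. -/
structure IsReducedAlternatingPrime (D : Diagram X) : Prop where
  nonempty : Nonempty X
  sphere : D.EulerSphere
  prime : D.ThreeEdgeConnected
  alternating : D.Alternating
  reduced : D.Reduced

open Classical in
/-- Permute the edge-ends by `ρ`, and exchange over and under at the crossings that meet `V`. -/
noncomputable def rewire (D : Diagram X) (ρ : Perm X) (V : Set X) : Diagram X where
  toCMap := D.toCMap.rewire ρ
  four := D.four
  isOver x := if ∃ v ∈ V, D.SameVertex v x then !D.isOver x else D.isOver x
  isOver_σ x := by
    have h : (∃ v ∈ V, D.SameVertex v (D.σ x)) ↔ ∃ v ∈ V, D.SameVertex v x := by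
      simp only [CMap.SameVertex, Perm.sameCycle_apply_right]
    have hσ : (D.toCMap.rewire ρ).σ x = D.σ x := rfl
    rw [hσ]
    simp only [h, D.isOver_σ]
    split_ifs <;> rfl

/-- Rename the darts by `e`. -/
def relabel (D : Diagram X) (e : Perm X) : Diagram X where
  σ := e * D.σ * e⁻¹
  α := e * D.α * e⁻¹
  α_invol x := by simp [Perm.mul_apply, D.α_invol]
  α_ne x h := D.α_ne (e⁻¹ x) (by
    have := congrArg (e⁻¹ : Perm X) h
    simpa [Perm.mul_apply] using this)
  four x := by
    have h := D.four (e⁻¹ x)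
    refine ⟨by simpa [Perm.mul_apply, Equiv.Perm.inv_def, Equiv.eq_symm_apply] using h.1, fun h' => h.2 ?_⟩
    have := congrArg (e⁻¹ : Perm X) h'
    simpa [Perm.mul_apply] using this
  isOver x := D.isOver (e⁻¹ x)
  isOver_σ x := by simp [Perm.mul_apply, D.isOver_σ]

/-! A twist of `k` crossings is drawn as a horizontal row.  It is given by the upper left dart
`l` of its first crossing; at the crossing with upper left dart `x` the lower left, lower right
and upper right darts are `σ x`, `σ² x`, `σ³ x`. -/

/-- The upper left dart of the `i`-th crossing of the row that starts at `l`. -/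
def rowDart (D : Diagram X) (l : X) (i : ℕ) : X := ((D.α * D.σ⁻¹) ^ i) l

/-- Upper left end of a row. -/
def nw (_D : Diagram X) (l : X) : X := l

/-- Lower left end of a row. -/
def sw (D : Diagram X) (l : X) : X := D.σ l

/-- Lower right end of a row of `k` crossings. -/
def se (D : Diagram X) (l : X) (k : ℕ) : X := D.σ (D.σ (D.rowDart l (k - 1)))

/-- Upper right end of a row of `k` crossings. -/
def ne (D : Diagram X) (l : X) (k : ℕ) : X := D.σ (D.σ (D.σ (D.rowDart l (k - 1))))

/-- `k` distinct crossings, consecutive ones being joined by the two edges of a 2-subgroup. -/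
def IsTwist (D : Diagram X) (l : X) (k : ℕ) : Prop :=
  1 ≤ k ∧
  (∀ i, i + 1 < k → D.IsBigon (D.σ (D.σ (D.rowDart l i)))) ∧
  ∀ i j, i < k → j < k → D.SameVertex (D.rowDart l i) (D.rowDart l j) → i = j

/-- All darts at the crossings of a twist. -/
def twistDarts (D : Diagram X) (l : X) (k : ℕ) : Set X :=
  {x | ∃ i < k, D.SameVertex (D.rowDart l i) x}

/-- A crossing that belongs to no 2-subgroup. -/
def IsLoner (D : Diagram X) (x : X) : Prop := ∀ y, D.SameVertex x y → ¬ D.IsBigon y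

/-- A group of size `k`: a twist of `k` crossings that is not part of a longer one. -/
def IsGroup (D : Diagram X) (l : X) (k : ℕ) : Prop :=
  D.IsTwist l k ∧ ¬ D.IsBigon l ∧ ¬ D.IsBigon (D.se l k) ∧ (k = 1 → D.IsLoner l)

/-- The `T` operation: the group, as a 4-tangle, is cut out, turned by a quarter turn, and
rejoined; over and under are exchanged in it so that the diagram stays alternating. -/
noncomputable def turn [DecidableEq X] (D : Diagram X) (l : X) (k : ℕ) : Diagram X :=
  D.rewire (List.formPerm [D.nw l, D.sw l, D.se l k, D.ne l k]) {x | ∃ i < k, x = D.rowDart l i}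

/-- The `OTS` operation: a strand of a triangle is moved across the opposite crossing, and over
and under are exchanged at the three crossings so that the diagram stays alternating. -/
noncomputable def OTS [DecidableEq X] (D : Diagram X) (t : X) : Diagram X :=
  D.rewire (D.otsPerm t) {t, D.φ t, D.φ (D.φ t)}

/-- One `T` or `OTS` operation inside the tangle with set of darts `V`, or a change of the names
of the darts of `V` (diagrams are considered up to isotopy relative to the outside of `V`). -/
inductive Move [DecidableEq X] (V : Set X) : Diagram X → Diagram X → Prop
  | T (D : Diagram X) (l : X) (k : ℕ) : 2 ≤ k → D.IsGroup l k → D.twistDarts l k ⊆ V →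
      Move V D (D.turn l k)
  | OTS (D : Diagram X) (t : X) : D.IsOtsTriangle t →
      (∀ x, D.SameVertex t x ∨ D.SameVertex (D.φ t) x ∨ D.SameVertex (D.φ (D.φ t)) x → x ∈ V) →
      Move V D (D.OTS t)
  | isotopy (D : Diagram X) (e : Perm X) : (∀ x, x ∉ V → e x = x) → Move V D (D.relabel e)

/-- `D'` is obtained from `D` by finitely many `T` and `OTS` operations inside `V`. -/
def Transforms [DecidableEq X] (V : Set X) (D D' : Diagram X) : Prop :=
  Relation.ReflTransGen (Move V) D D'

/-- Three disjoint twists in counterclockwise order around a central face: the right ends of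
each one are joined to right ends of the two others, so that the left ends are the six legs
of the configuration. -/
def IsTriangle (D : Diagram X) (l₀ : X) (k₀ : ℕ) (l₁ : X) (k₁ : ℕ) (l₂ : X) (k₂ : ℕ) : Prop :=
  D.IsTwist l₀ k₀ ∧ D.IsTwist l₁ k₁ ∧ D.IsTwist l₂ k₂ ∧
  Disjoint (D.twistDarts l₀ k₀) (D.twistDarts l₁ k₁) ∧
  Disjoint (D.twistDarts l₁ k₁) (D.twistDarts l₂ k₂) ∧
  Disjoint (D.twistDarts l₂ k₂) (D.twistDarts l₀ k₀) ∧
  D.α (D.se l₀ k₀) = D.ne l₁ k₁ ∧ D.α (D.se l₁ k₁) = D.ne l₂ k₂ ∧ D.α (D.se l₂ k₂) = D.ne l₀ k₀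

/-- `D'` has the same crossings and the same 2-subgroup edges as `D`, and agrees with `D`
outside the tangle with set of darts `V`. -/
def AgreesOutside (V : Set X) (D D' : Diagram X) : Prop :=
  D'.σ = D.σ ∧ (∀ x ∈ D.bigonDarts, D'.α x = D.α x) ∧
  (∀ x, x ∉ V → D'.isOver x = D.isOver x) ∧
  ∀ x, x ∉ V → D.α x ∉ V → D'.α x = D.α x

/-- The outer ends of the legs of a triangle of twists, numbered clockwise from the leg at the
upper left end of the first twist. -/
def leg (D : Diagram X) (l₀ l₁ l₂ : X) : Fin 6 → X :=
  ![D.α (D.nw l₀), D.α (D.sw l₂), D.α (D.nw l₂), D.α (D.sw l₁), D.α (D.nw l₁), D.α (D.sw l₀)]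

/-- The darts of the condensation of `D` are those darts of `D` that lie on no 2-subgroup edge.
Let `t` be a dart of a triangle of the condensation.  The two legs that leave the triangle at the
two ends of some side of it, on the outer side of that side, arrive at neighbouring darts of one
crossing of `D`. -/
def HasMeetingLegs [Finite X] (D : Diagram X) (t : D.Rest D.bigonDarts) : Prop :=
  let G := D.condensation
  let Meet : D.Rest D.bigonDarts → Prop := fun s =>
    D.σ (D.α (G.σ (G.σ (G.φ s))).1) = D.α (G.σ (G.σ (G.σ s))).1
  Meet t ∨ Meet (G.φ t) ∨ Meet (G.φ (G.φ t))

end Diagram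

/-! The heart is a manipulation of three twists around a face. If `A` and `B` are single crossings
and `C` is a row, apply `OTS` to `A`, `B` and the innermost crossing of `C`. The crossing just
passed is left behind, while `A` and `B` now form a triangle with the rest of `C`. Iterating, the
pair slides along the whole row, and the crossings left behind line up as the transported twist
(`Tri.pass`). If `B` is a longer twist, its innermost crossing is used in place of `B`, and `C` is
afterwards turned by `T` (`Tri.pass_turn`). This deposits one crossing of `B` on the far side, and
the rest of `B` forms a triangle with a single crossing and `C` in the opposite cyclic order
(`Tri.step`, `Tri.step'`). Induction on the size of `B`, for both cyclic orders at once, finishes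
the construction (`Tri.transform`): the deposited crossing prolongs the transported rest of `B`.
Every step reverses the cyclic order, which is why the parity of `b` decides the outcome.

Each operation must preserve reduced alternating prime diagrams. Crossings and edges keep their
numbers, and faces are counted by comparing the arcs in which faces cross the tangle
(`card_cycles_eq_of_runs`), so Euler's formula survives. Primality is treated through 2-colourings
of the crossings with at most two bichromatic edges: a cut inside the new tangle would yield a cut
of the old diagram (`ots_threeEdgeConnected`, `Row.threeEdgeConnected`). Absence of nugatory
crossings then follows from genus zero: a face with two opposite corners at one crossing gives a
closed curve, which by the vanishing of the first homology of the sphere (`CMap.exists_potential`)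
separates the graph along two edges (`reduced_of_sphere`).

For the condensation, the darts of the tangle are renamed so that the new diagram has the crossings
and the bigon edges of the old one (`Tri.exists_transformed`). Collapsing the same bigons gives the
same cyclic orders at the vertices, and only the six legs and three sides of the triangle have to be
compared with `ots(G)` (`Tri.collapse_iso`). For even `b` the vertices of `A` and `C` exchange their
roles. A new bigon can arise only where the two outer legs of one new twist arrive at neighbouring
darts (`Tri.bigon_cases`); this is what the hypothesis on meeting legs excludes.

A general triangle of `G` with a loner is brought to the explicit position by turning those groups
which show a long side to the face. Since `G` is simple, such a turn does not change the
condensation (`IsGroup.turn_spec`). -/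

theorem Equiv.Perm.sameCycle_iff_of_pow_four {X : Type*} (σ : Perm X)
    (h : ∀ x, σ (σ (σ (σ x))) = x) (x y : X) :
    σ.SameCycle x y ↔ y = x ∨ y = σ x ∨ y = σ (σ x) ∨ y = σ (σ (σ x)) := by
  have h4 : σ ^ (4 : ℤ) = 1 := by
    ext z
    have := h z
    rw [zpow_ofNat]; simpa [pow_succ, Perm.mul_apply] using this
  constructor
  · rintro ⟨n, rfl⟩
    have e : σ ^ n = σ ^ (n % 4) := by
      conv_lhs => rw [← Int.emod_add_mul_ediv n 4, zpow_add, zpow_mul, h4, one_zpow, mul_one]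
    rw [e]
    have h1 := Int.emod_nonneg n (by norm_num : (4 : ℤ) ≠ 0)
    have h2 := Int.emod_lt_of_pos n (by norm_num : (0 : ℤ) < 4)
    generalize n % 4 = m at h1 h2
    interval_cases m
    · left; simp
    · right; left; simp
    · right; right; left; rw [zpow_ofNat]; simp [pow_succ, Perm.mul_apply]
    · right; right; right; rw [zpow_ofNat]; simp [pow_succ, Perm.mul_apply]
  · rintro (rfl | rfl | rfl | rfl) <;> simp [Perm.sameCycle_apply_right, Perm.SameCycle.refl]

/-! ### Elementary identities at crossings and bigons -/

namespace Diagram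

variable {X : Type*} (E : Diagram X)

@[simp] theorem σ_four (x : X) : E.σ (E.σ (E.σ (E.σ x))) = x := (E.four x).1

@[simp] theorem α_α (x : X) : E.α (E.α x) = x := E.α_invol x

@[simp] theorem σ_ne_self (x : X) : E.σ x ≠ x := fun h => (E.four x).2 (by rw [h, h])

@[simp] theorem σσ_ne_self (x : X) : E.σ (E.σ x) ≠ x := (E.four x).2

@[simp] theorem σσσ_ne_self (x : X) : E.σ (E.σ (E.σ x)) ≠ x := fun h =>
  E.σ_ne_self x (by conv_lhs => rw [← h, E.σ_four])

theorem σ_symm_apply (x : X) : E.σ.symm x = E.σ (E.σ (E.σ x)) := by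
  rw [Equiv.symm_apply_eq, E.σ_four]

theorem σ_inv_apply (x : X) : E.σ⁻¹ x = E.σ (E.σ (E.σ x)) := E.σ_symm_apply x

theorem α_eq_iff {x y : X} : E.α x = y ↔ x = E.α y :=
  ⟨fun h => by rw [← h, E.α_α], fun h => by rw [h, E.α_α]⟩

theorem φ_apply (x : X) : E.φ x = E.σ (E.σ (E.σ (E.α x))) := by
  rw [CMap.φ, Perm.mul_apply, E.σ_inv_apply]

theorem sameVertex_iff (x y : X) : E.SameVertex x y ↔
    y = x ∨ y = E.σ x ∨ y = E.σ (E.σ x) ∨ y = E.σ (E.σ (E.σ x)) :=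
  Perm.sameCycle_iff_of_pow_four _ E.σ_four x y

variable {E}

theorem SameVertex.refl (x : X) : E.SameVertex x x := Perm.SameCycle.refl _ _

theorem SameVertex.symm {x y : X} (h : E.SameVertex x y) : E.SameVertex y x :=
  Perm.SameCycle.symm h

theorem SameVertex.trans {x y z : X} (h : E.SameVertex x y) (h' : E.SameVertex y z) :
    E.SameVertex x z := Perm.SameCycle.trans h h'

@[simp] theorem sameVertex_σ_left {x y : X} : E.SameVertex (E.σ x) y ↔ E.SameVertex x y :=
  Perm.sameCycle_apply_left

@[simp] theorem sameVertex_σ_right {x y : X} : E.SameVertex x (E.σ y) ↔ E.SameVertex x y :=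
  Perm.sameCycle_apply_right

variable (E)

/-- The working form of a bigon: neighbouring darts lead to neighbouring darts in the opposite
order. It avoids `φ` and is stable under changes of `α` elsewhere. -/
theorem isBigon_iff (x : X) :
    E.IsBigon x ↔ E.α x = E.σ (E.α (E.σ x)) ∧ ¬ E.SameVertex x (E.α x) := by
  have h1 : E.φ (E.φ x) = x ↔ E.α x = E.σ (E.α (E.σ x)) := by
    rw [E.φ_apply, E.φ_apply]
    constructor
    · intro h
      have h2 := congrArg E.σ h
      rw [E.σ_four, E.α_eq_iff] at h2
      rw [← h2, E.σ_four]
    · intro h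
      rw [h, E.σ_four, E.α_α, E.σ_four]
  have h2 : E.SameVertex x (E.φ x) ↔ E.SameVertex x (E.α x) := by
    rw [E.φ_apply]; simp
  rw [CMap.IsBigon, h1, h2]

variable {E}

theorem bigon_φ {x : X} (h : E.IsBigon x) : E.IsBigon (E.φ x) := by
  obtain ⟨h1, h2⟩ := h
  exact ⟨by rw [h1], fun h3 => h2 (by rw [h1] at h3; exact SameVertex.symm h3)⟩

/-- The other side of a bigon. -/
theorem bigon_other {x : X} (h : E.IsBigon x) : E.IsBigon (E.α (E.σ x)) := by
  have h1 := ((E.isBigon_iff x).1 h).1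
  have h2 := bigon_φ h
  rwa [E.φ_apply, h1, E.σ_four] at h2

/-- The two faces along the edge of `x` occupy the two corners beside `x`, because `φ (α x) = σ³ x`.
So membership can be tested at the crossing of `x` alone. -/
theorem mem_bigonDarts_iff {x : X} :
    x ∈ E.bigonDarts ↔ E.IsBigon x ∨ E.IsBigon (E.σ (E.σ (E.σ x))) := by
  constructor
  · rintro (h | h)
    · exact Or.inl h
    · right
      have := bigon_φ h
      rwa [E.φ_apply, E.α_α] at this
  · rintro (h | h)
    · exact Or.inl h
    · right
      have := bigon_other h
      rwa [E.σ_four] at this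

theorem α_mem_bigonDarts {x : X} : E.α x ∈ E.bigonDarts ↔ x ∈ E.bigonDarts := by
  simp only [CMap.bigonDarts, Set.mem_ofPred_eq, E.α_α, or_comm]

theorem rest_iff {x : X} :
    ¬ (x ∈ E.bigonDarts ∨ E.α x ∈ E.bigonDarts) ↔ x ∉ E.bigonDarts := by
  rw [α_mem_bigonDarts, or_self]

/-! ### Rows -/

variable (E)

@[simp] theorem rowDart_zero (l : X) : E.rowDart l 0 = l := rfl

theorem rowDart_succ (l : X) (i : ℕ) :
    E.rowDart l (i + 1) = E.α (E.σ (E.σ (E.σ (E.rowDart l i)))) := by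
  rw [rowDart, pow_succ', Perm.mul_apply, Perm.mul_apply, E.σ_inv_apply]; rfl

theorem rowDart_add (l : X) (i j : ℕ) :
    E.rowDart l (i + j) = E.rowDart (E.rowDart l i) j := by
  rw [rowDart, rowDart, rowDart, add_comm, pow_add, Perm.mul_apply]

/-- The upper inner edges are built into `rowDart`, and distinct crossings already give each bigon
two distinct vertices. Hence only the lower inner edges need to be recorded. -/
theorem isTwist_iff (l : X) (k : ℕ) : E.IsTwist l k ↔ 1 ≤ k ∧
    (∀ i, i + 1 < k → E.α (E.σ (E.σ (E.rowDart l i))) = E.σ (E.rowDart l (i + 1))) ∧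
    ∀ i j, i < k → j < k → E.SameVertex (E.rowDart l i) (E.rowDart l j) → i = j := by
  rw [IsTwist]
  refine and_congr_right fun _ => ⟨fun ⟨h1, h2⟩ => ⟨fun i hi => ?_, h2⟩,
    fun ⟨h1, h2⟩ => ⟨fun i hi => ?_, h2⟩⟩
  · have := ((E.isBigon_iff _).1 (h1 i hi)).1
    rw [this, rowDart_succ]
  · rw [isBigon_iff, h1 i hi, ← rowDart_succ]
    refine ⟨rfl, fun h => ?_⟩
    have := h2 i (i + 1) (by omega) hi (by simpa using h)
    omega

theorem isTwist_one (l : X) : E.IsTwist l 1 :=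
  ⟨le_rfl, fun i hi => by omega, fun i j hi hj _ => by omega⟩

@[simp] theorem se_one (l : X) : E.se l 1 = E.σ (E.σ l) := rfl
@[simp] theorem ne_one (l : X) : E.ne l 1 = E.σ (E.σ (E.σ l)) := rfl

theorem ne_eq_σ_se (l : X) (k : ℕ) : E.ne l k = E.σ (E.se l k) := rfl

@[simp] theorem se_succ (l : X) (k : ℕ) : E.se l (k + 1) = E.σ (E.σ (E.rowDart l k)) := rfl
@[simp] theorem ne_succ (l : X) (k : ℕ) : E.ne l (k + 1) = E.σ (E.σ (E.σ (E.rowDart l k))) := rfl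

theorem mem_twistDarts {l x : X} {k : ℕ} :
    x ∈ E.twistDarts l k ↔ ∃ i < k, E.SameVertex (E.rowDart l i) x := Iff.rfl

@[simp] theorem twistDarts_one (l : X) : E.twistDarts l 1 = {x | E.SameVertex l x} := by
  ext x
  simp [mem_twistDarts]

theorem twistDarts_succ (l : X) (k : ℕ) :
    E.twistDarts l (k + 1) = E.twistDarts l k ∪ {x | E.SameVertex (E.rowDart l k) x} := by
  ext x
  simp only [mem_twistDarts, Set.mem_union, Set.mem_ofPred_eq]
  constructor
  · rintro ⟨i, hi, h⟩
    rcases Nat.lt_succ_iff_lt_or_eq.1 hi with h' | rfl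
    · exact Or.inl ⟨i, h', h⟩
    · exact Or.inr h
  · rintro (⟨i, hi, h⟩ | h)
    · exact ⟨i, by omega, h⟩
    · exact ⟨k, by omega, h⟩

@[simp] theorem σ_mem_twistDarts {l x : X} {k : ℕ} :
    E.σ x ∈ E.twistDarts l k ↔ x ∈ E.twistDarts l k := by
  simp [mem_twistDarts]

theorem rowDart_mem {l : X} {i k : ℕ} (h : i < k) : E.rowDart l i ∈ E.twistDarts l k :=
  ⟨i, h, SameVertex.refl _⟩

theorem start_mem {l : X} {k : ℕ} (h : 1 ≤ k) : l ∈ E.twistDarts l k :=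
  ⟨0, h, SameVertex.refl _⟩

theorem se_mem {l : X} {k : ℕ} (h : 1 ≤ k) : E.se l k ∈ E.twistDarts l k :=
  ⟨k - 1, by omega, by simp [se, SameVertex.refl]⟩

theorem ne_mem {l : X} {k : ℕ} (h : 1 ≤ k) : E.ne l k ∈ E.twistDarts l k :=
  ⟨k - 1, by omega, by simp [ne, SameVertex.refl]⟩

theorem twistDarts_mono {l : X} {j k : ℕ} (h : j ≤ k) : E.twistDarts l j ⊆ E.twistDarts l k :=
  fun _ ⟨i, hi, hx⟩ => ⟨i, by omega, hx⟩

theorem twistDarts_succ' (l : X) (k : ℕ) :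
    E.twistDarts l (k + 1) = {x | E.SameVertex l x} ∪ E.twistDarts (E.rowDart l 1) k := by
  ext x
  simp only [mem_twistDarts, Set.mem_union, Set.mem_ofPred_eq]
  constructor
  · rintro ⟨_ | i, hi, h⟩
    · exact Or.inl h
    · exact Or.inr ⟨i, by omega, by rwa [← rowDart_add, add_comm]⟩
  · rintro (h | ⟨i, hi, h⟩)
    · exact ⟨0, by omega, h⟩
    · exact ⟨i + 1, by omega, by rwa [← rowDart_add, add_comm] at h⟩

variable {E}

theorem IsTwist.pos {l : X} {k : ℕ} (h : E.IsTwist l k) : 1 ≤ k := h.1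

theorem IsTwist.prefix {l : X} {j k : ℕ} (h : E.IsTwist l k) (hj : 1 ≤ j) (hjk : j ≤ k) :
    E.IsTwist l j :=
  ⟨hj, fun i hi => h.2.1 i (by omega), fun i i' hi hi' => h.2.2 i i' (by omega) (by omega)⟩

theorem IsTwist.α_se {l : X} {k : ℕ} (h : E.IsTwist l k) {i : ℕ} (hi : i + 1 < k) :
    E.α (E.σ (E.σ (E.rowDart l i))) = E.σ (E.rowDart l (i + 1)) :=
  ((E.isTwist_iff l k).1 h).2.1 i hi

theorem IsTwist.inj {l : X} {k : ℕ} (h : E.IsTwist l k) {i j : ℕ} (hi : i < k) (hj : j < k)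
    (hs : E.SameVertex (E.rowDart l i) (E.rowDart l j)) : i = j := h.2.2 i j hi hj hs

theorem α_ne_rowDart (l : X) (i : ℕ) :
    E.α (E.σ (E.σ (E.σ (E.rowDart l i)))) = E.rowDart l (i + 1) := (E.rowDart_succ l i).symm

theorem α_rowDart_succ (l : X) (i : ℕ) :
    E.α (E.rowDart l (i + 1)) = E.σ (E.σ (E.σ (E.rowDart l i))) := by
  rw [rowDart_succ, E.α_α]

theorem IsTwist.α_sw {l : X} {k : ℕ} (h : E.IsTwist l k) {i : ℕ} (hi : i + 1 < k) :
    E.α (E.σ (E.rowDart l (i + 1))) = E.σ (E.σ (E.rowDart l i)) := by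
  rw [← h.α_se hi, E.α_α]

/-- A crossing joined to the left end of a twist prolongs it. -/
theorem IsTwist.cons {l z : X} {k : ℕ} (h : E.IsTwist l k) (h1 : E.α (E.σ (E.σ (E.σ z))) = l)
    (h2 : E.α (E.σ (E.σ z)) = E.σ l) (h3 : z ∉ E.twistDarts l k) : E.IsTwist z (k + 1) := by
  have hr : E.rowDart z 1 = l := by rw [E.rowDart_succ, rowDart_zero, h1]
  have hr' : ∀ i, E.rowDart z (i + 1) = E.rowDart l i := fun i => by
    rw [add_comm, E.rowDart_add, hr]
  refine (E.isTwist_iff _ _).2 ⟨by omega, ?_, ?_⟩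
  · rintro (_ | i) hi
    · rw [rowDart_zero, h2, hr]
    · rw [hr', hr', h.α_se (by omega)]
  · rintro (_ | i) (_ | j) hi hj hs
    · rfl
    · rw [hr'] at hs
      exact absurd ⟨j, by omega, hs.symm⟩ h3
    · rw [hr'] at hs
      exact absurd ⟨i, by omega, hs⟩ h3
    · rw [hr', hr'] at hs
      rw [h.inj (by omega) (by omega) hs]

theorem se_cons {l z : X} {k : ℕ} (hk : 1 ≤ k) (h1 : E.α (E.σ (E.σ (E.σ z))) = l) :
    E.se z (k + 1) = E.se l k := by
  have hr : E.rowDart z 1 = l := by rw [E.rowDart_succ, rowDart_zero, h1]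
  obtain ⟨k, rfl⟩ := Nat.exists_eq_add_of_le' hk
  rw [se_succ, se_succ, add_comm, E.rowDart_add, hr]

theorem twistDarts_cons {l z : X} {k : ℕ} (h1 : E.α (E.σ (E.σ (E.σ z))) = l) :
    E.twistDarts z (k + 1) = {x | E.SameVertex z x} ∪ E.twistDarts l k := by
  rw [twistDarts_succ', show E.rowDart z 1 = l by rw [E.rowDart_succ, rowDart_zero, h1]]

/-- Twists are preserved if the involution does not change on their inner edges. -/
theorem rowDart_congr {E' : Diagram X} (hσ : E'.σ = E.σ) {l : X} {k : ℕ}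
    (h3 : ∀ i, i + 1 < k → E'.α (E.σ (E.σ (E.σ (E.rowDart l i)))) =
      E.α (E.σ (E.σ (E.σ (E.rowDart l i))))) {i : ℕ} (hi : i < k) :
    E'.rowDart l i = E.rowDart l i := by
  induction i with
  | zero => rfl
  | succ i ih => rw [rowDart_succ, rowDart_succ, ih (by omega), hσ, h3 i hi]

theorem IsTwist.congr {E' : Diagram X} (hσ : E'.σ = E.σ) {l : X} {k : ℕ} (h : E.IsTwist l k)
    (h2 : ∀ i, i + 1 < k → E'.α (E.σ (E.σ (E.rowDart l i))) = E.α (E.σ (E.σ (E.rowDart l i))))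
    (h3 : ∀ i, i + 1 < k → E'.α (E.σ (E.σ (E.σ (E.rowDart l i)))) =
      E.α (E.σ (E.σ (E.σ (E.rowDart l i))))) : E'.IsTwist l k := by
  have hr : ∀ {i : ℕ}, i < k → E'.rowDart l i = E.rowDart l i := rowDart_congr hσ h3
  refine (E'.isTwist_iff _ _).2 ⟨h.pos, fun i hi => ?_, fun i j hi hj => ?_⟩
  · rw [hr hi, hr (by omega), hσ, h2 i hi, h.α_se hi]
  · rw [hr hi, hr hj, CMap.SameVertex, hσ]
    exact h.inj hi hj

theorem twistDarts_congr {E' : Diagram X} (hσ : E'.σ = E.σ) {l : X} {k : ℕ}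
    (h3 : ∀ i, i + 1 < k → E'.α (E.σ (E.σ (E.σ (E.rowDart l i)))) =
      E.α (E.σ (E.σ (E.σ (E.rowDart l i))))) : E'.twistDarts l k = E.twistDarts l k := by
  ext x
  simp only [mem_twistDarts]
  refine exists_congr fun i => and_congr_right fun hi => ?_
  rw [rowDart_congr hσ h3 hi, CMap.SameVertex, CMap.SameVertex, hσ]

theorem se_congr {E' : Diagram X} (hσ : E'.σ = E.σ) {l : X} {k : ℕ} (hk : 1 ≤ k)
    (h3 : ∀ i, i + 1 < k → E'.α (E.σ (E.σ (E.σ (E.rowDart l i)))) =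
      E.α (E.σ (E.σ (E.σ (E.rowDart l i))))) : E'.se l k = E.se l k := by
  rw [se, se, rowDart_congr hσ h3 (by omega), hσ]

/-- The darts of a twist are its four ends and the ends of its inner edges. -/
theorem IsTwist.dart_cases {l x : X} {k : ℕ} (h : E.IsTwist l k) (hx : x ∈ E.twistDarts l k) :
    x = l ∨ x = E.σ l ∨ x = E.se l k ∨ x = E.ne l k ∨
    ∃ i, i + 1 < k ∧ (x = E.σ (E.σ (E.rowDart l i)) ∨ x = E.σ (E.σ (E.σ (E.rowDart l i))) ∨
      x = E.rowDart l (i + 1) ∨ x = E.σ (E.rowDart l (i + 1))) := by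
  obtain ⟨i, hi, hs⟩ := hx
  rcases (E.sameVertex_iff _ _).1 hs with rfl | rfl | rfl | rfl
  · rcases i with _ | i
    · exact Or.inl rfl
    · exact Or.inr (Or.inr (Or.inr (Or.inr ⟨i, hi, Or.inr (Or.inr (Or.inl rfl))⟩)))
  · rcases i with _ | i
    · exact Or.inr (Or.inl rfl)
    · exact Or.inr (Or.inr (Or.inr (Or.inr ⟨i, hi, Or.inr (Or.inr (Or.inr rfl))⟩)))
  · by_cases h' : i + 1 < k
    · exact Or.inr (Or.inr (Or.inr (Or.inr ⟨i, h', Or.inl rfl⟩)))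
    · obtain rfl : k = i + 1 := by omega
      exact Or.inr (Or.inr (Or.inl rfl))
  · by_cases h' : i + 1 < k
    · exact Or.inr (Or.inr (Or.inr (Or.inr ⟨i, h', Or.inr (Or.inl rfl)⟩)))
    · obtain rfl : k = i + 1 := by omega
      exact Or.inr (Or.inr (Or.inr (Or.inl rfl)))

/-- The inner edges of a twist have both their ends in it. -/
theorem IsTwist.α_mem_of_inner {l x : X} {k : ℕ} (h : E.IsTwist l k) {i : ℕ} (hi : i + 1 < k)
    (hx : x = E.σ (E.σ (E.rowDart l i)) ∨ x = E.σ (E.σ (E.σ (E.rowDart l i))) ∨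
      x = E.rowDart l (i + 1) ∨ x = E.σ (E.rowDart l (i + 1))) : E.α x ∈ E.twistDarts l k := by
  have m0 : E.rowDart l i ∈ E.twistDarts l k := E.rowDart_mem (by omega)
  have m1 : E.rowDart l (i + 1) ∈ E.twistDarts l k := E.rowDart_mem hi
  rcases hx with rfl | rfl | rfl | rfl
  · rw [h.α_se hi]; simpa
  · rw [α_ne_rowDart]; simpa
  · rw [α_rowDart_succ]; simpa
  · rw [h.α_sw hi]; simpa

/-- The same twist read from the other end. -/
theorem rowDart_reverse {l : X} {k : ℕ} (h : E.IsTwist l k) {i : ℕ} (hi : i < k) :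
    E.rowDart (E.se l k) i = E.σ (E.σ (E.rowDart l (k - 1 - i))) := by
  induction i with
  | zero => rfl
  | succ i ih =>
    obtain ⟨m, hm⟩ : ∃ m, k - 1 - i = m + 1 := ⟨k - 1 - i - 1, by omega⟩
    rw [rowDart_succ, ih (by omega), E.σ_four, hm, h.α_sw (by omega)]
    congr 3
    omega

theorem IsTwist.reverse {l : X} {k : ℕ} (h : E.IsTwist l k) : E.IsTwist (E.se l k) k := by
  refine (E.isTwist_iff _ _).2 ⟨h.pos, fun i hi => ?_, fun i j hi hj hs => ?_⟩
  · obtain ⟨m, hm⟩ : ∃ m, k - 1 - i = m + 1 := ⟨k - 1 - i - 1, by omega⟩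
    rw [rowDart_reverse h hi, rowDart_reverse h (by omega), E.σ_four, hm, α_rowDart_succ]
    congr 4
    omega
  · rw [rowDart_reverse h hi, rowDart_reverse h hj] at hs
    have := h.inj (i := k - 1 - i) (j := k - 1 - j) (by omega) (by omega) (by simpa using hs)
    omega

theorem IsTwist.se_se {l : X} {k : ℕ} (h : E.IsTwist l k) : E.se (E.se l k) k = l := by
  have := h.pos
  rw [se, rowDart_reverse h (by omega)]
  simp

theorem IsTwist.ne_se {l : X} {k : ℕ} (h : E.IsTwist l k) : E.ne (E.se l k) k = E.σ l := by
  rw [ne_eq_σ_se, h.se_se]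

theorem IsTwist.twistDarts_reverse {l : X} {k : ℕ} (h : E.IsTwist l k) :
    E.twistDarts (E.se l k) k = E.twistDarts l k := by
  ext x
  constructor
  · rintro ⟨i, hi, hs⟩
    rw [rowDart_reverse h hi] at hs
    exact ⟨k - 1 - i, by omega, by simpa using hs⟩
  · rintro ⟨i, hi, hs⟩
    refine ⟨k - 1 - i, by omega, ?_⟩
    rw [rowDart_reverse h (by omega), show k - 1 - (k - 1 - i) = i by omega]
    simpa using hs

end Diagram

/-! ### First returns and numbers of cycles -/

section Cycles

variable {X : Type*}

/-- Mostly used with `β = Prop`: a set invariant under `τ` is a union of cycles. -/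
theorem Equiv.Perm.SameCycle.map_eq {β : Type*} {τ : Perm X} {h : X → β} (hh : ∀ x, h (τ x) = h x)
    {x y : X} (hxy : τ.SameCycle x y) : h x = h y := by
  obtain ⟨n, rfl⟩ := hxy
  induction n using Int.induction_on with
  | zero => rfl
  | succ n ih => rw [add_comm, zpow_add, zpow_one, Perm.mul_apply, hh, ih]
  | pred n ih =>
    rw [ih, sub_eq_neg_add, zpow_add, zpow_neg_one, Perm.mul_apply, ← hh (τ⁻¹ _)]
    simp

/-- The forward orbit of `u` enters `p` first at `y`. -/
def Runs (τ : Perm X) (p : X → Prop) (u y : X) : Prop :=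
  ∃ n : ℕ, (τ ^ n) u = y ∧ p y ∧ ∀ m < n, ¬ p ((τ ^ m) u)

theorem Runs.refl {τ : Perm X} {p : X → Prop} {y : X} (h : p y) : Runs τ p y y :=
  ⟨0, rfl, h, fun _ hm => absurd hm (Nat.not_lt_zero _)⟩

theorem Runs.step {τ : Perm X} {p : X → Prop} {u y : X} (h : ¬ p u) (hr : Runs τ p (τ u) y) :
    Runs τ p u y := by
  obtain ⟨n, h1, h2, h3⟩ := hr
  refine ⟨n + 1, by rw [pow_succ, Perm.mul_apply, h1], h2, ?_⟩
  rintro (_ | m) hm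
  · exact h
  · rw [pow_succ, Perm.mul_apply]
    exact h3 m (by omega)

theorem Runs.sameCycle {τ : Perm X} {p : X → Prop} {u y : X} (h : Runs τ p u y) :
    τ.SameCycle u y := ⟨h.choose, by rw [zpow_natCast]; exact h.choose_spec.1⟩

theorem Runs.mem {τ : Perm X} {p : X → Prop} {u y : X} (h : Runs τ p u y) : p y :=
  h.choose_spec.2.1

variable [Finite X]

theorem firstReturn_eq_of_runs {τ : Perm X} {p : X → Prop} {x : {x // p x}} {y : X}
    (h : Runs τ p (τ x) y) : (firstReturn τ p x : X) = y := by
  classical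
  obtain ⟨n, h1, h2, h3⟩ := h
  have h1' : (τ ^ (n + 1)) x = y := by rw [pow_succ, Perm.mul_apply, h1]
  have hf : Nat.find (exists_return τ p x) = n := by
    rw [Nat.find_eq_iff]
    refine ⟨by rw [h1']; exact h2, fun m hm => ?_⟩
    have := h3 m hm
    rwa [← Perm.mul_apply, ← pow_succ] at this
  change (τ ^ (Nat.find (exists_return τ p x) + 1)) (x : X) = y
  rw [hf, h1']

theorem runs_firstReturn (τ : Perm X) (p : X → Prop) (x : {x // p x}) :
    Runs τ p (τ x) (firstReturn τ p x) := by
  classical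
  refine ⟨Nat.find (exists_return τ p x), ?_, (firstReturn τ p x).2, fun m hm => ?_⟩
  · rw [← Perm.mul_apply, ← pow_succ]; rfl
  · rw [← Perm.mul_apply, ← pow_succ]
    exact Nat.find_min (exists_return τ p x) hm

theorem sameCycle_firstReturn (τ : Perm X) (p : X → Prop) (x y : {x // p x}) :
    (firstReturn τ p).SameCycle x y ↔ τ.SameCycle (x : X) (y : X) := by
  constructor
  · intro h
    have := h.map_eq (h := fun z : {x // p x} => (Quotient.mk (Perm.SameCycle.setoid τ) (z : X)))
      (fun z => Quotient.sound ((Perm.sameCycle_apply_left.1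
        (runs_firstReturn τ p z).sameCycle).symm))
    exact Quotient.exact this
  · intro h
    obtain ⟨n, -, hn⟩ := h.exists_pow_eq'
    -- Induction on the number of `τ`-steps from `x` to `y`. As `y` satisfies `p`, the first return
    -- of `x` occurs no later than `y`, and the remaining distance is shorter.
    induction n using Nat.strong_induction_on generalizing x with
    | _ n ih =>
      rcases n with _ | n
      · have : x = y := Subtype.ext (by simpa using hn)
        rw [this]
      · obtain ⟨m, h1, h2, h3⟩ := runs_firstReturn τ p x
        rw [pow_succ, Perm.mul_apply] at hn
        have hmn : m ≤ n := by
          by_contra hc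
          exact h3 n (by omega) (by rw [hn]; exact y.2)
        have hc : (firstReturn τ p).SameCycle (firstReturn τ p x) y := by
          have e : (τ ^ (n - m)) (firstReturn τ p x : X) = y := by
            rw [← h1, ← Perm.mul_apply, ← pow_add, Nat.sub_add_cancel hmn, hn]
          exact ih (n - m) (by omega) _ ⟨(n - m : ℕ), by rw [zpow_natCast, e]⟩ e
        exact Perm.sameCycle_apply_left.1 hc

theorem card_cycles_firstReturn (τ : Perm X) (p : X → Prop)
    (h : ∀ x, ∃ y, p y ∧ τ.SameCycle x y) :
    Nat.card (Quotient (Perm.SameCycle.setoid (firstReturn τ p))) =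
      Nat.card (Quotient (Perm.SameCycle.setoid τ)) := by
  refine Nat.card_congr (Equiv.ofBijective
    (Quotient.map' (fun z : {x // p x} => (z : X))
      (fun x y hxy => (sameCycle_firstReturn τ p x y).1 hxy)) ⟨?_, ?_⟩)
  · rintro ⟨x⟩ ⟨y⟩ hxy
    exact Quotient.sound ((sameCycle_firstReturn τ p x y).2 (Quotient.exact hxy))
  · rintro ⟨x⟩
    obtain ⟨y, hy, hxy⟩ := h x
    exact ⟨Quotient.mk _ ⟨y, hy⟩, Quotient.sound hxy.symm⟩

/-- The tool for counting faces before and after a local change. The paths between visits to `p` may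
differ completely, provided that they join the same points of `p`. -/
theorem card_cycles_eq_of_runs {τ τ' : Perm X} {p : X → Prop}
    (h : ∀ x, ∃ y, p y ∧ τ.SameCycle x y) (h' : ∀ x, ∃ y, p y ∧ τ'.SameCycle x y)
    (hr : ∀ x, p x → ∃ y, Runs τ p (τ x) y ∧ Runs τ' p (τ' x) y) :
    Nat.card (Quotient (Perm.SameCycle.setoid τ)) =
      Nat.card (Quotient (Perm.SameCycle.setoid τ')) := by
  have e : firstReturn τ p = firstReturn τ' p := by
    ext x
    obtain ⟨y, h1, h2⟩ := hr x x.2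
    rw [firstReturn_eq_of_runs h1, firstReturn_eq_of_runs h2]
  rw [← card_cycles_firstReturn τ p h, ← card_cycles_firstReturn τ' p h', e]

end Cycles

namespace CMap

variable {X : Type*} {M : CMap X}

/-! ### Colourings and edge cuts -/

/-- There is no edge cut of size at most two. With the converse below, connectivity becomes a
statement about vertex colourings, which can be repainted inside a tangle. -/
theorem ThreeEdgeConnected.colour_eq {β : Type*} (h : M.ThreeEdgeConnected) {c : X → β} (e f : X)
    (hσ : ∀ x, c (M.σ x) = c x)
    (hα : ∀ x, x ≠ e → x ≠ M.α e → x ≠ f → x ≠ M.α f → c (M.α x) = c x) (x y : X) :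
    c x = c y := by
  have hxy := h e f x y
  induction hxy with
  | rel u v huv =>
    rcases huv with rfl | ⟨rfl, h1, h2, h3, h4⟩
    · exact (hσ u).symm
    · exact (hα u h1 h2 h3 h4).symm
  | refl => rfl
  | symm _ _ _ ih => exact ih.symm
  | trans _ _ _ _ _ ih1 ih2 => exact ih1.trans ih2

theorem threeEdgeConnected_of_colour
    (h : ∀ (c : X → Prop) (e f : X), (∀ x, c (M.σ x) = c x) →
      (∀ x, c (M.α x) ≠ c x → x = e ∨ x = M.α e ∨ x = f ∨ x = M.α f) → ∀ x y, c x = c y) :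
    M.ThreeEdgeConnected := by
  intro e f x y
  let r := fun u v => v = M.σ u ∨ (v = M.α u ∧ u ≠ e ∧ u ≠ M.α e ∧ u ≠ f ∧ u ≠ M.α f)
  -- The colour is the connected component of `x` after the deletion of the two edges.
  have key := h (fun z => Relation.EqvGen r x z) e f ?_ ?_ x y
  · exact (iff_of_eq key).1 (Relation.EqvGen.refl x)
  · intro z
    have hz : Relation.EqvGen r z (M.σ z) := Relation.EqvGen.rel _ _ (Or.inl rfl)
    exact propext ⟨fun h => h.trans _ _ _ (hz.symm _ _), fun h => h.trans _ _ _ hz⟩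
  · intro z hz
    by_contra hc
    push Not at hc
    have hr : Relation.EqvGen r z (M.α z) :=
      Relation.EqvGen.rel _ _ (Or.inr ⟨rfl, hc.1, hc.2.1, hc.2.2.1, hc.2.2.2⟩)
    exact hz (propext ⟨fun h => h.trans _ _ _ (hr.symm _ _), fun h => h.trans _ _ _ hr⟩)

/-! ### Homology of the sphere -/

section Homology

/-- The coboundary of the functions that are constant on the classes of `s`. -/
def coboundary (M : CMap X) (s : Setoid X) : (Quotient s → ℝ) →ₗ[ℝ] (X → ℝ) :=
  LinearMap.funLeft ℝ ℝ (fun x => Quotient.mk s (M.α x)) -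
    LinearMap.funLeft ℝ ℝ (fun x => Quotient.mk s x)

theorem coboundary_apply (M : CMap X) (s : Setoid X) (g : Quotient s → ℝ) (x : X) :
    M.coboundary s g x = g (Quotient.mk s (M.α x)) - g (Quotient.mk s x) := rfl

-- The kernel of the coboundary consists of constants, hence has dimension at most one; rank-nullity
-- gives the bound.
variable [Fintype X] in
theorem card_le_finrank_range_coboundary (M : CMap X) (s : Setoid X)
    (h : ∀ g : X → ℝ, (∀ x y, s.r x y → g x = g y) → (∀ x, g (M.α x) = g x) → ∀ x y, g x = g y) :
    Nat.card (Quotient s) ≤ Module.finrank ℝ (LinearMap.range (M.coboundary s)) + 1 := by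
  classical
  have h1 := LinearMap.finrank_range_add_finrank_ker (M.coboundary s)
  have h2 : Module.finrank ℝ (LinearMap.ker (M.coboundary s)) ≤ 1 := by
    have hle : LinearMap.ker (M.coboundary s) ≤ Submodule.span ℝ {(fun _ => 1 : Quotient s → ℝ)} := by
      intro g hg
      rw [LinearMap.mem_ker] at hg
      have hc := h (fun x => g (Quotient.mk s x))
        (fun x y hxy => congrArg g (Quotient.sound hxy))
        (fun x => by
          have := congrFun hg x
          rw [coboundary_apply] at this
          exact sub_eq_zero.1 this)
      rw [Submodule.mem_span_singleton]
      rcases isEmpty_or_nonempty X with hX | ⟨⟨x₀⟩⟩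
      · refine ⟨0, ?_⟩
        ext q
        exact (hX.false q.out).elim
      · refine ⟨g (Quotient.mk s x₀), ?_⟩
        ext q
        induction q using Quotient.inductionOn with
        | _ x => simpa using hc x₀ x
    refine (Submodule.finrank_mono hle).trans ((finrank_span_le_card _).trans ?_)
    simp
  have : Fintype (Quotient s) := Fintype.ofFinite _
  rw [Module.finrank_fintype_fun_eq_card, ← Nat.card_eq_fintype_card] at h1
  omega

/-- The functions that change sign when an edge is reversed. -/
def antisymm (M : CMap X) : Submodule ℝ (X → ℝ) :=
  LinearMap.ker (LinearMap.funLeft ℝ ℝ M.α + LinearMap.id)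

theorem mem_antisymm {M : CMap X} {w : X → ℝ} : w ∈ M.antisymm ↔ ∀ x, w (M.α x) = - w x := by
  rw [antisymm, LinearMap.mem_ker, funext_iff]
  exact forall_congr' fun x => eq_neg_iff_add_eq_zero.symm

theorem sameCycle_α_iff (M : CMap X) (x y : X) : M.α.SameCycle x y ↔ y = x ∨ y = M.α x := by
  constructor
  · intro h
    by_contra hc
    push Not at hc
    have := h.map_eq (h := fun z => z = x ∨ z = M.α x) (fun z => propext (by
      constructor
      · rintro (h | h)
        · right; rw [← h, M.α_invol]
        · left; exact M.α.injective h
      · rintro (rfl | rfl)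
        · right; rfl
        · left; exact M.α_invol x))
    rcases (iff_of_eq this).1 (Or.inl rfl) with h | h
    · exact hc.1 h
    · exact hc.2 h
  · rintro (rfl | rfl)
    · exact Perm.SameCycle.refl _ _
    · exact Perm.sameCycle_apply_right.2 (Perm.SameCycle.refl _ _)

-- An antisymmetric function is determined by its values on one chosen dart of each edge.
variable [Fintype X] in
theorem finrank_antisymm_le (M : CMap X) :
    Module.finrank ℝ M.antisymm ≤ Nat.card (Quotient (Perm.SameCycle.setoid M.α)) := by
  let s := Perm.SameCycle.setoid M.α
  let f : M.antisymm →ₗ[ℝ] (Quotient s → ℝ) :=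
    (LinearMap.funLeft ℝ ℝ (fun q : Quotient s => q.out)).comp (Submodule.subtype _)
  have hf : Function.Injective f := by
    rw [injective_iff_map_eq_zero]
    rintro ⟨w, hw⟩ h0
    rw [mem_antisymm] at hw
    ext x
    have h1 : w (Quotient.mk s x).out = 0 := congrFun h0 (Quotient.mk s x)
    have h2 : M.α.SameCycle (Quotient.mk s x).out x := Quotient.mk_out (s := s) x
    rcases (M.sameCycle_α_iff _ _).1 h2 with h | h
    · rw [← h] at h1; exact h1
    · change w x = 0
      rw [h, hw, h1, neg_zero]
  have h1 := LinearMap.finrank_le_finrank_of_injective hf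
  have : Fintype (Quotient s) := Fintype.ofFinite _
  rwa [Module.finrank_fintype_fun_eq_card, ← Nat.card_eq_fintype_card] at h1

-- Summation by parts: substituting `α x` for `x` identifies the two halves of the sum up to sign.
-- The factor 2 arises because every edge has two darts.
variable [Fintype X] in
theorem sum_mul_coboundary {M : CMap X} {w : X → ℝ} (hw : w ∈ M.antisymm) (s : Setoid X)
    (h : Quotient s → ℝ) :
    ∑ x, w x * M.coboundary s h x = -2 * ∑ x, w x * h (Quotient.mk s x) := by
  rw [mem_antisymm] at hw
  have e : ∑ x, w x * h (Quotient.mk s (M.α x)) = - ∑ x, w x * h (Quotient.mk s x) := by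
    rw [← Equiv.sum_comp M.α, ← Finset.sum_neg_distrib]
    refine Finset.sum_congr rfl fun x _ => ?_
    rw [hw, M.α_invol, neg_mul]
  simp only [coboundary_apply, mul_sub, Finset.sum_sub_distrib, e]
  ring

/-- The darts `α x` and `σ⁻¹ x` are consecutive along a face. -/
theorem face_const {M : CMap X} (h : Quotient (Perm.SameCycle.setoid M.φ) → ℝ) (x : X) :
    h (Quotient.mk _ (M.α x)) = h (Quotient.mk _ (M.σ⁻¹ x)) := by
  refine congrArg h (Quotient.sound ?_)
  change M.φ.SameCycle _ _
  rw [← Perm.sameCycle_apply_left]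
  rw [φ, Perm.mul_apply, M.α_invol]

theorem coboundary_mem_antisymm (M : CMap X) (s : Setoid X) (g : Quotient s → ℝ) :
    M.coboundary s g ∈ M.antisymm := by
  rw [mem_antisymm]
  intro x
  rw [coboundary_apply, coboundary_apply, M.α_invol]
  ring

variable [Fintype X] in
/-- On a connected map of genus zero an antisymmetric function whose sum vanishes along every
face is the coboundary of a function on the vertices. -/
theorem exists_potential {M : CMap X} (hE : M.EulerSphere)
    (hc : ∀ g : X → ℝ, (∀ x, g (M.σ x) = g x) → (∀ x, g (M.α x) = g x) → ∀ x y, g x = g y)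
    {w : X → ℝ} (hw : ∀ x, w (M.α x) = - w x)
    (hw' : ∀ h : X → ℝ, (∀ x, h (M.α x) = h (M.σ⁻¹ x)) → ∑ x, w x * h x = 0) :
    ∃ g : X → ℝ, (∀ x, g (M.σ x) = g x) ∧ ∀ x, g (M.α x) - g x = w x := by
  classical
  set sV := Perm.SameCycle.setoid M.σ
  set sF := Perm.SameCycle.setoid M.φ
  by_contra hno
  have hwR : w ∉ LinearMap.range (M.coboundary sV) := by
    rintro ⟨g, hg⟩
    refine hno ⟨fun x => g (Quotient.mk _ x), fun x => congrArg g (Quotient.sound ?_), fun x => ?_⟩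
    · exact Perm.sameCycle_apply_left.2 (Perm.SameCycle.refl _ _)
    · rw [← hg]; rfl
  have hV := M.card_le_finrank_range_coboundary sV (fun g h1 h2 => hc g
    (fun x => h1 _ _ (Perm.sameCycle_apply_left.2 (Perm.SameCycle.refl _ _))) h2)
  have hF := M.card_le_finrank_range_coboundary sF (fun g h1 h2 => hc g (fun x => by
    have h3 : g (M.φ (M.α (M.σ x))) = g (M.α (M.σ x)) :=
      h1 _ _ (Perm.sameCycle_apply_left.2 (Perm.SameCycle.refl _ _))
    rw [φ, Perm.mul_apply, M.α_invol] at h3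
    rw [← h2, ← h3]
    simp) h2)
  -- If `w` is not a coboundary, `R` has dimension at least `V`. It is orthogonal to the space `U`
  -- of face coboundaries, of dimension at least `F - 1`, and both lie in a space of dimension at
  -- most `E = V + F - 2`.
  set R := LinearMap.range (M.coboundary sV) ⊔ Submodule.span ℝ {w}
  set U := LinearMap.range (M.coboundary sF)
  have hwA : w ∈ M.antisymm := mem_antisymm.2 hw
  have horth : ∀ v ∈ R, ∀ u ∈ U, ∑ x, v x * u x = 0 := by
    rintro v hv _ ⟨h, rfl⟩
    obtain ⟨_, ⟨g, rfl⟩, v', hv', rfl⟩ := Submodule.mem_sup.1 hv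
    obtain ⟨t, rfl⟩ := Submodule.mem_span_singleton.1 hv'
    -- Vertex and face coboundaries are orthogonal: after a shift by `α` one replaces `h (α x)` by
    -- `h (σ⁻¹ x)` and `g x` by `g (σ⁻¹ x)`, and the two sums agree.
    have h1 : ∑ x, M.coboundary sV g x * M.coboundary sF h x = 0 := by
      rw [sum_mul_coboundary (M.coboundary_mem_antisymm sV g)]
      have : ∑ x, M.coboundary sV g x * h (Quotient.mk sF x) = 0 := by
        simp only [coboundary_apply, sub_mul, Finset.sum_sub_distrib]
        rw [← Equiv.sum_comp M.α, sub_eq_zero, ← Equiv.sum_comp M.σ⁻¹]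
        conv_rhs => rw [← Equiv.sum_comp M.σ⁻¹]
        rw [Equiv.sum_comp M.σ⁻¹ (fun x => g (Quotient.mk sV (M.α (M.α x))) *
          h (Quotient.mk sF (M.α x)))]
        refine Finset.sum_congr rfl fun x _ => ?_
        rw [M.α_invol, face_const h]
        congr 2
        exact Quotient.sound (show M.σ.SameCycle _ _ from ⟨-1, by simp⟩)
      rw [this, mul_zero]
    have h2 : ∑ x, w x * M.coboundary sF h x = 0 := by
      rw [sum_mul_coboundary hwA, hw' (fun x => h (Quotient.mk sF x)) (face_const h), mul_zero]
    simp only [Pi.add_apply, Pi.smul_apply, smul_eq_mul, add_mul, Finset.sum_add_distrib, h1,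
      mul_assoc, ← Finset.mul_sum, h2, mul_zero, add_zero]
  have hdis : R ⊓ U = ⊥ := by
    rw [eq_bot_iff]
    rintro v ⟨hv1, hv2⟩
    have h0 := horth v hv1 v hv2
    rw [Finset.sum_eq_zero_iff_of_nonneg (fun x _ => mul_self_nonneg _)] at h0
    ext x
    exact mul_self_eq_zero.1 (h0 x (Finset.mem_univ x))
  have hsum := Submodule.finrank_sup_add_finrank_inf_eq R U
  rw [hdis, finrank_bot, add_zero] at hsum
  have hle : R ⊔ U ≤ M.antisymm := by
    refine sup_le (sup_le ?_ ?_) ?_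
    · rintro _ ⟨g, rfl⟩; exact M.coboundary_mem_antisymm sV g
    · rw [Submodule.span_singleton_le_iff_mem]; exact hwA
    · rintro _ ⟨g, rfl⟩; exact M.coboundary_mem_antisymm sF g
  have hA := (Submodule.finrank_mono hle).trans M.finrank_antisymm_le
  have hlt : Module.finrank ℝ (LinearMap.range (M.coboundary sV)) < Module.finrank ℝ R := by
    refine Submodule.finrank_lt_finrank_of_lt (lt_of_le_of_ne le_sup_left fun h => hwR ?_)
    rw [h]
    exact Submodule.mem_sup_right (Submodule.mem_span_singleton_self w)
  have hE' : Nat.card (Quotient sV) + Nat.card (Quotient sF) =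
      Nat.card (Quotient (Perm.SameCycle.setoid M.α)) + 2 := hE
  omega

end Homology

end CMap

/-! ### Nugatory crossings are excluded by genus zero and connectivity -/

namespace Diagram

variable {X : Type*} [Fintype X] {E : Diagram X}

/-- A plane diagram with at least two crossings that is 3-edge-connected has no nugatory
crossing. -/
theorem reduced_of_sphere (hE : E.EulerSphere) (hc : E.ThreeEdgeConnected)
    (h2 : ∀ x, ∃ y, ¬ E.SameVertex x y) : E.Reduced := by
  classical
  intro x hx
  -- The edges at `σ x` and `σ² x` have to be different for the argument below. If they were one
  -- loop, deleting the edges at `x` and `σ³ x` would cut off this crossing.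
  have hloop : E.α (E.σ x) ≠ E.σ (E.σ x) := by
    intro hl
    obtain ⟨y, hy⟩ := h2 x
    have key : ∀ z, E.SameVertex x z → z ≠ x → z ≠ E.σ (E.σ (E.σ x)) →
        E.SameVertex x (E.α z) := by
      intro z hz h1 h3
      rcases (E.sameVertex_iff _ _).1 hz with rfl | rfl | rfl | rfl
      · exact absurd rfl h1
      · rw [hl]; simp [SameVertex.refl]
      · rw [← hl, E.α_α]; simp [SameVertex.refl]
      · exact absurd rfl h3
    have := hc.colour_eq (c := fun z => E.SameVertex x z) x (E.σ (E.σ (E.σ x)))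
      (fun z => by simp) (fun z h1 h2 h3 h4 => propext ⟨fun h => ?_, fun h => key z h h1 h3⟩) x y
    · exact hy ((iff_of_eq this).1 (SameVertex.refl x))
    · have := key (E.α z) h (fun h => h2 (E.α_eq_iff.1 h)) (fun h => h4 (E.α_eq_iff.1 h))
      rwa [E.α_α] at this
  -- A closed curve through the face and the crossing, pushed off the crossing, meets exactly the
  -- edges at `σ x` and `σ² x`; `w` counts the intersections with sign. Its pairing with a face
  -- function telescopes to `h (σ² x) - h x`, which vanishes because both corners lie on one face.
  obtain ⟨g, hg1, hg2⟩ := CMap.exists_potential hE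
    (fun g h1 h2 => hc.colour_eq (c := g) x x h1 (fun z _ _ _ _ => h2 z))
    (w := fun z => (if z = E.σ x then 1 else 0) - (if z = E.α (E.σ x) then 1 else 0) +
      ((if z = E.σ (E.σ x) then 1 else 0) - (if z = E.α (E.σ (E.σ x)) then 1 else 0)))
    (fun z => by
      simp only [E.α_eq_iff (y := E.σ x), E.α_eq_iff (y := E.σ (E.σ x)),
        E.α.apply_eq_iff_eq]
      ring)
    (fun h hh => by
      simp only [add_mul, sub_mul, ite_mul, one_mul, zero_mul, Finset.sum_add_distrib,
        Finset.sum_sub_distrib, Finset.sum_ite_eq', Finset.mem_univ, if_true]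
      have h1 : h x = h (E.σ (E.σ x)) := hx.map_eq (fun z => by
        have := hh (E.α z)
        rw [E.α_invol] at this
        exact this.symm)
      rw [hh, hh, ← h1]
      simp [h1])
  -- Off these two edges the potential does not jump, so it is constant by 3-edge-connectivity; yet
  -- it must jump by one along the edge of `σ x`.
  have hconst := hc.colour_eq (c := g) (E.σ x) (E.σ (E.σ x)) hg1 (fun z h1 h2 h3 h4 => by
    have := hg2 z
    simpa [h1, h2, h3, h4, sub_eq_zero] using this)
  have h0 := hg2 (E.σ x)
  rw [hconst (E.α (E.σ x)) (E.σ x)] at h0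
  have e1 : E.σ x ≠ E.α (E.σ x) := fun h => E.α_ne _ h.symm
  have e2 : E.σ x ≠ E.σ (E.σ x) := fun h => E.σ_ne_self _ h.symm
  have e3 : E.σ x ≠ E.α (E.σ (E.σ x)) := fun h => hloop (E.α_eq_iff.2 h)
  simp [e1, e2, e3] at h0

end Diagram

theorem Equiv.Perm.three_swaps {X : Type*} [DecidableEq X] {a a' b b' c c' : X}
    (h : [a, a', b, b', c, c'].Nodup) :
    let ρ := swap a b' * swap b c' * swap c a'
    ρ a = b' ∧ ρ b' = a ∧ ρ b = c' ∧ ρ c' = b ∧ ρ c = a' ∧ ρ a' = c ∧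
      ∀ x, x ≠ a → x ≠ a' → x ≠ b → x ≠ b' → x ≠ c → x ≠ c' → ρ x = x := by
  simp only [List.nodup_cons, List.mem_cons, List.not_mem_nil, or_false, not_or, not_false_eq_true,
    List.nodup_nil, and_true] at h
  obtain ⟨⟨h1, h2, h3, h4, h5⟩, ⟨h6, h7, h8, h9⟩, ⟨h10, h11, h12⟩, ⟨h13, h14⟩, h15⟩ := h
  intro ρ
  refine ⟨?_, ?_, ?_, ?_, ?_, ?_, ?_⟩
  · simp [ρ, swap_apply_of_ne_of_ne, *]
  · simp [ρ, swap_apply_of_ne_of_ne, *, Ne.symm]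
  · simp [ρ, swap_apply_of_ne_of_ne, *, Ne.symm]
  · simp [ρ, swap_apply_of_ne_of_ne, *, Ne.symm h15, Ne.symm h9, Ne.symm h2]
  · simp [ρ, swap_apply_of_ne_of_ne, *, Ne.symm h1]
  · simp [ρ, swap_apply_of_ne_of_ne, *, Ne.symm h4, Ne.symm h11, Ne.symm h13]
  · intro x g1 g2 g3 g4 g5 g6
    simp [ρ, swap_apply_of_ne_of_ne, *]

theorem Equiv.Perm.card_cycles_conj {X : Type*} (ρ τ : Perm X) :
    Nat.card (Quotient (Perm.SameCycle.setoid (ρ * τ * ρ⁻¹))) =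
      Nat.card (Quotient (Perm.SameCycle.setoid τ)) := by
  refine (Nat.card_congr (Quotient.congr ρ fun x y => ?_)).symm
  change τ.SameCycle x y ↔ (ρ * τ * ρ⁻¹).SameCycle (ρ x) (ρ y)
  rw [Perm.sameCycle_conj]
  simp

/-! ### Replacing a tangle inside a diagram -/

namespace Diagram

variable {X : Type*} {E E' : Diagram X} {V : Set X}

/-- The diagrams agree outside the tangle with set of darts `V`, and the same edges enter it. -/
structure Replaces (V : Set X) (E E' : Diagram X) : Prop where
  σ_eq : E'.σ = E.σ
  closed : ∀ x, E.σ x ∈ V ↔ x ∈ V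
  frame : ∀ x, x ∉ V → E.α x ∉ V → E'.α x = E.α x
  mem_iff : ∀ x, x ∉ V → (E.α x ∈ V ↔ E'.α x ∈ V)

namespace Replaces

theorem frame' (h : Replaces V E E') {x : X} (hx : x ∉ V) (hx' : E'.α x ∉ V) :
    E'.α x = E.α x := h.frame x hx fun h' => hx' ((h.mem_iff x hx).1 h')

/-- When the tangle is monochrome its interior is irrelevant, and a small cut of `E'` is one of `E`.
-/
theorem colour_const (h : Replaces V E E') (hc : E.ThreeEdgeConnected) {c : X → Prop} {e f : X}
    (hσ : ∀ x, c (E.σ x) = c x)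
    (hα : ∀ x, c (E'.α x) ≠ c x → x = e ∨ x = E'.α e ∨ x = f ∨ x = E'.α f)
    (hV : ∀ x ∈ V, ∀ y ∈ V, c x = c y) (x y : X) : c x = c y := by
  classical
  -- A cut edge that enters the tangle is named by its end outside `V`, since its inner end may be
  -- another dart in `E` than in `E'`.
  have key : ∀ x, x ∉ V → c (E.α x) ≠ c x →
      x = (if e ∈ V then E'.α e else e) ∨ x = E.α (if e ∈ V then E'.α e else e) ∨
      x = (if f ∈ V then E'.α f else f) ∨ x = E.α (if f ∈ V then E'.α f else f) := by
    intro x hx hcx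
    have h1 : c (E'.α x) = c (E.α x) := by
      by_cases hm : E.α x ∈ V
      · exact hV _ ((h.mem_iff x hx).1 hm) _ hm
      · rw [h.frame x hx hm]
    have aux : ∀ e, x = e ∨ x = E'.α e →
        x = (if e ∈ V then E'.α e else e) ∨ x = E.α (if e ∈ V then E'.α e else e) := by
      rintro e (rfl | rfl)
      · left; rw [if_neg hx]
      · by_cases he : e ∈ V
        · left; rw [if_pos he]
        · right; rw [if_neg he, h.frame' he hx]
    rcases hα x (by rwa [h1]) with h' | h' | h' | h'
    · exact (aux e (Or.inl h')).imp_right Or.inl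
    · exact (aux e (Or.inr h')).imp_right Or.inl
    · exact Or.inr (Or.inr (aux f (Or.inl h')))
    · exact Or.inr (Or.inr (aux f (Or.inr h')))
  refine hc.colour_eq (if e ∈ V then E'.α e else e) (if f ∈ V then E'.α f else f) hσ
    (fun x h1 h2 h3 h4 => ?_) x y
  by_contra hcx
  by_cases hx : x ∈ V
  · have hx' : E.α x ∉ V := fun h' => hcx (hV _ h' _ hx)
    rcases key (E.α x) hx' (by rw [E.α_α]; exact Ne.symm hcx) with h' | h' | h' | h'
    · exact h2 (E.α_eq_iff.1 h')
    · exact h1 (E.α.injective h')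
    · exact h4 (E.α_eq_iff.1 h')
    · exact h3 (E.α.injective h')
  · rcases key x hx hcx with h' | h' | h' | h'
    · exact h1 h'
    · exact h2 h'
    · exact h3 h'
    · exact h4 h'

end Replaces

/-- If a tangle is painted with one colour and at most two of its legs end in another colour,
then nothing outside it has another colour. -/
theorem colour_outside (hVσ : ∀ x, E.σ x ∈ V ↔ x ∈ V) (hc : E.ThreeEdgeConnected)
    {c : X → Prop} {κ : Prop} {e f : X} (hσ : ∀ x, c (E.σ x) = c x)
    (h1 : ∀ x, x ∉ V → E.α x ∉ V → c (E.α x) = c x)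
    (h2 : ∀ x, x ∉ V → E.α x ∈ V → x = e ∨ x = f ∨ c x = κ) (hV : V.Nonempty) {x : X}
    (hx : x ∉ V) : c x = κ := by
  classical
  obtain ⟨v, hv⟩ := hV
  have := hc.colour_eq (c := fun z => if z ∈ V then κ else c z) e f
    (fun z => by simp only [hVσ, hσ]) (fun z g1 g2 g3 g4 => ?_) x v
  · simpa only [if_neg hx, if_pos hv] using this
  · have key : ∀ z, z ≠ e → z ≠ f → z ∉ V → (if E.α z ∈ V then κ else c (E.α z)) = c z := by
      intro z g1 g3 hz
      by_cases hz' : E.α z ∈ V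
      · rw [if_pos hz']
        rcases h2 z hz hz' with h | h | h
        · exact absurd h g1
        · exact absurd h g3
        · exact h.symm
      · rw [if_neg hz', h1 z hz hz']
    by_cases hz : z ∈ V
    · by_cases hz' : E.α z ∈ V
      · simp only [hz, hz', if_true]
      · have := key (E.α z) (fun h => g2 (E.α_eq_iff.1 h)) (fun h => g4 (E.α_eq_iff.1 h)) hz'
        rw [E.α_α, if_pos hz] at this
        simp only [hz, hz', if_true, if_false, this]
    · simp only [hz, if_false]
      exact key z g1 g3 hz

theorem Replaces.alternating (h : Replaces V E E') (hE : E.Alternating)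
    (hV : ∀ x ∈ V, E'.isOver (E'.α x) = !E'.isOver x)
    (hover : ∀ x, x ∉ V → E'.isOver x = E.isOver x) : E'.Alternating := by
  intro x
  by_cases hx : x ∈ V
  · exact hV x hx
  · by_cases hx' : E'.α x ∈ V
    · have := hV (E'.α x) hx'
      rw [E'.α_α] at this
      rw [this, Bool.not_not]
    · rw [hover x hx, hover _ hx', h.frame' hx hx', hE]

/-- The numbers of cycles give Euler's formula, and reducedness is then free by `reduced_of_sphere`;
two different crossings are needed for that. -/
theorem IsReducedAlternatingPrime.of_sphere [Fintype X] (hE : E.IsReducedAlternatingPrime)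
    (hσ : E'.σ = E.σ)
    (hα : Nat.card (Quotient (Perm.SameCycle.setoid E'.α)) =
      Nat.card (Quotient (Perm.SameCycle.setoid E.α)))
    (hφ : Nat.card (Quotient (Perm.SameCycle.setoid E'.φ)) =
      Nat.card (Quotient (Perm.SameCycle.setoid E.φ)))
    (halt : E'.Alternating) (hc : E'.ThreeEdgeConnected) {u v : X} (huv : ¬ E.SameVertex u v) :
    E'.IsReducedAlternatingPrime := by
  have hs : E'.EulerSphere := by
    have := hE.sphere
    rw [CMap.EulerSphere] at this ⊢
    rw [hσ, hα, hφ, this]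
  refine ⟨hE.nonempty, hs, hc, halt, reduced_of_sphere hs hc fun x => ?_⟩
  by_contra! hx
  have h1 := hx u
  have h2 := hx v
  rw [CMap.SameVertex, hσ] at h1 h2
  exact huv (SameVertex.trans (E := E) (SameVertex.symm (E := E) h1) h2)

end Diagram

/-! ### Triangles of three twists -/

namespace Diagram

variable {X : Type*} {E E' : Diagram X} {V : Set X}

/-- Three twists around a central face whose crossings are those of `V`; the outer ends `nᵢ`, `sᵢ`
of the upper and lower legs of the twists lie outside `V`. -/
structure Tri (E : Diagram X) (V : Set X) (l₀ : X) (k₀ : ℕ) (l₁ : X) (k₁ : ℕ) (l₂ : X) (k₂ : ℕ)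
    (n₀ s₀ n₁ s₁ n₂ s₂ : X) : Prop where
  tri : E.IsTriangle l₀ k₀ l₁ k₁ l₂ k₂
  V_eq : V = E.twistDarts l₀ k₀ ∪ E.twistDarts l₁ k₁ ∪ E.twistDarts l₂ k₂
  nw₀ : E.α l₀ = n₀
  sw₀ : E.α (E.σ l₀) = s₀
  nw₁ : E.α l₁ = n₁
  sw₁ : E.α (E.σ l₁) = s₁
  nw₂ : E.α l₂ = n₂
  sw₂ : E.α (E.σ l₂) = s₂
  n₀_mem : n₀ ∉ V
  s₀_mem : s₀ ∉ V
  n₁_mem : n₁ ∉ V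
  s₁_mem : s₁ ∉ V
  n₂_mem : n₂ ∉ V
  s₂_mem : s₂ ∉ V

namespace Tri

variable {l₀ l₁ l₂ : X} {k₀ k₁ k₂ : ℕ} {n₀ s₀ n₁ s₁ n₂ s₂ : X}

/-- Thanks to the cyclic symmetry, facts are proved for the twist with index 0 only and transported
by `rot`. -/
theorem rot (h : Tri E V l₀ k₀ l₁ k₁ l₂ k₂ n₀ s₀ n₁ s₁ n₂ s₂) :
    Tri E V l₁ k₁ l₂ k₂ l₀ k₀ n₁ s₁ n₂ s₂ n₀ s₀ := by
  obtain ⟨⟨t0, t1, t2, d0, d1, d2, a0, a1, a2⟩, hV, c1, c2, c3, c4, c5, c6, c7, c8, c9, c10, c11,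
    c12⟩ := h
  refine ⟨⟨t1, t2, t0, d1, d2, d0, a1, a2, a0⟩, ?_, c3, c4, c5, c6, c1, c2, c9, c10, c11, c12,
    c7, c8⟩
  rw [hV]
  ext x; simp only [Set.mem_union]; tauto

theorem closed (h : Tri E V l₀ k₀ l₁ k₁ l₂ k₂ n₀ s₀ n₁ s₁ n₂ s₂) (x : X) :
    E.σ x ∈ V ↔ x ∈ V := by
  rw [h.V_eq]; simp

theorem sub₀ (h : Tri E V l₀ k₀ l₁ k₁ l₂ k₂ n₀ s₀ n₁ s₁ n₂ s₂) : E.twistDarts l₀ k₀ ⊆ V := by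
  rw [h.V_eq]
  exact fun x hx => Or.inl (Or.inl hx)

theorem twist₀ (h : Tri E V l₀ k₀ l₁ k₁ l₂ k₂ n₀ s₀ n₁ s₁ n₂ s₂) : E.IsTwist l₀ k₀ := h.tri.1

theorem α_se₀ (h : Tri E V l₀ k₀ l₁ k₁ l₂ k₂ n₀ s₀ n₁ s₁ n₂ s₂) :
    E.α (E.se l₀ k₀) = E.ne l₁ k₁ := h.tri.2.2.2.2.2.2.1

theorem α_ne₀ (h : Tri E V l₀ k₀ l₁ k₁ l₂ k₂ n₀ s₀ n₁ s₁ n₂ s₂) :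
    E.α (E.ne l₀ k₀) = E.se l₂ k₂ := by
  rw [E.α_eq_iff]; exact h.rot.rot.α_se₀.symm

theorem disj₀₁ (h : Tri E V l₀ k₀ l₁ k₁ l₂ k₂ n₀ s₀ n₁ s₁ n₂ s₂) :
    Disjoint (E.twistDarts l₀ k₀) (E.twistDarts l₁ k₁) := h.tri.2.2.2.1

theorem mem_cases (h : Tri E V l₀ k₀ l₁ k₁ l₂ k₂ n₀ s₀ n₁ s₁ n₂ s₂) {x : X} (hx : x ∈ V) :
    x ∈ E.twistDarts l₀ k₀ ∨ x ∈ E.twistDarts l₁ k₁ ∨ x ∈ E.twistDarts l₂ k₂ := by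
  rw [h.V_eq] at hx
  rcases hx with (hx | hx) | hx
  · exact Or.inl hx
  · exact Or.inr (Or.inl hx)
  · exact Or.inr (Or.inr hx)

theorem inner₀ (h : Tri E V l₀ k₀ l₁ k₁ l₂ k₂ n₀ s₀ n₁ s₁ n₂ s₂) {x : X}
    (hx : x ∈ E.twistDarts l₀ k₀) : x = l₀ ∨ x = E.σ l₀ ∨ E.α x ∈ V := by
  rcases h.twist₀.dart_cases hx with h' | h' | rfl | rfl | ⟨i, hi, h'⟩
  · exact Or.inl h'
  · exact Or.inr (Or.inl h')
  · right; right
    rw [h.α_se₀]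
    exact h.rot.sub₀ (E.ne_mem h.rot.twist₀.pos)
  · right; right
    rw [h.α_ne₀]
    exact h.rot.rot.sub₀ (E.se_mem h.rot.rot.twist₀.pos)
  · exact Or.inr (Or.inr (h.sub₀ (h.twist₀.α_mem_of_inner hi h')))

/-- The edges that enter the tangle. -/
theorem leg_cases (h : Tri E V l₀ k₀ l₁ k₁ l₂ k₂ n₀ s₀ n₁ s₁ n₂ s₂) {x : X} (hx : x ∈ V)
    (hx' : E.α x ∉ V) :
    x = l₀ ∨ x = E.σ l₀ ∨ x = l₁ ∨ x = E.σ l₁ ∨ x = l₂ ∨ x = E.σ l₂ := by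
  rcases h.mem_cases hx with hm | hm | hm
  · have := h.inner₀ hm; tauto
  · have := h.rot.inner₀ hm; tauto
  · have := h.rot.rot.inner₀ hm; tauto

theorem out_cases (h : Tri E V l₀ k₀ l₁ k₁ l₂ k₂ n₀ s₀ n₁ s₁ n₂ s₂) {x : X} (hx : x ∉ V)
    (hx' : E.α x ∈ V) : x = n₀ ∨ x = s₀ ∨ x = n₁ ∨ x = s₁ ∨ x = n₂ ∨ x = s₂ := by
  rcases h.leg_cases hx' (by rwa [E.α_α]) with g | g | g | g | g | g <;>
    rw [E.α_eq_iff] at g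
  · exact Or.inl (g.trans h.nw₀)
  · exact Or.inr (Or.inl (g.trans h.sw₀))
  · exact Or.inr (Or.inr (Or.inl (g.trans h.nw₁)))
  · exact Or.inr (Or.inr (Or.inr (Or.inl (g.trans h.sw₁))))
  · exact Or.inr (Or.inr (Or.inr (Or.inr (Or.inl (g.trans h.nw₂)))))
  · exact Or.inr (Or.inr (Or.inr (Or.inr (Or.inr (g.trans h.sw₂)))))

theorem start_mem₀ (h : Tri E V l₀ k₀ l₁ k₁ l₂ k₂ n₀ s₀ n₁ s₁ n₂ s₂) : l₀ ∈ V :=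
  h.sub₀ (E.start_mem h.twist₀.pos)

theorem α_out (h : Tri E V l₀ k₀ l₁ k₁ l₂ k₂ n₀ s₀ n₁ s₁ n₂ s₂) {x : X}
    (hx : x = n₀ ∨ x = s₀ ∨ x = n₁ ∨ x = s₁ ∨ x = n₂ ∨ x = s₂) : E.α x ∈ V := by
  rcases hx with rfl | rfl | rfl | rfl | rfl | rfl
  · rw [← h.nw₀, E.α_α]; exact h.start_mem₀
  · rw [← h.sw₀, E.α_α, h.closed]; exact h.start_mem₀
  · rw [← h.nw₁, E.α_α]; exact h.rot.start_mem₀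
  · rw [← h.sw₁, E.α_α, h.closed]; exact h.rot.start_mem₀
  · rw [← h.nw₂, E.α_α]; exact h.rot.rot.start_mem₀
  · rw [← h.sw₂, E.α_α, h.closed]; exact h.rot.rot.start_mem₀

theorem ne_of_mem₀₁ (h : Tri E V l₀ k₀ l₁ k₁ l₂ k₂ n₀ s₀ n₁ s₁ n₂ s₂) {x y : X}
    (hx : x ∈ E.twistDarts l₀ k₀) (hy : y ∈ E.twistDarts l₁ k₁) : x ≠ y := by
  rintro rfl
  exact Set.disjoint_left.1 h.disj₀₁ hx hy

end Tri

/-! ### The operation `OTS` -/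

section OTS

variable {A B C : X} {nA sA nB sB nC sC : X}

theorem Tri.α_se_one {A B C : X} (h : Tri E V A 1 B 1 C 1 nA sA nB sB nC sC) :
    E.α (E.σ (E.σ A)) = E.σ (E.σ (E.σ B)) := h.α_se₀

theorem Tri.α_ne_one {A B C : X} (h : Tri E V A 1 B 1 C 1 nA sA nB sB nC sC) :
    E.α (E.σ (E.σ (E.σ A))) = E.σ (E.σ C) := h.α_ne₀

theorem Tri.mem_one (h : Tri E V A 1 B 1 C 1 nA sA nB sB nC sC) {x : X} :
    x ∈ V ↔ E.SameVertex A x ∨ E.SameVertex B x ∨ E.SameVertex C x := by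
  rw [h.V_eq]
  simp [or_assoc]

theorem Tri.not_sameVertex (h : Tri E V A 1 B 1 C 1 nA sA nB sB nC sC) :
    ¬ E.SameVertex A B := fun h' =>
  h.ne_of_mem₀₁ (x := B) (y := B) ⟨0, one_pos, h'⟩ ⟨0, one_pos, SameVertex.refl _⟩ rfl

/-- Two kinds of face arcs cross the tangle. One enters from `nA` and follows the side from `A` to
`C` towards `sC`; the other enters from `sA` and turns round the corner at `A` towards `nA`. The
operation interchanges the two kinds but keeps the pairs of legs that they join. -/
theorem ots_runs (h : Tri E V A 1 B 1 C 1 nA sA nB sB nC sC)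
    {p : X → Prop} (hp : ∀ x, p x ↔ x ∉ V ∨
      x = E.σ (E.σ A) ∨ x = E.σ (E.σ B) ∨ x = E.σ (E.σ C)) :
    Runs E.φ p (E.φ nA) (E.σ (E.σ (E.σ sC))) ∧ Runs E.φ p (E.φ sA) (E.σ (E.σ (E.σ nA))) ∧
    ∀ x, E.SameVertex A x → ∃ y, p y ∧ E.φ.SameCycle x y := by
  have hAB := h.not_sameVertex
  have hAC : ¬ E.SameVertex A C := fun h' => h.rot.rot.not_sameVertex h'.symm
  have e1 : E.α nA = A := by rw [← h.nw₀, E.α_α]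
  have e2 : E.α sA = E.σ A := by rw [← h.sw₀, E.α_α]
  have hC := h.rot.rot
  have m1 : E.σ (E.σ (E.σ sC)) ∉ V := by simpa only [h.closed] using h.s₂_mem
  have m2 : E.σ (E.σ (E.σ nA)) ∉ V := by simpa only [h.closed] using h.n₀_mem
  have m3 : E.σ (E.σ (E.σ sA)) ∉ V := by simpa only [h.closed] using h.s₀_mem
  have a1 : E.φ (E.σ (E.σ (E.σ A))) = E.σ C := by
    rw [E.φ_apply, h.α_ne_one, E.σ_four]
  have a2 : E.φ (E.σ C) = E.σ (E.σ (E.σ sC)) := by rw [E.φ_apply, h.sw₂]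
  have a3 : E.φ A = E.σ (E.σ (E.σ nA)) := by rw [E.φ_apply, h.nw₀]
  have a4 : E.φ (E.σ A) = E.σ (E.σ (E.σ sA)) := by rw [E.φ_apply, h.sw₀]
  have q1 : ¬ p (E.σ (E.σ (E.σ A))) := by
    rw [hp]
    have hB : E.σ (E.σ (E.σ A)) ≠ E.σ (E.σ B) := fun h' => hAB (by
      have : E.SameVertex A (E.σ (E.σ (E.σ A))) := by simp [SameVertex.refl]
      rw [h'] at this; simpa using this)
    have hC : E.σ (E.σ (E.σ A)) ≠ E.σ (E.σ C) := fun h' => hAC (by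
      have : E.SameVertex A (E.σ (E.σ (E.σ A))) := by simp [SameVertex.refl]
      rw [h'] at this; simpa using this)
    simp [h.closed, h.start_mem₀, hB, hC]
  have q2 : ∀ {l : X}, E.SameVertex A l → l ≠ E.σ (E.σ A) → ¬ p l := by
    intro l hl hl'
    rw [hp]
    rintro (h' | h' | h' | h')
    · exact h' (h.mem_one.2 (Or.inl hl))
    · exact hl' h'
    · rw [h'] at hl; exact hAB (by simpa using hl)
    · rw [h'] at hl; exact hAC (by simpa using hl)
  have q3 : ¬ p (E.σ C) := by
    rw [hp]
    rintro (h' | h' | h' | h')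
    · exact h' (by rw [h.closed]; exact h.rot.rot.start_mem₀)
    · refine hAC ?_
      have : E.SameVertex C (E.σ C) := by simp [SameVertex.refl]
      rw [h'] at this
      exact SameVertex.symm (by simpa using this)
    · refine h.rot.not_sameVertex ?_
      have : E.SameVertex C (E.σ C) := by simp [SameVertex.refl]
      rw [h'] at this
      exact SameVertex.symm (by simpa using this)
    · exact E.σ_ne_self C (E.σ.injective h').symm
  have r1 : Runs E.φ p (E.σ (E.σ (E.σ A))) (E.σ (E.σ (E.σ sC))) := by
    refine Runs.step q1 ?_
    rw [a1]
    refine Runs.step q3 ?_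
    rw [a2]
    exact Runs.refl ((hp _).2 (Or.inl m1))
  have r2 : Runs E.φ p A (E.σ (E.σ (E.σ nA))) := by
    refine Runs.step (q2 (SameVertex.refl A) (E.σσ_ne_self A).symm) ?_
    rw [a3]
    exact Runs.refl ((hp _).2 (Or.inl m2))
  refine ⟨?_, ?_, fun x hx => ?_⟩
  · rwa [E.φ_apply, e1]
  · rwa [E.φ_apply, e2, E.σ_four]
  · rcases (E.sameVertex_iff _ _).1 hx with rfl | rfl | rfl | rfl
    · exact ⟨_, r2.mem, r2.sameCycle⟩
    · refine ⟨_, (hp _).2 (Or.inl m3), ?_⟩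
      rw [← a4]
      exact Perm.sameCycle_apply_right.2 (Perm.SameCycle.refl _ _)
    · exact ⟨_, (hp _).2 (Or.inr (Or.inl rfl)), Perm.SameCycle.refl _ _⟩
    · exact ⟨_, r1.mem, r1.sameCycle⟩

theorem Tri.replaces {l₀ l₁ l₂ l₀' l₁' l₂' : X} {k₀ k₁ k₂ k₀' k₁' k₂' : ℕ}
    {n₀ s₀ n₁ s₁ n₂ s₂ n₀' s₀' n₁' s₁' n₂' s₂' : X}
    (h : Tri E V l₀ k₀ l₁ k₁ l₂ k₂ n₀ s₀ n₁ s₁ n₂ s₂)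
    (h' : Tri E' V l₀' k₀' l₁' k₁' l₂' k₂' n₀' s₀' n₁' s₁' n₂' s₂') (hσ : E'.σ = E.σ)
    (hfr : ∀ x, x ∉ V → E.α x ∉ V → E'.α x = E.α x)
    (hs : ∀ x, (x = n₀ ∨ x = s₀ ∨ x = n₁ ∨ x = s₁ ∨ x = n₂ ∨ x = s₂) ↔
      (x = n₀' ∨ x = s₀' ∨ x = n₁' ∨ x = s₁' ∨ x = n₂' ∨ x = s₂')) : Replaces V E E' :=
  ⟨hσ, h.closed, hfr, fun x hx => ⟨fun hm => h'.α_out ((hs x).1 (h.out_cases hx hm)),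
    fun hm => h.α_out ((hs x).2 (h'.out_cases hx hm))⟩⟩

variable [Fintype X] in
theorem ots_card_faces (h : Tri E V A 1 B 1 C 1 nA sA nB sB nC sC)
    (h' : Tri E' V A 1 B 1 C 1 sB nC sC nA sA nB) (hσ : E'.σ = E.σ) (hR : Replaces V E E') :
    Nat.card (Quotient (Perm.SameCycle.setoid E'.φ)) =
      Nat.card (Quotient (Perm.SameCycle.setoid E.φ)) := by
  -- The central face never leaves the tangle, so its three darts are added to the outer darts in
  -- order that every face meets `p`.
  let p : X → Prop := fun x => x ∉ V ∨ x = E.σ (E.σ A) ∨ x = E.σ (E.σ B) ∨ x = E.σ (E.σ C)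
  have hp0 : ∀ x, p x ↔ x ∉ V ∨ x = E.σ (E.σ A) ∨ x = E.σ (E.σ B) ∨ x = E.σ (E.σ C) :=
    fun x => Iff.rfl
  have hp1 : ∀ x, p x ↔ x ∉ V ∨ x = E.σ (E.σ B) ∨ x = E.σ (E.σ C) ∨ x = E.σ (E.σ A) :=
    fun x => by rw [hp0]; tauto
  have hp2 : ∀ x, p x ↔ x ∉ V ∨ x = E.σ (E.σ C) ∨ x = E.σ (E.σ A) ∨ x = E.σ (E.σ B) :=
    fun x => by rw [hp0]; tauto
  have R0 := ots_runs h hp0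
  have R1 := ots_runs h.rot hp1
  have R2 := ots_runs h.rot.rot hp2
  have S0 := ots_runs h' (p := p) (by rw [hσ]; exact hp0)
  have S1 := ots_runs h'.rot (p := p) (by rw [hσ]; exact hp1)
  have S2 := ots_runs h'.rot.rot (p := p) (by rw [hσ]; exact hp2)
  rw [hσ] at S0 S1 S2
  refine (card_cycles_eq_of_runs (p := p) (fun x => ?_) (fun x => ?_) (fun x hx => ?_)).symm
  · by_cases hx : x ∈ V
    · rcases h.mem_one.1 hx with hm | hm | hm
      · exact R0.2.2 x hm
      · exact R1.2.2 x hm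
      · exact R2.2.2 x hm
    · exact ⟨x, Or.inl hx, Perm.SameCycle.refl _ _⟩
  · by_cases hx : x ∈ V
    · rcases h'.mem_one.1 hx with hm | hm | hm
      · exact S0.2.2 x hm
      · exact S1.2.2 x hm
      · exact S2.2.2 x hm
    · exact ⟨x, Or.inl hx, Perm.SameCycle.refl _ _⟩
  · by_cases hV : x ∈ V
    · have aux : ∀ (F : Diagram X), F.σ = E.σ → ∀ a b, E.σ (E.σ a) = x →
          F.α (F.σ (F.σ a)) = F.σ (F.σ (F.σ b)) → F.φ x = E.σ (E.σ b) := by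
        rintro F hF a b rfl hab
        rw [hF] at hab
        rw [F.φ_apply, hF, hab, E.σ_four]
      rcases hx with hx | hx | hx | hx
      · exact absurd hV hx
      · refine ⟨E.σ (E.σ B), ?_, ?_⟩
        · rw [aux E rfl A B hx.symm h.α_se_one]
          exact Runs.refl (Or.inr (Or.inr (Or.inl rfl)))
        · rw [aux E' hσ A B hx.symm h'.α_se_one]
          exact Runs.refl (Or.inr (Or.inr (Or.inl rfl)))
      · refine ⟨E.σ (E.σ C), ?_, ?_⟩
        · rw [aux E rfl B C hx.symm h.rot.α_se_one]
          exact Runs.refl (Or.inr (Or.inr (Or.inr rfl)))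
        · rw [aux E' hσ B C hx.symm h'.rot.α_se_one]
          exact Runs.refl (Or.inr (Or.inr (Or.inr rfl)))
      · refine ⟨E.σ (E.σ A), ?_, ?_⟩
        · rw [aux E rfl C A hx.symm h.rot.rot.α_se_one]
          exact Runs.refl (Or.inr (Or.inl rfl))
        · rw [aux E' hσ C A hx.symm h'.rot.rot.α_se_one]
          exact Runs.refl (Or.inr (Or.inl rfl))
    · by_cases hx' : E.α x ∈ V
      · rcases h.out_cases hV hx' with rfl | rfl | rfl | rfl | rfl | rfl
        · exact ⟨_, R0.1, S1.2.1⟩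
        · exact ⟨_, R0.2.1, S2.1⟩
        · exact ⟨_, R1.1, S2.2.1⟩
        · exact ⟨_, R1.2.1, S0.1⟩
        · exact ⟨_, R2.1, S0.2.1⟩
        · exact ⟨_, R2.2.1, S1.1⟩
      · have hm : E.φ x ∉ V := by
          rw [E.φ_apply]; simpa only [h.closed] using hx'
        have e : E'.φ x = E.φ x := by
          rw [E.φ_apply, E'.φ_apply, hσ, hR.frame x hV hx']
        exact ⟨E.φ x, Runs.refl (Or.inl hm), by rw [e]; exact Runs.refl (Or.inl hm)⟩

end OTS

end Diagram

namespace Diagram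

variable {X : Type*} {E E' : Diagram X} {V : Set X}

/-- Once two different cut edges are known, they exhaust a cut of at most two edges. -/
theorem two_edges_cover (E : Diagram X) {e f u v x : X} (hu : u = e ∨ u = E.α e ∨ u = f ∨ u = E.α f)
    (hv : v = e ∨ v = E.α e ∨ v = f ∨ v = E.α f) (h1 : v ≠ u) (h2 : v ≠ E.α u)
    (hx : x = e ∨ x = E.α e ∨ x = f ∨ x = E.α f) :
    x = u ∨ x = E.α u ∨ x = v ∨ x = E.α v := by
  have := E.α_α
  grind

section OTS

variable {A B C : X} {nA sA nB sB nC sC : X}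

/-- If `A` alone has its colour, its two sides of the triangle are the whole cut, so no leg changes
colour. In `E` paint the tangle with the colour of `B` and `C`: only the two legs `sB`, `nC`, which
`A` carries in `E'`, can disagree. By `colour_outside` even `sB` has the colour of `B`, and hence so
has `A`. -/
theorem ots_colour_aux (h : Tri E V A 1 B 1 C 1 nA sA nB sB nC sC)
    (h' : Tri E' V A 1 B 1 C 1 sB nC sC nA sA nB) (hR : Replaces V E E')
    (hc : E.ThreeEdgeConnected) {c : X → Prop} {e f : X}
    (hσ : ∀ x, c (E.σ x) = c x)
    (hα : ∀ x, c (E'.α x) ≠ c x → x = e ∨ x = E'.α e ∨ x = f ∨ x = E'.α f)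
    (h1 : c A ≠ c B) (h2 : c B = c C) : False := by
  have hs := hR.σ_eq
  have i1 : E'.α (E.σ (E.σ A)) = E.σ (E.σ (E.σ B)) := by rw [← hs]; exact h'.α_se_one
  have i2 : E'.α (E.σ (E.σ (E.σ A))) = E.σ (E.σ C) := by rw [← hs]; exact h'.α_ne_one
  have b1 := hα (E.σ (E.σ A)) (by rw [i1]; simpa only [hσ] using h1.symm)
  have b2 := hα (E.σ (E.σ (E.σ A))) (by rw [i2]; simpa only [hσ, ← h2] using h1.symm)
  have hcov : ∀ x, x ∉ V → c (E'.α x) = c x := by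
    intro x hx
    by_contra hcx
    have hBA : E.σ (E.σ (E.σ A)) ≠ E'.α (E.σ (E.σ A)) := by
      rw [i1]
      intro h0
      exact h.not_sameVertex (by
        rw [E.σ.injective (E.σ.injective (E.σ.injective h0))]; exact SameVertex.refl _)
    have hin : ∀ y, y = E.σ (E.σ A) ∨ y = E'.α (E.σ (E.σ A)) ∨ y = E.σ (E.σ (E.σ A)) ∨
        y = E'.α (E.σ (E.σ (E.σ A))) → y ∈ V := by
      have := h.start_mem₀
      have := h.rot.start_mem₀
      have := h.rot.rot.start_mem₀
      rintro y (rfl | rfl | rfl | rfl) <;> simp only [i1, i2, h.closed] <;> assumption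
    exact hx (hin x (E'.two_edges_cover b1 b2 (E.σ_ne_self _) hBA (hα x hcx)))
  have leg : ∀ {x y : X}, E'.α x = y → y ∉ V → c y = c x := by
    rintro x y rfl hy
    have := hcov _ hy
    rw [E'.α_α] at this
    exact this.symm
  have lσ : ∀ {x y : X}, E'.α (E'.σ x) = y → y ∉ V → c y = c x := by
    intro x y hxy hy
    rw [leg hxy hy, hs, hσ]
  have key : c sB = c B := by
    refine colour_outside (e := sB) (f := nC) h.closed hc hσ (fun x hx hx' => ?_)
      (fun x hx hx' => ?_) ⟨A, h.start_mem₀⟩ h.s₁_mem |>.trans rfl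
    · rw [← hR.frame x hx hx', hcov x hx]
    · rcases h.out_cases hx hx' with rfl | rfl | rfl | rfl | rfl | rfl
      · exact Or.inr (Or.inr (lσ h'.sw₁ h.n₀_mem))
      · exact Or.inr (Or.inr ((leg h'.nw₂ h.s₀_mem).trans h2.symm))
      · exact Or.inr (Or.inr ((lσ h'.sw₂ h.n₁_mem).trans h2.symm))
      · exact Or.inl rfl
      · exact Or.inr (Or.inl rfl)
      · exact Or.inr (Or.inr (leg h'.nw₁ h.s₂_mem))
  exact h1 (by rw [← key, leg h'.nw₀ h.s₁_mem])

/-- Of three crossings with two colours, either all agree and the tangle can be ignored, or exactly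
one is the odd one out. -/
theorem ots_threeEdgeConnected (h : Tri E V A 1 B 1 C 1 nA sA nB sB nC sC)
    (h' : Tri E' V A 1 B 1 C 1 sB nC sC nA sA nB) (hR : Replaces V E E')
    (hc : E.ThreeEdgeConnected) : E'.ThreeEdgeConnected := by
  refine CMap.threeEdgeConnected_of_colour fun c e f hσ hα => ?_
  rw [hR.σ_eq] at hσ
  by_cases h1 : c A = c B
  · by_cases h2 : c B = c C
    · refine hR.colour_const hc hσ hα ?_
      have key : ∀ x ∈ V, c x = c A := by
        intro x hx
        rcases h.mem_one.1 hx with hm | hm | hm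
        · exact (hm.map_eq hσ).symm
        · rw [h1]; exact (hm.map_eq hσ).symm
        · rw [h1, h2]; exact (hm.map_eq hσ).symm
      intro x hx y hy
      rw [key x hx, key y hy]
    · exact (ots_colour_aux h.rot.rot h'.rot.rot hR hc hσ hα
        (by rw [h1]; exact Ne.symm h2) h1).elim
  · by_cases h2 : c B = c C
    · exact (ots_colour_aux h h' hR hc hσ hα h1 h2).elim
    · have h3 : c C = c A := by
        by_cases c A <;> by_cases c B <;> by_cases c C <;> simp_all
      exact (ots_colour_aux h.rot h'.rot hR hc hσ hα h2 h3).elim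

theorem rewire_α_apply (ρ : Perm X) (W : Set X) (x : X) :
    (E.rewire ρ W).α (ρ x) = ρ (E.α x) := by
  change (ρ * E.α * ρ⁻¹) (ρ x) = _
  simp [Perm.mul_apply]

theorem rewire_isOver_of_mem (ρ : Perm X) {W : Set X}
    (hW : ∀ x, x ∈ V ↔ ∃ v ∈ W, E.SameVertex v x) {x : X} (hx : x ∈ V) :
    (E.rewire ρ W).isOver x = !E.isOver x := if_pos ((hW x).1 hx)

theorem rewire_isOver_of_notMem (ρ : Perm X) {W : Set X}
    (hW : ∀ x, x ∈ V ↔ ∃ v ∈ W, E.SameVertex v x) {x : X} (hx : x ∉ V) :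
    (E.rewire ρ W).isOver x = E.isOver x := if_neg fun h => hx ((hW x).2 h)

/-- The darts `A`, `B`, `C` lie on the same level, so the half turn moves every leg to a dart of the
opposite level. The exchange of over and under compensates for this. -/
theorem ots_alternating_aux (h : Tri E V A 1 B 1 C 1 nA sA nB sB nC sC)
    (h' : Tri E' V A 1 B 1 C 1 sB nC sC nA sA nB) (hσ : E'.σ = E.σ) (hE : E.Alternating)
    (hV : ∀ x, x ∈ V → E'.isOver x = !E.isOver x) (hV' : ∀ x, x ∉ V → E'.isOver x = E.isOver x)
    (x : X) (hx : E.SameVertex A x) : E'.isOver (E'.α x) = !E'.isOver x := by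
  have vA := h.start_mem₀
  have vB := h.rot.start_mem₀
  have vC := h.rot.rot.start_mem₀
  have alt : ∀ {x y : X}, E.α x = y → E.isOver y = !E.isOver x := by
    rintro x _ rfl; exact hE x
  have o1 := alt h.α_se_one
  have o2 := alt h.α_ne_one
  have l1 := alt h.sw₁
  have l2 := alt h.nw₂
  simp only [E.isOver_σ, Bool.not_not] at o1 o2 l1 l2
  have i1 := h'.sw₀
  have i2 := h'.α_se_one
  have i3 := h'.α_ne_one
  rw [hσ] at i1 i2 i3
  have cl := h.closed
  rcases (E.sameVertex_iff _ _).1 hx with rfl | rfl | rfl | rfl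
  · rw [h'.nw₀, hV' _ h'.n₀_mem, hV _ vA, l1, Bool.not_not, ← Bool.not_inj_iff, o1]
  · rw [i1, hV' _ h'.s₀_mem, hV _ ((cl _).2 vA), E.isOver_σ, l2, Bool.not_not, ← o2]
  · rw [i2, hV _ (by simpa only [cl]), hV _ (by simpa only [cl]), E.isOver_σ, E.isOver_σ,
      E.isOver_σ, E.isOver_σ, E.isOver_σ]
    simpa using o1
  · rw [i3, hV _ (by simpa only [cl]), hV _ (by simpa only [cl]), E.isOver_σ, E.isOver_σ,
      E.isOver_σ, E.isOver_σ, E.isOver_σ]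
    simpa using o2

theorem ots_alternating (h : Tri E V A 1 B 1 C 1 nA sA nB sB nC sC)
    (h' : Tri E' V A 1 B 1 C 1 sB nC sC nA sA nB) (hR : Replaces V E E') (hE : E.Alternating)
    (hV : ∀ x, x ∈ V → E'.isOver x = !E.isOver x) (hV' : ∀ x, x ∉ V → E'.isOver x = E.isOver x) :
    E'.Alternating := by
  refine hR.alternating hE (fun x hx => ?_) hV'
  rcases h.mem_one.1 hx with hm | hm | hm
  · exact ots_alternating_aux h h' hR.σ_eq hE hV hV' x hm
  · exact ots_alternating_aux h.rot h'.rot hR.σ_eq hE hV hV' x hm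
  · exact ots_alternating_aux h.rot.rot h'.rot.rot hR.σ_eq hE hV hV' x hm

variable [DecidableEq X]

/-- A reduced alternating prime diagram is changed inside the tangle `V` by a sequence of
operations that does not rename darts. -/
structure Good (V : Set X) (E E' : Diagram X) : Prop where
  transforms : E.Transforms V E'
  σ_eq : E'.σ = E.σ
  isOver_eq : ∀ x, x ∉ V → E'.isOver x = E.isOver x
  prime : E.IsReducedAlternatingPrime → E'.IsReducedAlternatingPrime
  frame : ∀ x, x ∉ V → E.α x ∉ V → E'.α x = E.α x

theorem Move.mono {V W : Set X} (hVW : V ⊆ W) {E E' : Diagram X} (h : Move V E E') :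
    Move W E E' := by
  cases h with
  | T l k h1 h2 h3 => exact Move.T E l k h1 h2 (h3.trans hVW)
  | OTS t h1 h2 => exact Move.OTS E t h1 fun x hx => hVW (h2 x hx)
  | isotopy e h1 => exact Move.isotopy E e fun x hx => h1 x fun h => hx (hVW h)

theorem Good.refl (V : Set X) (E : Diagram X) : Good V E E :=
  ⟨Relation.ReflTransGen.refl, rfl, fun _ _ => rfl, id, fun _ _ _ => rfl⟩

theorem Good.mono {V W : Set X} (hVW : V ⊆ W) (h : Good V E E') : Good W E E' :=
  ⟨Relation.ReflTransGen.mono (fun _ _ h => Move.mono hVW h) _ _ h.transforms, h.σ_eq,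
    fun x hx => h.isOver_eq x fun h' => hx (hVW h'), h.prime,
    fun x hx hx' => h.frame x (fun h' => hx (hVW h')) fun h' => hx' (hVW h')⟩

theorem Good.trans {E'' : Diagram X} (h : Good V E E') (h' : Good V E' E'') : Good V E E'' :=
  ⟨Relation.ReflTransGen.trans h.transforms h'.transforms, h'.σ_eq.trans h.σ_eq,
    fun x hx => (h'.isOver_eq x hx).trans (h.isOver_eq x hx), fun hE => h'.prime (h.prime hE),
    fun x hx hx' => by
      have := h.frame x hx hx'
      rw [h'.frame x hx (by rwa [this]), this]⟩

variable [Fintype X]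

/-- The operation `OTS` on a triangle none of whose legs returns to it. -/
theorem Tri.ots (h : Tri E V A 1 B 1 C 1 nA sA nB sB nC sC) :
    ∃ E' : Diagram X, Good V E E' ∧ Tri E' V A 1 B 1 C 1 sB nC sC nA sA nB := by
  have hAB := h.not_sameVertex
  have hBC := h.rot.not_sameVertex
  have hCA := h.rot.rot.not_sameVertex
  have f1 : E.φ (E.σ (E.σ A)) = E.σ (E.σ B) := by rw [E.φ_apply, h.α_se_one, E.σ_four]
  have f2 : E.φ (E.σ (E.σ B)) = E.σ (E.σ C) := by rw [E.φ_apply, h.rot.α_se_one, E.σ_four]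
  have f3 : E.φ (E.σ (E.σ C)) = E.σ (E.σ A) := by rw [E.φ_apply, h.rot.rot.α_se_one, E.σ_four]
  -- The triangle is based at the inner dart `σ² A`; there the darts `p`, `q` of `otsPerm` are the
  -- outer darts `A`, `σ A`, and likewise at `B` and `C`.
  set ρ : Perm X := swap A (E.σ B) * swap B (E.σ C) * swap C (E.σ A) with hρ
  have hots : E.otsPerm (E.σ (E.σ A)) = ρ := by
    simp only [CMap.otsPerm, f1, f2, E.σ_four, hρ]
  have sne : ∀ {u v x y : X}, ¬ E.SameVertex u v → E.SameVertex u x → E.SameVertex v y → x ≠ y := by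
    rintro u v x _ huv hx hy rfl
    exact huv (SameVertex.trans hx (SameVertex.symm hy))
  have r : ∀ x : X, E.SameVertex x x := SameVertex.refl
  have r' : ∀ x : X, E.SameVertex x (E.σ x) := fun x => sameVertex_σ_right.2 (r x)
  have hAC : ¬ E.SameVertex A C := fun h => hCA (SameVertex.symm h)
  have hnd : [A, E.σ A, B, E.σ B, C, E.σ C].Nodup := by
    simp only [List.nodup_cons, List.mem_cons, List.not_mem_nil, or_false, not_or,
      not_false_eq_true, List.nodup_nil, and_true]
    exact ⟨⟨(E.σ_ne_self A).symm, sne hAB (r _) (r _), sne hAB (r _) (r' _), sne hAC (r _) (r _),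
      sne hAC (r _) (r' _)⟩, ⟨sne hAB (r' _) (r _), sne hAB (r' _) (r' _), sne hAC (r' _) (r _),
      sne hAC (r' _) (r' _)⟩, ⟨(E.σ_ne_self B).symm, sne hBC (r _) (r _), sne hBC (r _) (r' _)⟩,
      ⟨sne hBC (r' _) (r _), sne hBC (r' _) (r' _)⟩, (E.σ_ne_self C).symm⟩
  obtain ⟨p1, p2, p3, p4, p5, p6, p7⟩ := Perm.three_swaps hnd
  rw [← hρ] at p1 p2 p3 p4 p5 p6 p7
  have mem_se : ∀ {u : X}, u ∈ V → E.σ (E.σ u) ∈ V := fun hu => by simpa only [h.closed] using hu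
  have fixV : ∀ x, x ∉ V → ρ x = x := by
    intro x hx
    have n1 : ∀ {y}, y ∈ V → x ≠ y := fun hy hxy => hx (hxy ▸ hy)
    have n2 : ∀ {y}, y ∈ V → x ≠ E.σ y := fun hy => n1 ((h.closed _).2 hy)
    exact p7 x (n1 h.start_mem₀) (n2 h.start_mem₀) (n1 h.rot.start_mem₀) (n2 h.rot.start_mem₀)
      (n1 h.rot.rot.start_mem₀) (n2 h.rot.rot.start_mem₀)
  have fixse : ∀ u, u = A ∨ u = B ∨ u = C →
      ρ (E.σ (E.σ u)) = E.σ (E.σ u) ∧ ρ (E.σ (E.σ (E.σ u))) = E.σ (E.σ (E.σ u)) := by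
    have t1 : ∀ u, E.σ (E.σ u) ≠ E.σ u := fun u hu => E.σ_ne_self _ hu
    have t2 : ∀ u, E.σ (E.σ (E.σ u)) ≠ E.σ u := fun u hu => E.σσ_ne_self _ hu
    have q : ∀ {u v}, ¬ E.SameVertex u v → E.σ (E.σ u) ≠ v ∧ E.σ (E.σ u) ≠ E.σ v ∧
        E.σ (E.σ (E.σ u)) ≠ v ∧ E.σ (E.σ (E.σ u)) ≠ E.σ v := by
      intro u v huv
      refine ⟨?_, ?_, ?_, ?_⟩ <;> refine sne huv (by simp [r]) (by simp [r])
    have hBA : ¬ E.SameVertex B A := fun h => hAB (SameVertex.symm h)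
    have hCB : ¬ E.SameVertex C B := fun h => hBC (SameVertex.symm h)
    rintro u (rfl | rfl | rfl)
    · obtain ⟨a1, a2, a3, a4⟩ := q hAB
      obtain ⟨b1, b2, b3, b4⟩ := q hAC
      exact ⟨p7 _ (E.σσ_ne_self _) (t1 _) a1 a2 b1 b2, p7 _ (E.σσσ_ne_self _) (t2 _) a3 a4 b3 b4⟩
    · obtain ⟨a1, a2, a3, a4⟩ := q hBA
      obtain ⟨b1, b2, b3, b4⟩ := q hBC
      exact ⟨p7 _ a1 a2 (E.σσ_ne_self _) (t1 _) b1 b2, p7 _ a3 a4 (E.σσσ_ne_self _) (t2 _) b3 b4⟩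
    · obtain ⟨a1, a2, a3, a4⟩ := q hCA
      obtain ⟨b1, b2, b3, b4⟩ := q hCB
      exact ⟨p7 _ a1 a2 b1 b2 (E.σσ_ne_self _) (t1 _), p7 _ a3 a4 b3 b4 (E.σσσ_ne_self _) (t2 _)⟩
  let E' := E.OTS (E.σ (E.σ A))
  have hE' : ∀ x, E'.α (ρ x) = ρ (E.α x) := by
    intro x
    rw [← hots]
    exact rewire_α_apply _ _ x
  have hσ : E'.σ = E.σ := rfl
  have hfr : ∀ x, x ∉ V → E.α x ∉ V → E'.α x = E.α x := by
    intro x hx hx'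
    have := hE' x
    rwa [fixV x hx, fixV _ hx'] at this
  have hleg : ∀ {x y z : X}, E.α x = z → z ∉ V → ρ x = y → E'.α y = z := by
    rintro x y z rfl hz rfl
    rw [hE', fixV _ hz]
  have hin : ∀ {u v : X}, (u = A ∨ u = B ∨ u = C) → (v = A ∨ v = B ∨ v = C) →
      E.α (E.σ (E.σ u)) = E.σ (E.σ (E.σ v)) → E'.α (E.σ (E.σ u)) = E.σ (E.σ (E.σ v)) := by
    intro u v hu hv huv
    have := hE' (E.σ (E.σ u))
    rwa [(fixse u hu).1, huv, (fixse v hv).2] at this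
  have htd : ∀ l, E'.twistDarts l 1 = E.twistDarts l 1 := fun l => by
    rw [twistDarts_one, twistDarts_one]; rfl
  have h' : Tri E' V A 1 B 1 C 1 sB nC sC nA sA nB := by
    refine ⟨⟨E'.isTwist_one _, E'.isTwist_one _, E'.isTwist_one _, ?_, ?_, ?_, ?_, ?_, ?_⟩, ?_,
      hleg h.sw₁ h.s₁_mem p2, hleg h.nw₂ h.n₂_mem p5, hleg h.sw₂ h.s₂_mem p4,
      hleg h.nw₀ h.n₀_mem p1, hleg h.sw₀ h.s₀_mem p6, hleg h.nw₁ h.n₁_mem p3,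
      h.s₁_mem, h.n₂_mem, h.s₂_mem, h.n₀_mem, h.s₀_mem, h.n₁_mem⟩
    · rw [htd, htd]; exact h.disj₀₁
    · rw [htd, htd]; exact h.rot.disj₀₁
    · rw [htd, htd]; exact h.rot.rot.disj₀₁
    · exact hin (Or.inl rfl) (Or.inr (Or.inl rfl)) h.α_se_one
    · exact hin (Or.inr (Or.inl rfl)) (Or.inr (Or.inr rfl)) h.rot.α_se_one
    · exact hin (Or.inr (Or.inr rfl)) (Or.inl rfl) h.rot.rot.α_se_one
    · rw [htd, htd, htd]; exact h.V_eq
  have hR : Replaces V E E' := h.replaces h' hσ hfr (fun x => by tauto)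
  have hW : ∀ x, x ∈ V ↔ ∃ v ∈ ({E.σ (E.σ A), E.φ (E.σ (E.σ A)), E.φ (E.φ (E.σ (E.σ A)))} : Set X),
      E.SameVertex v x := by
    intro x
    rw [h.mem_one]
    simp [f1, f2]
  have hoV : ∀ x, x ∉ V → E'.isOver x = E.isOver x := fun x => rewire_isOver_of_notMem _ hW
  refine ⟨E', ⟨Relation.ReflTransGen.single (Move.OTS E _ ?_ ?_), hσ, hoV, fun hE => ?_, hfr⟩, h'⟩
  -- Two parallel edges from `u` to `v` would have to use both inner darts `σ² u`, `σ³ u`, because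
  -- the legs of `u` leave `V`. These two darts lead to different crossings of the triangle.
  · have mc : ∀ {u v : X} {n s : X}, E.α u = n → E.α (E.σ u) = s → n ∉ V → s ∉ V → v ∈ V →
        ¬ (E.SameVertex v (E.α (E.σ (E.σ u))) ∧ E.SameVertex v (E.α (E.σ (E.σ (E.σ u))))) →
        ¬ E.MultiplyConnected (E.σ (E.σ u)) (E.σ (E.σ v)) := by
      rintro u v n s hn hs hn' hs' hv hno ⟨a, b, hab, ha, hb, ha', hb'⟩
      have vmem : ∀ {x y : X}, x ∈ V → E.SameVertex x y → y ∈ V := by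
        intro x y hx hxy
        have := hxy.map_eq (h := fun z => z ∈ V) (fun z => propext (h.closed z))
        exact (iff_of_eq this).1 hx
      have cas : ∀ {a}, E.SameVertex (E.σ (E.σ u)) a → E.SameVertex (E.σ (E.σ v)) (E.α a) →
          a = E.σ (E.σ u) ∨ a = E.σ (E.σ (E.σ u)) := by
        intro a ha ha'
        have hm := vmem (mem_se hv) ha'
        rcases (E.sameVertex_iff u a).1 (by simpa using ha) with rfl | rfl | rfl | rfl
        · rw [hn] at hm; exact absurd hm hn'
        · rw [hs] at hm; exact absurd hm hs'
        · exact Or.inl rfl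
        · exact Or.inr rfl
      simp only [sameVertex_σ_left] at ha' hb'
      rcases cas ha (by simpa using ha') with rfl | rfl <;>
        rcases cas hb (by simpa using hb') with rfl | rfl
      · exact hab rfl
      · exact hno ⟨ha', hb'⟩
      · exact hno ⟨hb', ha'⟩
      · exact hab rfl
    refine ⟨by rw [f1, f2, f3], ?_⟩
    rw [f1, f2]
    simp only [sameVertex_σ_left, sameVertex_σ_right]
    refine ⟨hAB, hBC, hCA, ?_, ?_, ?_⟩
    · refine mc h.nw₀ h.sw₀ h.n₀_mem h.s₀_mem h.rot.start_mem₀ fun hh => ?_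
      rw [h.α_ne_one] at hh
      exact hBC (by simpa using hh.2)
    · refine mc h.nw₁ h.sw₁ h.n₁_mem h.s₁_mem h.rot.rot.start_mem₀ fun hh => ?_
      rw [h.rot.α_ne_one] at hh
      exact hCA (by simpa using hh.2)
    · refine mc h.nw₂ h.sw₂ h.n₂_mem h.s₂_mem h.start_mem₀ fun hh => ?_
      rw [h.rot.rot.α_ne_one] at hh
      exact hAB (by simpa using hh.2)
  · intro x hx
    rw [f1, f2] at hx
    rw [h.mem_one]
    simpa using hx
  · refine hE.of_sphere hσ (Perm.card_cycles_conj _ _) (ots_card_faces h h' hσ hR) ?_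
      (ots_threeEdgeConnected h h' hR hE.prime) hAB
    exact ots_alternating h h' hR hE.alternating (fun x => rewire_isOver_of_mem _ hW) hoV

end OTS

end Diagram

/-! ### The operation `T` on a row of crossings -/

theorem List.formPerm_four {X : Type*} [DecidableEq X] {a b c d : X} (h : [a, b, c, d].Nodup) :
    let ρ := List.formPerm [a, b, c, d]
    ρ a = b ∧ ρ b = c ∧ ρ c = d ∧ ρ d = a ∧ ∀ x, x ≠ a → x ≠ b → x ≠ c → x ≠ d → ρ x = x := by
  simp only [List.nodup_cons, List.mem_cons, List.not_mem_nil, or_false, not_or, not_false_eq_true,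
    List.nodup_nil, and_true] at h
  obtain ⟨⟨h1, h2, h3⟩, ⟨h4, h5⟩, h6⟩ := h
  have hρ : List.formPerm [a, b, c, d] = Equiv.swap a b * (Equiv.swap b c * Equiv.swap c d) := by
    simp [List.formPerm_cons_cons]
  rw [hρ]
  refine ⟨?_, ?_, ?_, ?_, ?_⟩
  · simp [Equiv.swap_apply_of_ne_of_ne, *]
  · simp [Equiv.swap_apply_of_ne_of_ne, *, Ne.symm h2, Ne.symm h4]
  · simp [Equiv.swap_apply_of_ne_of_ne, *, Ne.symm h5, Ne.symm h3, Ne.symm h6]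
  · simp [*]
  · intro x g1 g2 g3 g4
    simp [Equiv.swap_apply_of_ne_of_ne, *]

namespace Diagram

variable {X : Type*} {E E' : Diagram X} {V : Set X}

/-- A twist whose crossings are those of `V` and whose four legs end outside `V`. -/
structure Row (E : Diagram X) (V : Set X) (l : X) (k : ℕ) (n s u v : X) : Prop where
  twist : E.IsTwist l k
  V_eq : V = E.twistDarts l k
  nw : E.α l = n
  sw : E.α (E.σ l) = s
  se : E.α (E.se l k) = u
  ne : E.α (E.ne l k) = v
  n_mem : n ∉ V
  s_mem : s ∉ V
  u_mem : u ∉ V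
  v_mem : v ∉ V

namespace Row

variable {l : X} {k : ℕ} {n s u v : X}

theorem closed (h : Row E V l k n s u v) (x : X) : E.σ x ∈ V ↔ x ∈ V := by
  rw [h.V_eq]; simp

theorem row_mem (h : Row E V l k n s u v) {i : ℕ} (hi : i < k) : E.rowDart l i ∈ V := by
  rw [h.V_eq]; exact E.rowDart_mem hi

theorem cases (h : Row E V l k n s u v) {x : X} (hx : x ∈ V) :
    x = l ∨ x = E.σ l ∨ x = E.se l k ∨ x = E.ne l k ∨
    ∃ i, i + 1 < k ∧ (x = E.σ (E.σ (E.rowDart l i)) ∨ x = E.σ (E.σ (E.σ (E.rowDart l i))) ∨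
      x = E.rowDart l (i + 1) ∨ x = E.σ (E.rowDart l (i + 1))) :=
  h.twist.dart_cases (h.V_eq ▸ hx)

theorem out_cases (h : Row E V l k n s u v) {x : X} (hx : x ∉ V) (hx' : E.α x ∈ V) :
    x = n ∨ x = s ∨ x = u ∨ x = v := by
  rcases h.cases hx' with h' | h' | h' | h' | ⟨i, hi, h'⟩
  · left; rw [← h.nw, ← h', E.α_α]
  · right; left; rw [← h.sw, ← h', E.α_α]
  · right; right; left; rw [← h.se, ← h', E.α_α]
  · right; right; right; rw [← h.ne, ← h', E.α_α]
  · have := h.twist.α_mem_of_inner hi h'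
    rw [E.α_α, ← h.V_eq] at this
    exact absurd this hx

theorem start_mem (h : Row E V l k n s u v) : l ∈ V := by
  rw [h.V_eq]; exact E.start_mem h.twist.pos

theorem se_mem (h : Row E V l k n s u v) : E.se l k ∈ V := by
  rw [h.V_eq]; exact E.se_mem h.twist.pos

theorem ne_mem (h : Row E V l k n s u v) : E.ne l k ∈ V := by
  rw [h.V_eq]; exact E.ne_mem h.twist.pos

theorem α_out (h : Row E V l k n s u v) {x : X} (hx : x = n ∨ x = s ∨ x = u ∨ x = v) :
    E.α x ∈ V := by
  rcases hx with rfl | rfl | rfl | rfl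
  · rw [← h.nw, E.α_α]; exact h.start_mem
  · rw [← h.sw, E.α_α, h.closed]; exact h.start_mem
  · rw [← h.se, E.α_α]; exact h.se_mem
  · rw [← h.ne, E.α_α]; exact h.ne_mem

theorem replaces {l' : X} {k' : ℕ} {n' s' u' v' : X} (h : Row E V l k n s u v)
    (h' : Row E' V l' k' n' s' u' v') (hσ : E'.σ = E.σ)
    (hfr : ∀ x, x ∉ V → E.α x ∉ V → E'.α x = E.α x)
    (hs : ∀ x, (x = n ∨ x = s ∨ x = u ∨ x = v) ↔ (x = n' ∨ x = s' ∨ x = u' ∨ x = v')) :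
    Replaces V E E' :=
  ⟨hσ, h.closed, hfr, fun x hx => ⟨fun hm => h'.α_out ((hs x).1 (h.out_cases hx hm)),
    fun hm => h.α_out ((hs x).2 (h'.out_cases hx hm))⟩⟩

/-- Faces cross a row in four arcs: along its upper and its lower side, and round its two ends. All
other darts lie on the inner bigons and are taken as return points. -/
theorem runs (h : Row E V l k n s u v) {p : X → Prop} (hp : ∀ x, p x ↔ x ∉ V ∨
      ∃ i, i + 1 < k ∧ (x = E.σ (E.σ (E.rowDart l i)) ∨ x = E.rowDart l (i + 1))) :
    Runs E.φ p (E.φ n) (E.σ (E.σ (E.σ v))) ∧ Runs E.φ p (E.φ v) (E.σ (E.σ (E.σ u))) ∧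
    Runs E.φ p (E.φ u) (E.σ (E.σ (E.σ s))) ∧ Runs E.φ p (E.φ s) (E.σ (E.σ (E.σ n))) ∧
    ∀ x ∈ V, ∃ y, p y ∧ E.φ.SameCycle x y := by
  have hk := h.twist.pos
  have inj : ∀ {i j x}, i < k → j < k → E.SameVertex (E.rowDart l i) x →
      E.SameVertex (E.rowDart l j) x → i = j := fun hi hj h1 h2 =>
    h.twist.inj hi hj (SameVertex.trans h1 (SameVertex.symm h2))
  have r : ∀ x : X, E.SameVertex x x := SameVertex.refl
  have p0 : ∀ {x : X}, x ∉ V → p x := fun hx => (hp _).2 (Or.inl hx)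
  have m : ∀ {x}, x ∉ V → E.σ (E.σ (E.σ x)) ∉ V := fun hx => by simpa only [h.closed] using hx
  -- upper and lower sides
  have q3 : ∀ {i}, i < k → ¬ p (E.σ (E.σ (E.σ (E.rowDart l i)))) := by
    intro i hi
    rw [hp]
    rintro (h' | ⟨j, hj, h' | h'⟩)
    · exact h' (by simpa only [h.closed] using h.row_mem hi)
    · obtain rfl := inj (j := j) (x := E.σ (E.σ (E.rowDart l j))) hi (by omega)
        (by rw [← h']; simp [r]) (by simp [r])
      exact E.σ_ne_self _ h'
    · obtain rfl := inj (j := j + 1) (x := E.rowDart l (j + 1)) hi hj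
        (by rw [← h']; simp [r]) (by simp [r])
      exact E.σσσ_ne_self _ h'
  have q1 : ∀ {i}, i < k → ¬ p (E.σ (E.rowDart l i)) := by
    intro i hi
    rw [hp]
    rintro (h' | ⟨j, hj, h' | h'⟩)
    · exact h' (by simpa only [h.closed] using h.row_mem hi)
    · obtain rfl := inj (j := j) (x := E.σ (E.σ (E.rowDart l j))) hi (by omega)
        (by rw [← h']; simp [r]) (by simp [r])
      exact E.σ_ne_self _ (E.σ.injective h').symm
    · obtain rfl := inj (j := j + 1) (x := E.rowDart l (j + 1)) hi hj
        (by rw [← h']; simp [r]) (by simp [r])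
      exact E.σ_ne_self _ h'
  have q0 : ¬ p l := by
    rw [hp]
    rintro (h' | ⟨j, hj, h' | h'⟩)
    · exact h' h.start_mem
    · obtain rfl := inj (i := 0) (j := j) (x := E.σ (E.σ (E.rowDart l j))) (by omega) (by omega)
        (by rw [← h']; simp [r]) (by simp [r])
      exact E.σσ_ne_self _ h'.symm
    · have := inj (i := 0) (j := j + 1) (x := E.rowDart l (j + 1)) (by omega) hj
        (by rw [← h']; simp [r]) (by simp [r])
      omega
  have q2 : ¬ p (E.se l k) := by
    rw [hp]
    rintro (h' | ⟨j, hj, h' | h'⟩)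
    · exact h' h.se_mem
    · have := inj (i := k - 1) (j := j) (x := E.σ (E.σ (E.rowDart l j))) (by omega) (by omega)
        (by rw [← h', Diagram.se]; simp [r]) (by simp [r])
      omega
    · have := inj (i := k - 1) (j := j + 1) (x := E.rowDart l (j + 1)) (by omega) hj
        (by rw [← h', Diagram.se]; simp [r]) (by simp [r])
      rw [Diagram.se, this] at h'
      exact E.σσ_ne_self _ h'
  have top : ∀ j, j < k → Runs E.φ p (E.σ (E.σ (E.σ (E.rowDart l (k - 1 - j)))))
      (E.σ (E.σ (E.σ v))) := by
    intro j
    induction j with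
    | zero =>
      intro _
      refine Runs.step (q3 (by omega)) ?_
      rw [E.φ_apply, Nat.sub_zero, show E.σ (E.σ (E.σ (E.rowDart l (k - 1)))) = E.ne l k from rfl,
        h.ne]
      exact Runs.refl (p0 (m h.v_mem))
    | succ j ih =>
      intro hj
      refine Runs.step (q3 (by omega)) ?_
      rw [E.φ_apply, α_ne_rowDart, show k - 1 - (j + 1) + 1 = k - 1 - j by omega]
      exact ih (by omega)
  have bot : ∀ j, j < k → Runs E.φ p (E.σ (E.rowDart l j)) (E.σ (E.σ (E.σ s))) := by
    intro j
    induction j with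
    | zero =>
      intro hj
      refine Runs.step (q1 hj) ?_
      rw [E.φ_apply, rowDart_zero, h.sw]
      exact Runs.refl (p0 (m h.s_mem))
    | succ j ih =>
      intro hj
      refine Runs.step (q1 hj) ?_
      rw [E.φ_apply, h.twist.α_sw hj, E.σ_four]
      exact ih (by omega)
  have left : Runs E.φ p l (E.σ (E.σ (E.σ n))) := by
    refine Runs.step q0 ?_
    rw [E.φ_apply, h.nw]
    exact Runs.refl (p0 (m h.n_mem))
  have right : Runs E.φ p (E.se l k) (E.σ (E.σ (E.σ u))) := by
    refine Runs.step q2 ?_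
    rw [E.φ_apply, h.se]
    exact Runs.refl (p0 (m h.u_mem))
  refine ⟨?_, ?_, ?_, ?_, fun x hx => ?_⟩
  · rw [E.φ_apply, ← h.nw, E.α_α]
    simpa using top (k - 1) (by omega)
  · rw [E.φ_apply, ← h.ne, E.α_α, ne_eq_σ_se, E.σ_four]
    exact right
  · rw [E.φ_apply, ← h.se, E.α_α, Diagram.se, E.σ_four]
    exact bot (k - 1) (by omega)
  · rw [E.φ_apply, ← h.sw, E.α_α, E.σ_four]
    exact left
  · rw [h.V_eq] at hx
    obtain ⟨i, hi, hx⟩ := hx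
    rcases (E.sameVertex_iff _ _).1 hx with rfl | rfl | rfl | rfl
    · rcases i with _ | i
      · exact ⟨_, left.mem, left.sameCycle⟩
      · exact ⟨_, (hp _).2 (Or.inr ⟨i, hi, Or.inr rfl⟩), Perm.SameCycle.refl _ _⟩
    · exact ⟨_, (bot i hi).mem, (bot i hi).sameCycle⟩
    · by_cases hi' : i + 1 < k
      · exact ⟨_, (hp _).2 (Or.inr ⟨i, hi', Or.inl rfl⟩), Perm.SameCycle.refl _ _⟩
      · obtain rfl : i = k - 1 := by omega
        exact ⟨_, right.mem, right.sameCycle⟩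
    · have := top (k - 1 - i) (by omega)
      rw [show k - 1 - (k - 1 - i) = i by omega] at this
      exact ⟨_, this.mem, this.sameCycle⟩

/-- A quarter turn moves the four arcs one place on, but in either position they join cyclically
consecutive legs. -/
theorem card_faces [Finite X] (h : Row E V l k n s u v) (h' : Row E' V l k v n s u)
    (hr : ∀ i, i < k → E'.rowDart l i = E.rowDart l i) (hR : Replaces V E E') :
    Nat.card (Quotient (Perm.SameCycle.setoid E'.φ)) =
      Nat.card (Quotient (Perm.SameCycle.setoid E.φ)) := by
  have hσ := hR.σ_eq
  let p : X → Prop := fun x => x ∉ V ∨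
      ∃ i, i + 1 < k ∧ (x = E.σ (E.σ (E.rowDart l i)) ∨ x = E.rowDart l (i + 1))
  obtain ⟨a1, a2, a3, a4, a5⟩ := h.runs (p := p) fun x => Iff.rfl
  obtain ⟨b1, b2, b3, b4, b5⟩ := h'.runs (p := p) fun x => or_congr_right
    (exists_congr fun i => and_congr_right fun hi => by rw [hr i (by omega), hr _ hi, hσ])
  rw [hσ] at b1 b2 b3 b4
  refine (card_cycles_eq_of_runs (p := p) (fun x => ?_) (fun x => ?_) (fun x hx => ?_)).symm
  · by_cases hx : x ∈ V
    · exact a5 x hx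
    · exact ⟨x, Or.inl hx, Perm.SameCycle.refl _ _⟩
  · by_cases hx : x ∈ V
    · exact b5 x hx
    · exact ⟨x, Or.inl hx, Perm.SameCycle.refl _ _⟩
  · by_cases hV : x ∈ V
    · rcases hx with hx | ⟨i, hi, rfl | rfl⟩
      · exact absurd hV hx
      · have e1 : E.φ (E.σ (E.σ (E.rowDart l i))) = E.rowDart l (i + 1) := by
          rw [E.φ_apply, h.twist.α_se hi, E.σ_four]
        have e2 : E'.φ (E.σ (E.σ (E.rowDart l i))) = E.rowDart l (i + 1) := by
          rw [← hr i (by omega), ← hσ, E'.φ_apply, h'.twist.α_se hi, E'.σ_four, hr _ hi]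
        have hpp : p (E.rowDart l (i + 1)) := Or.inr ⟨i, hi, Or.inr rfl⟩
        exact ⟨_, by rw [e1]; exact Runs.refl hpp, by rw [e2]; exact Runs.refl hpp⟩
      · have e1 : E.φ (E.rowDart l (i + 1)) = E.σ (E.σ (E.rowDart l i)) := by
          rw [E.φ_apply, α_rowDart_succ]; simp
        have e2 : E'.φ (E.rowDart l (i + 1)) = E.σ (E.σ (E.rowDart l i)) := by
          rw [← hr i (by omega), ← hr _ hi, ← hσ, E'.φ_apply, α_rowDart_succ]; simp
        have hpp : p (E.σ (E.σ (E.rowDart l i))) := Or.inr ⟨i, hi, Or.inl rfl⟩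
        exact ⟨_, by rw [e1]; exact Runs.refl hpp, by rw [e2]; exact Runs.refl hpp⟩
    · by_cases hx' : E.α x ∈ V
      · rcases h.out_cases hV hx' with rfl | rfl | rfl | rfl
        · exact ⟨_, a1, b4⟩
        · exact ⟨_, a4, b3⟩
        · exact ⟨_, a3, b2⟩
        · exact ⟨_, a2, b1⟩
      · have hm : E.φ x ∉ V := by
          rw [E.φ_apply]; simpa only [h.closed] using hx'
        have e : E'.φ x = E.φ x := by
          rw [E.φ_apply, E'.φ_apply, hσ, hR.frame x hV hx']
        exact ⟨E.φ x, Runs.refl (Or.inl hm), by rw [e]; exact Runs.refl (Or.inl hm)⟩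

/-- If the colour changes inside the row, it does so at a single bigon whose two edges are the whole
cut. Then the legs `v`, `n` at the left end have one colour and `s`, `u` at the right end the other.
In `E` the row can be painted with the former, and `colour_outside` forces this colour on `s` as
well. -/
theorem threeEdgeConnected (h : Row E V l k n s u v) (h' : Row E' V l k v n s u)
    (hr : ∀ i, i < k → E'.rowDart l i = E.rowDart l i) (hR : Replaces V E E')
    (hc : E.ThreeEdgeConnected) : E'.ThreeEdgeConnected := by
  refine CMap.threeEdgeConnected_of_colour fun c e f hσ hα => ?_
  have hs := hR.σ_eq
  rw [hs] at hσ
  have hk := h.twist.pos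
  have chain : ∀ a b, a ≤ b → b < k → (∀ j, a ≤ j → j < b → c (E.rowDart l j) =
      c (E.rowDart l (j + 1))) → c (E.rowDart l a) = c (E.rowDart l b) := by
    intro a b hab
    induction b, hab using Nat.le_induction with
    | base => intros; rfl
    | succ b hab ih =>
      intro hb hj
      rw [ih (by omega) fun j h1 h2 => hj j h1 (by omega), hj b hab (by omega)]
  by_cases hcon : ∀ i, i + 1 < k → c (E.rowDart l i) = c (E.rowDart l (i + 1))
  · refine hR.colour_const hc hσ hα ?_
    have key : ∀ x ∈ V, c x = c l := by
      intro x hx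
      rw [h.V_eq] at hx
      obtain ⟨i, hi, hx⟩ := hx
      rw [← hx.map_eq hσ]
      exact (chain 0 i (Nat.zero_le _) hi fun j _ hj => hcon j (by omega)).symm
    intro x hx y hy
    rw [key x hx, key y hy]
  · exfalso
    push Not at hcon
    obtain ⟨i, hi, hci⟩ := hcon
    have i1 : ∀ j, j + 1 < k → E'.α (E.σ (E.σ (E.rowDart l j))) = E.σ (E.rowDart l (j + 1)) := by
      intro j hj
      rw [← hr j (by omega), ← hr _ hj, ← hs, h'.twist.α_se hj]
    have i2 : ∀ j, j + 1 < k → E'.α (E.σ (E.σ (E.σ (E.rowDart l j)))) = E.rowDart l (j + 1) := by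
      intro j hj
      rw [← hr j (by omega), ← hr _ hj, ← hs, α_ne_rowDart]
    have b1 := hα (E.σ (E.σ (E.rowDart l i))) (by
      rw [i1 i hi]; simpa only [hσ] using Ne.symm hci)
    have b2 := hα (E.σ (E.σ (E.σ (E.rowDart l i)))) (by
      rw [i2 i hi]; simpa only [hσ] using Ne.symm hci)
    have hcov := fun x hx => E'.two_edges_cover b1 b2 (E.σ_ne_self _) (by
      rw [i1 i hi]
      intro h0
      have := h.twist.inj (i := i) (j := i + 1) (by omega) hi (by
        rw [← E.σ.injective h0]; simp [SameVertex.refl])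
      omega) (hα x hx)
    rw [i1 i hi, i2 i hi] at hcov
    have hout : ∀ x, x ∉ V → c (E'.α x) = c x := by
      intro x hx
      by_contra hcx
      have m0 := h.row_mem (i := i) (by omega)
      have m1 := h.row_mem hi
      rcases hcov x hcx with rfl | rfl | rfl | rfl <;>
        exact hx (by simpa only [h.closed])
    have hrow : ∀ j, j + 1 < k → j ≠ i → c (E.rowDart l j) = c (E.rowDart l (j + 1)) := by
      intro j hj hji
      by_contra hcx
      have sv : ∀ {a b x : _}, a < k → b < k → E.SameVertex (E.rowDart l a) x →
          E.SameVertex (E.rowDart l b) x → a = b := fun hi hj h1 h2 =>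
        h.twist.inj hi hj (SameVertex.trans h1 (SameVertex.symm h2))
      have r : ∀ x : X, E.SameVertex x x := SameVertex.refl
      rcases hcov (E.σ (E.σ (E.rowDart l j))) (by
        rw [i1 j hj]; simpa only [hσ] using Ne.symm hcx) with h0 | h0 | h0 | h0
      · exact hji (sv (x := E.σ (E.σ (E.rowDart l j))) (by omega) (by omega) (by simp [r])
          (by rw [h0]; simp [r]))
      · have := sv (a := j) (b := i + 1) (x := E.σ (E.σ (E.rowDart l j))) (by omega) (by omega)
          (by simp [r]) (by rw [h0]; simp [r])
        rw [this] at h0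
        exact E.σ_ne_self _ (E.σ.injective h0)
      · exact hji (sv (x := E.σ (E.σ (E.rowDart l j))) (by omega) (by omega) (by simp [r])
          (by rw [h0]; simp [r]))
      · have := sv (a := j) (b := i + 1) (x := E.σ (E.σ (E.rowDart l j))) (by omega) (by omega)
          (by simp [r]) (by rw [h0]; simp [r])
        rw [this] at h0
        exact E.σσ_ne_self _ h0
    have c1 : c l = c (E.rowDart l i) :=
      chain 0 i (Nat.zero_le _) (by omega) fun j _ hj => hrow j (by omega) (by omega)
    have c2 : c (E.rowDart l (i + 1)) = c (E.rowDart l (k - 1)) :=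
      chain (i + 1) (k - 1) (by omega) (by omega) fun j h1 h2 => hrow j (by omega) (by omega)
    have leg : ∀ {x y : X}, E'.α x = y → y ∉ V → c y = c x := by
      rintro x y rfl hy
      have := hout _ hy
      rw [E'.α_α] at this
      exact this.symm
    have g1 : c v = c l := leg h'.nw h.v_mem
    have g2 : c n = c l := by rw [leg h'.sw h.n_mem, hs, hσ]
    have g3 : c s = c (E.rowDart l (k - 1)) := by
      rw [leg h'.se h.s_mem, Diagram.se, hs, hσ, hσ, hr _ (by omega)]
    have key : c s = c l := by
      refine colour_outside (e := s) (f := u) h.closed hc hσ (fun x hx hx' => ?_)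
        (fun x hx hx' => ?_) ⟨l, h.start_mem⟩ h.s_mem
      · rw [← hR.frame x hx hx', hout x hx]
      · rcases h.out_cases hx hx' with rfl | rfl | rfl | rfl
        · exact Or.inr (Or.inr g2)
        · exact Or.inl rfl
        · exact Or.inr (Or.inl rfl)
        · exact Or.inr (Or.inr g1)
    exact hci (by rw [← c1, ← key, g3, c2])

/-- Neighbouring ends of a row lie on opposite levels, so a quarter turn reverses the level met by
each leg; this cancels with the exchange of over and under. Inner edges have both their ends
exchanged. -/
theorem alternating (h : Row E V l k n s u v) (h' : Row E' V l k v n s u)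
    (hr : ∀ i, i < k → E'.rowDart l i = E.rowDart l i) (hR : Replaces V E E')
    (hE : E.Alternating) (hV : ∀ x, x ∈ V → E'.isOver x = !E.isOver x)
    (hV' : ∀ x, x ∉ V → E'.isOver x = E.isOver x) : E'.Alternating := by
  have hs := hR.σ_eq
  have hk := h.twist.pos
  refine hR.alternating hE (fun x hx => ?_) hV'
  have alt : ∀ {x y : X}, E.α x = y → E.isOver y = !E.isOver x := by
    rintro x _ rfl; exact hE x
  have row : ∀ i, E.isOver (E.rowDart l i) = E.isOver l := by
    intro i
    induction i with
    | zero => rfl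
    | succ i ih =>
      rw [rowDart_succ, hE, E.isOver_σ, E.isOver_σ, E.isOver_σ, ih]; simp
  have ose : E.isOver (E.se l k) = E.isOver l := by
    rw [Diagram.se, E.isOver_σ, E.isOver_σ, row]; simp
  have one : E.isOver (E.ne l k) = !E.isOver l := by
    rw [ne_eq_σ_se, E.isOver_σ, ose]
  have e1 : E'.se l k = E.se l k := by rw [Diagram.se, Diagram.se, hr _ (by omega), hs]
  have e2 : E'.ne l k = E.ne l k := by rw [ne_eq_σ_se, ne_eq_σ_se, e1, hs]
  rcases h.cases hx with rfl | rfl | rfl | rfl | ⟨i, hi, h0⟩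
  · rw [h'.nw, hV' _ h.v_mem, hV _ hx, alt h.ne, one]
  · rw [← hs, h'.sw, hs, hV' _ h.n_mem, hV _ hx, alt h.nw, E.isOver_σ]; simp
  · rw [← e1, h'.se, e1, hV' _ h.s_mem, hV _ hx, alt h.sw, E.isOver_σ, ose]
  · rw [← e2, h'.ne, e2, hV' _ h.u_mem, hV _ hx, alt h.se, ose, one]; simp
  · have e : E'.α x = E.α x := by
      rcases h0 with rfl | rfl | rfl | rfl
      · rw [h.twist.α_se hi, ← hr i (by omega), ← hs, h'.twist.α_se hi, hr _ hi]
      · rw [α_ne_rowDart, ← hr i (by omega), ← hs, α_ne_rowDart, hr _ hi]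
      · rw [α_rowDart_succ, ← hr _ hi, α_rowDart_succ, hr _ (by omega), hs]
      · rw [h.twist.α_sw hi, ← hr _ hi, ← hs, h'.twist.α_sw hi, hr _ (by omega)]
    have hm : E.α x ∈ V := by rw [h.V_eq]; exact h.twist.α_mem_of_inner hi h0
    rw [e, hV _ hm, hV _ hx, hE]

variable [Fintype X] [DecidableEq X]

/-- Without bigons at its two ends the row is a whole group, which is what `T` requires. -/
theorem turn (h : Row E V l k n s u v) (hk : 2 ≤ k) (hb : ¬ E.IsBigon l)
    (hb' : ¬ E.IsBigon (E.se l k)) :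
    Good V E (E.turn l k) ∧ Row (E.turn l k) V l k v n s u ∧
      ∀ i, i < k → (E.turn l k).rowDart l i = E.rowDart l i := by
  set E' := E.turn l k with hE'def
  have inj : ∀ {i j x}, i < k → j < k → E.SameVertex (E.rowDart l i) x →
      E.SameVertex (E.rowDart l j) x → i = j := fun hi hj h1 h2 =>
    h.twist.inj hi hj (SameVertex.trans h1 (SameVertex.symm h2))
  have r : ∀ x : X, E.SameVertex x x := SameVertex.refl
  have n03 : ∀ {x y : X}, E.SameVertex l x → E.SameVertex (E.rowDart l (k - 1)) y → x ≠ y := by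
    rintro x _ h1 h2 rfl
    have := inj (i := 0) (by omega) (by omega) h1 h2
    omega
  have rse : E.SameVertex (E.rowDart l (k - 1)) (E.se l k) := by simp [Diagram.se, r]
  have rne : E.SameVertex (E.rowDart l (k - 1)) (E.ne l k) := by simp [Diagram.ne, r]
  have hnd : [E.nw l, E.sw l, E.se l k, E.ne l k].Nodup := by
    simp only [List.nodup_cons, List.mem_cons, List.not_mem_nil, or_false, not_or,
      not_false_eq_true, List.nodup_nil, and_true]
    exact ⟨⟨(E.σ_ne_self l).symm, n03 (r l) rse, n03 (r l) rne⟩, ⟨n03 (by simp [Diagram.sw, r]) rse,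
      n03 (by simp [Diagram.sw, r]) rne⟩, (E.σ_ne_self _).symm⟩
  obtain ⟨p1, p2, p3, p4, p5⟩ := List.formPerm_four hnd
  set ρ := List.formPerm [E.nw l, E.sw l, E.se l k, E.ne l k] with hρ
  have hE' : ∀ x, E'.α (ρ x) = ρ (E.α x) := fun x => rewire_α_apply _ _ x
  have hσ : E'.σ = E.σ := rfl
  have fixV : ∀ x, x ∉ V → ρ x = x := by
    intro x hx
    have n1 : ∀ {y}, y ∈ V → x ≠ y := fun hy hxy => hx (hxy ▸ hy)
    exact p5 x (n1 h.start_mem) (n1 ((h.closed _).2 h.start_mem)) (n1 h.se_mem) (n1 h.ne_mem)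
  have hfr : ∀ x, x ∉ V → E.α x ∉ V → E'.α x = E.α x := by
    intro x hx hx'
    have := hE' x
    rwa [fixV x hx, fixV _ hx'] at this
  have hleg : ∀ {x y z : X}, E.α x = z → z ∉ V → ρ x = y → E'.α y = z := by
    rintro x y z rfl hz rfl
    rw [hE', fixV _ hz]
  have fixin : ∀ i, i + 1 < k → ρ (E.σ (E.σ (E.rowDart l i))) = E.σ (E.σ (E.rowDart l i)) ∧
      ρ (E.σ (E.σ (E.σ (E.rowDart l i)))) = E.σ (E.σ (E.σ (E.rowDart l i))) ∧
      ρ (E.rowDart l (i + 1)) = E.rowDart l (i + 1) ∧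
      ρ (E.σ (E.rowDart l (i + 1))) = E.σ (E.rowDart l (i + 1)) := by
    intro i hi
    have a0 : ∀ {x}, E.SameVertex (E.rowDart l (i + 1)) x → x ≠ l ∧ x ≠ E.σ l := by
      intro x hx
      refine ⟨?_, ?_⟩ <;> rintro rfl <;>
        have := inj (i := 0) (j := i + 1) (by omega) hi (by simp [r]) hx <;> omega
    have a1 : ∀ {x}, E.SameVertex (E.rowDart l i) x → x ≠ E.se l k ∧ x ≠ E.ne l k := by
      intro x hx
      refine ⟨?_, ?_⟩ <;> rintro rfl
      · have := inj (i := k - 1) (j := i) (by omega) (by omega) rse hx; omega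
      · have := inj (i := k - 1) (j := i) (by omega) (by omega) rne hx; omega
    have a2 : ∀ x, x ≠ E.σ (E.σ x) ∧ E.σ x ≠ E.σ (E.σ x) ∧ x ≠ E.σ (E.σ (E.σ x)) ∧
        E.σ x ≠ E.σ (E.σ (E.σ x)) := fun x =>
      ⟨(E.σσ_ne_self x).symm, (E.σ_ne_self _).symm, (E.σσσ_ne_self x).symm, (E.σσ_ne_self _).symm⟩
    have a3 : ∀ {x y}, E.SameVertex (E.rowDart l i) x → E.SameVertex l y →
        (i = 0 → x ≠ y) → x ≠ y := by
      rintro x _ hx hy hi0 rfl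
      exact hi0 (inj (by omega) (by omega) hx hy) rfl
    have a4 : ∀ {x y}, E.SameVertex (E.rowDart l (i + 1)) x →
        E.SameVertex (E.rowDart l (k - 1)) y → (i + 1 = k - 1 → x ≠ y) → x ≠ y := by
      rintro x _ hx hy hi0 rfl
      exact hi0 (inj (by omega) (by omega) hx hy) rfl
    have t2 : E.SameVertex (E.rowDart l i) (E.σ (E.σ (E.rowDart l i))) := by simp [r]
    have t3 : E.SameVertex (E.rowDart l i) (E.σ (E.σ (E.σ (E.rowDart l i)))) := by simp [r]
    have t1 : E.SameVertex (E.rowDart l (i + 1)) (E.σ (E.rowDart l (i + 1))) := by simp [r]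
    have lσ : E.SameVertex l (E.σ l) := by simp [r]
    refine ⟨p5 _ ?_ ?_ (a1 t2).1 (a1 t2).2, p5 _ ?_ ?_ (a1 t3).1 (a1 t3).2,
      p5 _ (a0 (r _)).1 (a0 (r _)).2 ?_ ?_, p5 _ (a0 t1).1 (a0 t1).2 ?_ ?_⟩
    · exact a3 t2 (r l) (by rintro rfl; exact (a2 l).1.symm)
    · exact a3 t2 lσ (by rintro rfl; exact (a2 l).2.1.symm)
    · exact a3 t3 (r l) (by rintro rfl; exact (a2 l).2.2.1.symm)
    · exact a3 t3 lσ (by rintro rfl; exact (a2 l).2.2.2.symm)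
    · exact a4 (r _) rse (by intro h0; rw [Diagram.se, h0]; exact (a2 _).1)
    · exact a4 (r _) rne (by intro h0; rw [Diagram.ne, h0]; exact (a2 _).2.2.1)
    · exact a4 t1 rse (by intro h0; rw [Diagram.se, h0]; exact (a2 _).2.1)
    · exact a4 t1 rne (by intro h0; rw [Diagram.ne, h0]; exact (a2 _).2.2.2)
  have h3 : ∀ i, i + 1 < k → E'.α (E.σ (E.σ (E.σ (E.rowDart l i)))) =
      E.α (E.σ (E.σ (E.σ (E.rowDart l i)))) := by
    intro i hi
    have := hE' (E.σ (E.σ (E.σ (E.rowDart l i))))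
    rwa [(fixin i hi).2.1, α_ne_rowDart, (fixin i hi).2.2.1, ← α_ne_rowDart] at this
  have h2 : ∀ i, i + 1 < k → E'.α (E.σ (E.σ (E.rowDart l i))) = E.α (E.σ (E.σ (E.rowDart l i))) := by
    intro i hi
    have := hE' (E.σ (E.σ (E.rowDart l i)))
    rwa [(fixin i hi).1, h.twist.α_se hi, (fixin i hi).2.2.2, ← h.twist.α_se hi] at this
  have hr : ∀ i, i < k → E'.rowDart l i = E.rowDart l i := fun i hi => rowDart_congr hσ h3 hi
  have e1 : E'.se l k = E.se l k := se_congr hσ h.twist.pos h3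
  have e2 : E'.ne l k = E.ne l k := by rw [ne_eq_σ_se, ne_eq_σ_se, e1, hσ]
  have h' : Row E' V l k v n s u := by
    refine ⟨h.twist.congr hσ h2 h3, ?_, hleg h.ne h.v_mem p4, hleg h.nw h.n_mem p1, ?_, ?_,
      h.v_mem, h.n_mem, h.s_mem, h.u_mem⟩
    · rw [twistDarts_congr hσ h3]; exact h.V_eq
    · rw [e1]; exact hleg h.sw h.s_mem p2
    · rw [e2]; exact hleg h.se h.u_mem p3
  have hR : Replaces V E E' := h.replaces h' hσ hfr (fun x => by tauto)
  have hW : ∀ x, x ∈ V ↔ ∃ v ∈ {x | ∃ i < k, x = E.rowDart l i}, E.SameVertex v x := by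
    intro x
    rw [h.V_eq, mem_twistDarts]
    constructor
    · rintro ⟨i, hi, hx⟩; exact ⟨_, ⟨i, hi, rfl⟩, hx⟩
    · rintro ⟨_, ⟨i, hi, rfl⟩, hx⟩; exact ⟨i, hi, hx⟩
  have hoV : ∀ x, x ∉ V → E'.isOver x = E.isOver x := fun x => rewire_isOver_of_notMem _ hW
  refine ⟨⟨Relation.ReflTransGen.single (Move.T E l k hk ⟨h.twist, hb, hb', by omega⟩
    (by rw [h.V_eq])), hσ, hoV, fun hE => ?_, hfr⟩, h', hr⟩
  refine hE.of_sphere hσ (Perm.card_cycles_conj _ _) (h.card_faces h' hr hR)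
    (h.alternating h' hr hR hE.alternating (fun x => rewire_isOver_of_mem _ hW) hoV)
    (h.threeEdgeConnected h' hr hR hE.prime)
    (u := l) (v := E.rowDart l 1) (fun h0 => ?_)
  have := inj (i := 0) (j := 1) (x := E.rowDart l 1) (by omega) (by omega) h0 (r _)
  omega

/-- A twist can be turned by a quarter turn; for a single crossing only the names change. -/
theorem exists_turn (h : Row E V l k n s u v) (hb : ¬ E.SameVertex n s) (hb' : ¬ E.SameVertex u v) :
    ∃ (E' : Diagram X) (l' : X), Good V E E' ∧ Row E' V l' k v n s u := by
  obtain hk | hk : k = 1 ∨ 2 ≤ k := by have := h.twist.pos; omega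
  · subst hk
    refine ⟨E, E.σ (E.σ (E.σ l)), Good.refl _ _, E.isTwist_one _, ?_, h.ne, ?_, ?_, ?_, h.v_mem,
      h.n_mem, h.s_mem, h.u_mem⟩
    · rw [h.V_eq]; ext x; simp
    · rw [E.σ_four]; exact h.nw
    · rw [se_one, E.σ_four]; exact h.sw
    · rw [ne_one, E.σ_four]; exact h.se
  · refine ⟨E.turn l k, l, ?_⟩
    obtain ⟨h1, h2, -⟩ := h.turn hk
      (fun h0 => hb (by
        have := ((E.isBigon_iff _).1 h0).1
        rw [h.nw, h.sw] at this
        rw [this]; simp [SameVertex.refl]))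
      (fun h0 => hb' (by
        have := ((E.isBigon_iff _).1 h0).1
        rw [← ne_eq_σ_se, h.se, h.ne] at this
        rw [this]; simp [SameVertex.refl]))
    exact ⟨h1, h2⟩

end Row

end Diagram

/-! ### Splitting and prolonging a triangle; passing along a twist -/

namespace Diagram

variable {X : Type*} {E E' : Diagram X} {V : Set X}

theorem Row.reverse {l : X} {k : ℕ} {n s u v : X} (h : Row E V l k n s u v) :
    Row E V (E.se l k) k u v n s :=
  ⟨h.twist.reverse, by rw [h.twist.twistDarts_reverse]; exact h.V_eq, h.se, h.ne,
    by rw [h.twist.se_se]; exact h.nw, by rw [h.twist.ne_se]; exact h.sw,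
    h.u_mem, h.v_mem, h.n_mem, h.s_mem⟩

theorem sameVertex_congr (hσ : E'.σ = E.σ) {x y : X} : E'.SameVertex x y ↔ E.SameVertex x y := by
  rw [CMap.SameVertex, hσ, CMap.SameVertex]

theorem mem_twistDarts_one {l x : X} : x ∈ E.twistDarts l 1 ↔ E.SameVertex l x := by simp

theorem notMem_of_sameVertex {V : Set X} (hV : ∀ x, E.σ x ∈ V ↔ x ∈ V) {x y : X} (hx : x ∉ V)
    (hxy : E.SameVertex x y) : y ∉ V := by
  have := hxy.map_eq (h := fun z => z ∈ V) (fun z => propext (hV z))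
  exact fun hy => hx ((iff_of_eq this).2 hy)

namespace Tri

variable {l₀ l₁ l₂ : X} {k₀ k₁ k₂ : ℕ} {n₀ s₀ n₁ s₁ n₂ s₂ : X}

/-- The innermost crossing of the third twist forms a triangle with the two other twists. -/
theorem split {m : ℕ} (h : Tri E V l₀ k₀ l₁ k₁ l₂ (m + 2) n₀ s₀ n₁ s₁ n₂ s₂) :
    ∃ W : Set X, Tri E W l₀ k₀ l₁ k₁ (E.rowDart l₂ (m + 1)) 1 n₀ s₀ n₁ s₁
        (E.σ (E.σ (E.σ (E.rowDart l₂ m)))) (E.σ (E.σ (E.rowDart l₂ m))) ∧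
      V = W ∪ E.twistDarts l₂ (m + 1) ∧ (∀ x ∈ E.twistDarts l₂ (m + 1), x ∉ W) := by
  have hsub : E.twistDarts (E.rowDart l₂ (m + 1)) 1 ⊆ E.twistDarts l₂ (m + 2) := by
    rw [E.twistDarts_succ l₂ (m + 1), twistDarts_one]
    exact Set.subset_union_right
  have hVW : V = E.twistDarts l₀ k₀ ∪ E.twistDarts l₁ k₁ ∪
      E.twistDarts (E.rowDart l₂ (m + 1)) 1 ∪ E.twistDarts l₂ (m + 1) := by
    rw [h.V_eq, E.twistDarts_succ l₂ (m + 1), twistDarts_one]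
    ext x; simp only [Set.mem_union]; tauto
  have hWV : ∀ {x}, x ∉ V → x ∉ E.twistDarts l₀ k₀ ∪ E.twistDarts l₁ k₁ ∪
      E.twistDarts (E.rowDart l₂ (m + 1)) 1 := fun hx hx' => hx (by rw [hVW]; exact Or.inl hx')
  have hno : ∀ x ∈ E.twistDarts l₂ (m + 1), x ∉ E.twistDarts l₀ k₀ ∪ E.twistDarts l₁ k₁ ∪
      E.twistDarts (E.rowDart l₂ (m + 1)) 1 := by
    intro x hx hx'
    have hx2 : x ∈ E.twistDarts l₂ (m + 2) := E.twistDarts_mono (by omega) hx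
    rcases hx' with (hx' | hx') | hx'
    · exact h.rot.rot.ne_of_mem₀₁ hx2 hx' rfl
    · exact h.rot.ne_of_mem₀₁ hx' hx2 rfl
    · obtain ⟨i, hi, hs⟩ := hx
      have := h.rot.rot.twist₀.inj (i := i) (j := m + 1) (by omega) (by omega)
        (SameVertex.trans hs (SameVertex.symm (mem_twistDarts_one.1 hx')))
      omega
  refine ⟨_, ⟨⟨h.twist₀, h.rot.twist₀, E.isTwist_one _, h.disj₀₁,
    h.rot.disj₀₁.mono_right hsub, h.rot.rot.disj₀₁.mono_left hsub, h.α_se₀, h.rot.α_se₀,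
    h.rot.rot.α_se₀⟩, rfl, h.nw₀, h.sw₀, h.nw₁, h.sw₁, E.α_rowDart_succ _ _,
    h.rot.rot.twist₀.α_sw (by omega), hWV h.n₀_mem, hWV h.s₀_mem, hWV h.n₁_mem, hWV h.s₁_mem,
    hno _ ?_, hno _ ?_⟩, hVW, hno⟩
  · simpa using E.rowDart_mem (by omega : m < m + 1)
  · simpa using E.rowDart_mem (by omega : m < m + 1)

/-- A crossing joined to the outer end of the third twist prolongs it. -/
theorem cons {W : Set X} {z n s : X}
    (h : Tri E W l₀ k₀ l₁ k₁ l₂ k₂ n₀ s₀ n₁ s₁ (E.σ (E.σ (E.σ z))) (E.σ (E.σ z)))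
    (hV : V = W ∪ {x | E.SameVertex z x}) (hz : z ∉ W) (hn : E.α z = n) (hs : E.α (E.σ z) = s)
    (m₀ : n₀ ∉ V) (m₀' : s₀ ∉ V) (m₁ : n₁ ∉ V) (m₁' : s₁ ∉ V) (m : n ∉ V) (m' : s ∉ V) :
    Tri E V l₀ k₀ l₁ k₁ z (k₂ + 1) n₀ s₀ n₁ s₁ n s := by
  have h1 : E.α (E.σ (E.σ (E.σ z))) = l₂ := by rw [← h.nw₂, E.α_α]
  have h2 : E.α (E.σ (E.σ z)) = E.σ l₂ := by rw [← h.sw₂, E.α_α]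
  have hk := h.rot.rot.twist₀.pos
  have hd : ∀ {l k}, E.twistDarts l k ⊆ W → Disjoint (E.twistDarts l k) {x | E.SameVertex z x} :=
    fun {l k} hl => Set.disjoint_left.2 fun x hx hx' =>
      notMem_of_sameVertex h.closed hz hx' (hl hx)
  have hse : E.se z (k₂ + 1) = E.se l₂ k₂ := se_cons hk h1
  refine ⟨⟨h.twist₀, h.rot.twist₀, h.rot.rot.twist₀.cons h1 h2 fun h' => hz (h.rot.rot.sub₀ h'),
    h.disj₀₁, ?_, ?_, h.α_se₀, ?_, ?_⟩, ?_, h.nw₀, h.sw₀, h.nw₁, h.sw₁, hn, hs, m₀, m₀', m₁, m₁',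
    m, m'⟩
  · rw [twistDarts_cons h1]
    exact Set.disjoint_union_right.2 ⟨hd h.rot.sub₀, h.rot.disj₀₁⟩
  · rw [twistDarts_cons h1]
    exact Set.disjoint_union_left.2 ⟨(hd h.sub₀).symm, h.rot.rot.disj₀₁⟩
  · rw [ne_eq_σ_se E z, hse]; exact h.rot.α_se₀
  · rw [hse]; exact h.rot.rot.α_se₀
  · rw [hV, h.V_eq, twistDarts_cons h1]
    ext x; simp only [Set.mem_union]; tauto

end Tri

section

variable [DecidableEq X]

/-- A twist outside the changed tangle remains. -/
theorem Good.twist {W : Set X} (hg : Good W E E') {l : X} {k : ℕ} (h : E.IsTwist l k)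
    (hW : ∀ x ∈ E.twistDarts l k, x ∉ W) :
    E'.IsTwist l k ∧ (∀ i < k, E'.rowDart l i = E.rowDart l i) ∧
      E'.twistDarts l k = E.twistDarts l k ∧ E'.se l k = E.se l k := by
  have h3 : ∀ i, i + 1 < k → E'.α (E.σ (E.σ (E.σ (E.rowDart l i)))) =
      E.α (E.σ (E.σ (E.σ (E.rowDart l i)))) := fun i hi =>
    hg.frame _ (hW _ (by simpa using E.rowDart_mem (by omega)))
      (hW _ (h.α_mem_of_inner hi (Or.inr (Or.inl rfl))))
  have h2 : ∀ i, i + 1 < k → E'.α (E.σ (E.σ (E.rowDart l i))) = E.α (E.σ (E.σ (E.rowDart l i))) :=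
    fun i hi => hg.frame _ (hW _ (by simpa using E.rowDart_mem (by omega)))
      (hW _ (h.α_mem_of_inner hi (Or.inl rfl)))
  exact ⟨h.congr hg.σ_eq h2 h3, fun i hi => rowDart_congr hg.σ_eq h3 hi,
    twistDarts_congr hg.σ_eq h3, se_congr hg.σ_eq h.pos h3⟩

variable [Fintype X]

/-- Two single crossings pass along the third twist of a triangle. -/
theorem Tri.pass {c : ℕ} : ∀ {E : Diagram X} {V : Set X} {A B C nA sA nB sB nC sC : X},
    Tri E V A 1 B 1 C (c + 1) nA sA nB sB nC sC →
    ∃ (E' : Diagram X) (A' B' C' : X), Good V E E' ∧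
      Tri E' V A' 1 B' 1 C' (c + 1) sB nC sC nA sA nB := by
  induction c with
  | zero =>
    intro E V A B C nA sA nB sB nC sC h
    obtain ⟨E', h1, h2⟩ := h.ots
    exact ⟨E', A, B, C, h1, h2⟩
  | succ m ih =>
    intro E V A B C nA sA nB sB nC sC h
    obtain ⟨V3, h3, hV, hno⟩ := h.split
    set Z := E.rowDart C (m + 1)
    set W := E.rowDart C m
    have hV3V : V3 ⊆ V := by rw [hV]; exact Set.subset_union_left
    -- `OTS` acts on `A`, `B` and the innermost crossing `Z` of the row. The other crossings of the
    -- row lie outside that tangle and survive as a twist.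
    obtain ⟨E1, g1, t1⟩ := h3.ots
    obtain ⟨w1, w2, w3, w4⟩ := g1.twist
      (h.rot.rot.twist₀.prefix (j := m + 1) (by omega) (by omega)) hno
    have hσ := g1.σ_eq
    -- Around the next central face the order is `B`, `A`, rest of the row. The darts `σ B` and `σ³
    -- A` are the upper left darts with respect to this face.
    let V' := E1.twistDarts (E.σ B) 1 ∪ E1.twistDarts (E.σ (E.σ (E.σ A))) 1 ∪
      E1.twistDarts C (m + 1)
    have e1 : E1.twistDarts (E.σ B) 1 = {x | E.SameVertex B x} := by
      ext x; rw [mem_twistDarts_one, sameVertex_congr hσ]; simp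
    have e2 : E1.twistDarts (E.σ (E.σ (E.σ A))) 1 = {x | E.SameVertex A x} := by
      ext x; rw [mem_twistDarts_one, sameVertex_congr hσ]; simp
    have hVV' : V = V' ∪ {x | E.SameVertex Z x} := by
      rw [hV, h3.V_eq]
      simp only [V', e1, e2, w3, twistDarts_one]
      ext x; simp only [Set.mem_union]; tauto
    have hV'V : ∀ {x}, x ∉ V → x ∉ V' := fun hx hx' => hx (by rw [hVV']; exact Or.inl hx')
    have hZ : ∀ {x}, E.SameVertex Z x → x ∉ V' := by
      intro x hx hx'
      simp only [V', e1, e2, w3] at hx'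
      rcases hx' with (hx' | hx') | hx'
      · exact h3.rot.ne_of_mem₀₁ (mem_twistDarts_one.2 hx') (mem_twistDarts_one.2 hx) rfl
      · exact h3.rot.rot.ne_of_mem₀₁ (mem_twistDarts_one.2 hx) (mem_twistDarts_one.2 hx') rfl
      · exact hno x hx' (h3.rot.rot.sub₀ (mem_twistDarts_one.2 hx))
    have d1 : Disjoint {x | E.SameVertex B x} {x | E.SameVertex A x} := by
      have := h.disj₀₁
      rw [twistDarts_one, twistDarts_one] at this
      exact this.symm
    have d2 : Disjoint {x | E.SameVertex A x} (E.twistDarts C (m + 1)) := by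
      refine Set.disjoint_left.2 fun x hx hx' => hno x hx' (h3.sub₀ (mem_twistDarts_one.2 hx))
    have d3 : Disjoint (E.twistDarts C (m + 1)) {x | E.SameVertex B x} := by
      refine Set.disjoint_left.2 fun x hx hx' => hno x hx (h3.rot.sub₀ (mem_twistDarts_one.2 hx'))
    have i1 := t1.α_ne_one
    have i2 := t1.rot.α_ne_one
    have i3 := t1.rot.α_se_one
    have l1 := t1.sw₀
    have l2 := t1.sw₁
    have l3 := t1.sw₂
    rw [hσ] at i1 i2 i3 l1 l2 l3
    have hCm : C ∈ E.twistDarts C (m + 1) := E.start_mem (by omega)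
    have t2 : Tri E1 V' (E.σ B) 1 (E.σ (E.σ (E.σ A))) 1 C (m + 1) nA (E.σ (E.σ (E.σ Z)))
        (E.σ (E.σ Z)) sB nC sC := by
      refine ⟨⟨E1.isTwist_one _, E1.isTwist_one _, w1, ?_, ?_, ?_, ?_, ?_, ?_⟩, rfl, l2, ?_, i1,
        ?_, ?_, ?_, hV'V h.n₀_mem, hZ (by simp [SameVertex.refl]), hZ (by simp [SameVertex.refl]),
        hV'V h.s₁_mem, hV'V h.n₂_mem, hV'V h.s₂_mem⟩
      · rw [e1, e2]; exact d1
      · rw [e2, w3]; exact d2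
      · rw [e1, w3]; exact d3
      · rw [se_one, ne_one, hσ, i2, E.σ_four]
      · rw [se_one, hσ, E.σ_four, l1, ne_eq_σ_se, w4, hσ]; rfl
      · rw [w4, ne_one, hσ, E.σ_four]
        change E1.α (E.σ (E.σ W)) = B
        rw [E1.α_eq_iff]; exact t1.nw₁.symm
      · rw [hσ, i3]
      · rw [hσ, E.σ_four]; exact t1.nw₀
      · rw [g1.frame _ (hno _ hCm), h.nw₂]
        rw [h.nw₂]; exact fun h' => h.n₂_mem (hV3V h')
      · rw [hσ, g1.frame _ (hno _ (by simpa using hCm)), h.sw₂]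
        rw [h.sw₂]; exact fun h' => h.s₂_mem (hV3V h')
    obtain ⟨E2, A2, B2, C2, g2, t3⟩ := ih t2
    have hσ2 : E2.σ = E.σ := g2.σ_eq.trans hσ
    have hV'sub : V' ⊆ V := by rw [hVV']; exact Set.subset_union_left
    refine ⟨E2, A2, B2, Z, (g1.mono hV3V).trans (g2.mono hV'sub), ?_⟩
    rw [← hσ2] at t3
    -- `Z`, left behind with the legs `sA` and `nB`, becomes the outermost crossing of the
    -- transported twist.
    refine t3.cons ?_ (hZ (SameVertex.refl _)) ?_ ?_ h.s₁_mem h.n₂_mem h.s₂_mem h.n₀_mem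
      h.s₀_mem h.n₁_mem
    · rw [hVV']
      simp only [sameVertex_congr hσ2]
    · rw [g2.frame _ (hZ (SameVertex.refl _)), t1.nw₂]
      rw [t1.nw₂]; exact hV'V h.s₀_mem
    · rw [hσ2, g2.frame _ (hZ (by simp [SameVertex.refl])), l3]
      rw [l3]; exact hV'V h.n₁_mem

end

end Diagram

/-! ### The induction on the size of the second twist -/

namespace Diagram

variable {X : Type*} {E E' : Diagram X} {V : Set X} [DecidableEq X] [Fintype X]

namespace Tri

/-- Two single crossings `A`, `B` pass along the twist `C`, which is then turned so that its end
points towards `B'` and towards the legs that `B` had. -/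
theorem pass_turn {A B C nA sA nB sB nC sC : X} {c : ℕ} (hc : 1 ≤ c)
    (h : Tri E V A 1 B 1 C c nA sA nB sB nC sC) (hn : ¬ E.SameVertex sA nB) :
    ∃ (E' : Diagram X) (A' B' C' : X) (W : Set X), Good V E E' ∧
      V = W ∪ {x | E.SameVertex A' x} ∪ {x | E.SameVertex B' x} ∧
      ¬ E.SameVertex A' B' ∧
      (∀ x, E.SameVertex A' x → x ∉ W) ∧ (∀ x, E.SameVertex B' x → x ∉ W) ∧
      Row E' W C' c (E.σ (E.σ B')) sA nB (E.σ (E.σ (E.σ A'))) ∧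
      E'.α A' = sB ∧ E'.α (E.σ A') = nC ∧ E'.α B' = sC ∧ E'.α (E.σ B') = nA ∧
      E'.α (E.σ (E.σ A')) = E.σ (E.σ (E.σ B')) := by
  obtain ⟨c, rfl⟩ := Nat.exists_eq_add_of_le' hc
  obtain ⟨E1, A', B', C', g1, t1⟩ := h.pass
  have hσ := g1.σ_eq
  set W := E1.twistDarts C' (c + 1)
  have hAB : ¬ E.SameVertex A' B' := fun h0 =>
    t1.ne_of_mem₀₁ (x := B') (y := B') (mem_twistDarts_one.2 ((sameVertex_congr hσ).2 h0))
      (mem_twistDarts_one.2 (SameVertex.refl _)) rfl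
  have hA : ∀ x, E.SameVertex A' x → x ∉ W := fun x hx hx' =>
    t1.rot.rot.ne_of_mem₀₁ hx' (mem_twistDarts_one.2 ((sameVertex_congr hσ).2 hx)) rfl
  have hB : ∀ x, E.SameVertex B' x → x ∉ W := fun x hx hx' =>
    t1.rot.ne_of_mem₀₁ (mem_twistDarts_one.2 ((sameVertex_congr hσ).2 hx)) hx' rfl
  have hWV : W ⊆ V := t1.rot.rot.sub₀
  have hw : ∀ {x}, x ∉ V → x ∉ W := fun hx hx' => hx (hWV hx')
  have hrow : Row E1 W C' (c + 1) sA nB (E.σ (E.σ (E.σ A'))) (E.σ (E.σ B')) := by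
    refine ⟨t1.rot.rot.twist₀, rfl, t1.nw₂, t1.sw₂, ?_, ?_, hw h.s₀_mem, hw h.n₁_mem,
      hA _ (by simp [SameVertex.refl]), hB _ (by simp [SameVertex.refl])⟩
    · rw [t1.rot.rot.α_se₀, ne_one, hσ]
    · rw [t1.rot.rot.α_ne₀, se_one, hσ]
  -- The row must be maximal before it is turned: on the left this is `hn`, on the right its legs
  -- end at the different crossings `A'` and `B'`.
  obtain ⟨E2, C2, g2, r2⟩ := hrow.exists_turn (by rwa [sameVertex_congr hσ]) (by
    rw [sameVertex_congr hσ]; simpa using hAB)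
  have l1 := t1.nw₀
  have l2 := t1.sw₀
  have l3 := t1.nw₁
  have l4 := t1.sw₁
  have l5 := t1.α_se₀
  rw [se_one, ne_one] at l5
  rw [hσ] at l2 l4 l5
  have fr : ∀ {x y}, E1.α x = y → x ∉ W → y ∉ W → E2.α x = y := by
    rintro x y rfl hx hy
    exact g2.frame x hx hy
  refine ⟨E2, A', B', C2, W, g1.trans (g2.mono hWV), ?_, hAB, hA, hB, r2,
    fr l1 (hA _ (SameVertex.refl _)) (hw h.s₁_mem),
    fr l2 (hA _ (by simp [SameVertex.refl])) (hw h.n₂_mem),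
    fr l3 (hB _ (SameVertex.refl _)) (hw h.s₂_mem),
    fr l4 (hB _ (by simp [SameVertex.refl])) (hw h.n₀_mem),
    fr l5 (hA _ (by simp [SameVertex.refl])) (hB _ (by simp [SameVertex.refl]))⟩
  rw [t1.V_eq, twistDarts_one, twistDarts_one]
  simp only [sameVertex_congr hσ]
  ext x; simp only [Set.mem_union]; tauto

/-- One crossing of the twist `B` is brought to the other side of `A` and `C`. -/
theorem step {A B C nA sA nB sB nC sC : X} {c m : ℕ}
    (h : Tri E V A 1 B (m + 2) C c nA sA nB sB nC sC) :
    ∃ (E' : Diagram X) (S C' P : X) (W : Set X), Good V E E' ∧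
      Tri E' W S 1 C' c B (m + 1) nC (E.σ (E.σ (E.σ P))) (E.σ (E.σ P)) sA nB sB ∧
      V = W ∪ {x | E.SameVertex P x} ∧ P ∉ W ∧ E'.α P = sC ∧ E'.α (E.σ P) = nA := by
  obtain ⟨V3, h3, hV, hno⟩ := h.rot.rot.split
  set Z := E.rowDart B (m + 1)
  set W := E.rowDart B m
  have hV3V : V3 ⊆ V := by rw [hV]; exact Set.subset_union_left
  have hBB : E.twistDarts B (m + 1) ⊆ V := by rw [hV]; exact Set.subset_union_right
  have h3' := h3.rot
  have hW : W ∈ E.twistDarts B (m + 1) := E.rowDart_mem (by omega)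
  obtain ⟨E2, A', B', C', U, g2, hU, hAB, hA, hB, r2, a1, a2, b1, b2, ab⟩ :=
    -- One of the two legs at the outer end of `C` after the passage ends outside `V`, the other at
    -- the crossing `W` of the rest of `B`.
    h3'.pass_turn h.rot.rot.twist₀.pos (by
      refine fun h0 => notMem_of_sameVertex (E := E) (V := V) h.closed h.s₀_mem h0 ?_
      exact hBB (by simpa using hW))
  have hσ := g2.σ_eq
  have hUV3 : U ⊆ V3 := by rw [hU]; exact fun x hx => Or.inl (Or.inl hx)
  have hAV3 : ∀ {x}, E.SameVertex A' x → x ∈ V3 := fun hx => by rw [hU]; exact Or.inl (Or.inr hx)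
  have hBV3 : ∀ {x}, E.SameVertex B' x → x ∈ V3 := fun hx => by rw [hU]; exact Or.inr hx
  obtain ⟨w1, w2, w3, w4⟩ := g2.twist
      (h.rot.twist₀.prefix (j := m + 1) (by omega) (by omega)) hno
  have hBm : B ∈ E.twistDarts B (m + 1) := E.start_mem (by omega)
  -- The smaller triangle consists of `A'`, which plays the part of `S`, of the turned twist and of
  -- the rest of `B`. The crossing `B'` is deposited outside as `P`.
  let V2 := {x | E.SameVertex A' x} ∪ U ∪ E.twistDarts B (m + 1)
  have hVV2 : V = V2 ∪ {x | E.SameVertex B' x} := by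
    rw [hV, hU]; ext x; simp only [V2, Set.mem_union]; tauto
  have hV2V : V2 ⊆ V := by rw [hVV2]; exact Set.subset_union_left
  have hB2 : ∀ {x}, E.SameVertex B' x → x ∉ V2 := by
    rintro x hx ((hx' | hx') | hx')
    · exact hAB (SameVertex.trans hx' (SameVertex.symm hx))
    · exact hB x hx hx'
    · exact hno x hx' (hBV3 hx)
  have e1 : E2.twistDarts (E.σ A') 1 = {x | E.SameVertex A' x} := by
    ext x; rw [mem_twistDarts_one, sameVertex_congr hσ]; simp
  refine ⟨E2, E.σ A', C', B', V2, g2.mono hV3V, ?_, hVV2, hB2 (SameVertex.refl _), b1, b2⟩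
  have hu := r2.V_eq
  refine ⟨⟨E2.isTwist_one _, r2.twist, w1, ?_, ?_, ?_, ?_, ?_, ?_⟩, ?_, a2, ?_, r2.nw, r2.sw,
    ?_, ?_, fun h' => h.n₂_mem (hV2V h'), hB2 (by simp [SameVertex.refl]),
    hB2 (by simp [SameVertex.refl]), fun h' => h.s₀_mem (hV2V h'), fun h' => h.n₁_mem (hV2V h'),
    fun h' => h.s₁_mem (hV2V h')⟩
  · rw [e1, ← hu]; exact Set.disjoint_left.2 hA
  · rw [← hu, w3]; exact Set.disjoint_left.2 fun x hx hx' => hno x hx' (hUV3 hx)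
  · rw [e1, w3]; exact Set.disjoint_left.2 fun x hx hx' => hno x hx (hAV3 hx')
  · rw [se_one, hσ, E2.α_eq_iff, r2.ne]
  · rw [r2.se, ne_eq_σ_se, w4, hσ]; rfl
  · rw [w4, ne_one, hσ, E.σ_four]
    change E2.α (E.σ (E.σ W)) = A'
    rw [E2.α_eq_iff, a1]
  · rw [e1, ← hu, w3]
  · rw [hσ, ab]
  · rw [g2.frame _ (hno _ hBm), h.nw₁]
    rw [h.nw₁]; exact fun h' => h.n₁_mem (hV3V h')
  · rw [hσ, g2.frame _ (hno _ (by simpa using hBm)), h.sw₁]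
    rw [h.sw₁]; exact fun h' => h.s₁_mem (hV3V h')

/-- The mirror image of `Tri.step`. -/
theorem step' {A B C nA sA nB sB nC sC : X} {c m : ℕ}
    (h : Tri E V A 1 C c B (m + 2) nA sA nC sC nB sB) :
    ∃ (E' : Diagram X) (S C' P : X) (W : Set X), Good V E E' ∧
      Tri E' W S 1 B (m + 1) C' c (E.σ (E.σ P)) sC nB sB nA (E.σ (E.σ (E.σ P))) ∧
      V = W ∪ {x | E.SameVertex P x} ∧ P ∉ W ∧ E'.α P = sA ∧ E'.α (E.σ P) = nC := by
  obtain ⟨V3, h3, hV, hno⟩ := h.split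
  set Z := E.rowDart B (m + 1)
  set W := E.rowDart B m
  have hV3V : V3 ⊆ V := by rw [hV]; exact Set.subset_union_left
  have hBB : E.twistDarts B (m + 1) ⊆ V := by rw [hV]; exact Set.subset_union_right
  have h3' := h3.rot.rot
  have hW : W ∈ E.twistDarts B (m + 1) := E.rowDart_mem (by omega)
  obtain ⟨E2, A', B', C', U, g2, hU, hAB, hA, hB, r2, a1, a2, b1, b2, ab⟩ :=
    h3'.pass_turn h.rot.twist₀.pos (by
      refine fun h0 => notMem_of_sameVertex (E := E) (V := V) h.closed h.n₀_mem
        (SameVertex.symm h0) ?_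
      exact hBB (by simpa using hW))
  have hσ := g2.σ_eq
  have hUV3 : U ⊆ V3 := by rw [hU]; exact fun x hx => Or.inl (Or.inl hx)
  have hAV3 : ∀ {x}, E.SameVertex A' x → x ∈ V3 := fun hx => by rw [hU]; exact Or.inl (Or.inr hx)
  have hBV3 : ∀ {x}, E.SameVertex B' x → x ∈ V3 := fun hx => by rw [hU]; exact Or.inr hx
  obtain ⟨w1, w2, w3, w4⟩ := g2.twist
      (h.rot.rot.twist₀.prefix (j := m + 1) (by omega) (by omega)) hno
  have hBm : B ∈ E.twistDarts B (m + 1) := E.start_mem (by omega)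
  -- In the mirror image `B'` stays in the triangle and `A'` is deposited as `P`; the turned twist
  -- is read from its other end.
  let V2 := {x | E.SameVertex B' x} ∪ E.twistDarts B (m + 1) ∪ U
  have hVV2 : V = V2 ∪ {x | E.SameVertex A' x} := by
    rw [hV, hU]; ext x; simp only [V2, Set.mem_union]; tauto
  have hV2V : V2 ⊆ V := by rw [hVV2]; exact Set.subset_union_left
  have hA2 : ∀ {x}, E.SameVertex A' x → x ∉ V2 := by
    rintro x hx ((hx' | hx') | hx')
    · exact hAB (SameVertex.trans hx (SameVertex.symm hx'))
    · exact hno x hx' (hAV3 hx)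
    · exact hA x hx hx'
  have e1 : E2.twistDarts (E.σ (E.σ (E.σ B'))) 1 = {x | E.SameVertex B' x} := by
    ext x; rw [mem_twistDarts_one, sameVertex_congr hσ]; simp
  refine ⟨E2, E.σ (E.σ (E.σ B')), E2.se C' c, A', V2, g2.mono hV3V, ?_, hVV2,
    hA2 (SameVertex.refl _), a1, a2⟩
  have r3 := r2.reverse
  have hu := r3.V_eq
  refine ⟨⟨E2.isTwist_one _, w1, r3.twist, ?_, ?_, ?_, ?_, ?_, ?_⟩, ?_, ?_, ?_, ?_, ?_, r3.nw,
    r3.sw, hA2 (by simp [SameVertex.refl]), fun h' => h.s₁_mem (hV2V h'),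
    fun h' => h.n₂_mem (hV2V h'), fun h' => h.s₂_mem (hV2V h'), fun h' => h.n₀_mem (hV2V h'),
    hA2 (by simp [SameVertex.refl])⟩
  · rw [e1, w3]; exact Set.disjoint_left.2 fun x hx hx' => hno x hx' (hBV3 hx)
  · rw [← hu, w3]; exact Set.disjoint_left.2 fun x hx hx' => hno x hx (hUV3 hx')
  · rw [e1, ← hu]; exact Set.disjoint_left.2 fun x hx hx' => hB x hx' hx
  · rw [se_one, hσ, E.σ_four, b2, ne_eq_σ_se, w4, hσ]; rfl
  · rw [w4, ← E2.α_eq_iff.2 r3.ne.symm]; rfl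
  · rw [r3.se, ne_one, hσ, E.σ_four]
  · rw [e1, ← hu, w3]
  · rw [E2.α_eq_iff, ab]
  · rw [hσ, E.σ_four, b1]
  · rw [g2.frame _ (hno _ hBm), h.nw₂]
    rw [h.nw₂]; exact fun h' => h.n₂_mem (hV3V h')
  · rw [hσ, g2.frame _ (hno _ (by simpa using hBm)), h.sw₂]
    rw [h.sw₂]; exact fun h' => h.s₂_mem (hV3V h')

/-- The two cyclic orders are proved together, because removing one crossing of `B` leads from
either order to the other. In both cases the induction leaves the transported rest of `B` facing the
deposited crossing `P`, which then prolongs it. -/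
theorem transform {c : ℕ} (b : ℕ) : ∀ (E : Diagram X) (V : Set X) (A B C nA sA nB sB nC sC : X),
    (Tri E V A 1 B (b + 1) C c nA sA nB sB nC sC →
      ∃ (E' : Diagram X) (A' B' C' : X), Good V E E' ∧
      (Odd (b + 1) → Tri E' V A' 1 B' (b + 1) C' c sB nC sC nA sA nB) ∧
      (Even (b + 1) → Tri E' V A' 1 C' c B' (b + 1) sA nB sB nC sC nA)) ∧
    (Tri E V A 1 C c B (b + 1) nA sA nC sC nB sB →
      ∃ (E' : Diagram X) (A' B' C' : X), Good V E E' ∧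
      (Odd (b + 1) → Tri E' V A' 1 C' c B' (b + 1) sC nB sB nA sA nC) ∧
      (Even (b + 1) → Tri E' V A' 1 B' (b + 1) C' c sB nA sA nC sC nB)) := by
  induction b with
  | zero =>
    intro E V A B C nA sA nB sB nC sC
    have hodd : ¬ Even (0 + 1) := by decide
    refine ⟨fun h => ?_, fun h => ?_⟩
    · obtain ⟨c', rfl⟩ := Nat.exists_eq_add_of_le' h.rot.rot.twist₀.pos
      obtain ⟨E', A', B', C', g, t⟩ := h.pass
      exact ⟨E', A', B', C', g, fun _ => t, fun h' => absurd h' hodd⟩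
    · obtain ⟨c', rfl⟩ := Nat.exists_eq_add_of_le' h.rot.twist₀.pos
      obtain ⟨E', A', B', C', g, t⟩ := h.rot.rot.pass
      -- The triangle was read as `B`, `A`, `C`, so the two single crossings come out with exchanged
      -- names.
      exact ⟨E', B', A', C', g, fun _ => t.rot, fun h' => absurd h' hodd⟩
  | succ m ih =>
    intro E V A B C nA sA nB sB nC sC
    refine ⟨fun h => ?_, fun h => ?_⟩
    · obtain ⟨E2, S, C', P, W, g, t, hV, hP, p1, p2⟩ := h.step
      obtain ⟨E3, A3, B3, C3, g3, k1, k2⟩ := (ih _ _ _ _ _ _ _ _ _ _ _).2 t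
      have hWV : W ⊆ V := by rw [hV]; exact Set.subset_union_left
      have hσ : E3.σ = E.σ := g3.σ_eq.trans g.σ_eq
      have hV' : V = W ∪ {x | E3.SameVertex P x} := by rw [hV]; simp only [sameVertex_congr hσ]
      have hP' : E.σ P ∉ W :=
        notMem_of_sameVertex t.closed hP (by rw [sameVertex_congr g.σ_eq]; simp [SameVertex.refl])
      have p1' : E3.α P = sC := by
        rw [g3.frame _ hP, p1]
        rw [p1]; exact fun h' => h.s₂_mem (hWV h')
      have p2' : E3.α (E3.σ P) = nA := by
        rw [hσ, g3.frame _ hP', p2]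
        rw [p2]; exact fun h' => h.n₀_mem (hWV h')
      rw [← hσ] at k1 k2
      refine ⟨E3, A3, P, C3, (g.mono le_rfl).trans (g3.mono hWV), fun ho => ?_, fun he => ?_⟩
      -- The smaller twist has the other parity, so the odd clause comes from the even clause of the
      -- mirrored statement; below it is the other way round.
      · have := k2 (by rw [Nat.odd_add_one, Nat.not_odd_iff_even] at ho; exact ho)
        exact (this.rot.rot.cons hV' hP p1' p2' h.s₀_mem h.n₁_mem h.s₁_mem h.n₂_mem h.s₂_mem
          h.n₀_mem).rot
      · have := k1 (by rw [Nat.even_add_one, Nat.not_even_iff_odd] at he; exact he)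
        exact this.cons hV' hP p1' p2' h.s₀_mem h.n₁_mem h.s₁_mem h.n₂_mem h.s₂_mem h.n₀_mem
    · obtain ⟨E2, S, C', P, W, g, t, hV, hP, p1, p2⟩ := h.step'
      obtain ⟨E3, A3, B3, C3, g3, k1, k2⟩ := (ih _ _ _ _ _ _ _ _ _ _ _).1 t
      have hWV : W ⊆ V := by rw [hV]; exact Set.subset_union_left
      have hσ : E3.σ = E.σ := g3.σ_eq.trans g.σ_eq
      have hV' : V = W ∪ {x | E3.SameVertex P x} := by rw [hV]; simp only [sameVertex_congr hσ]
      have hP' : E.σ P ∉ W :=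
        notMem_of_sameVertex t.closed hP (by rw [sameVertex_congr g.σ_eq]; simp [SameVertex.refl])
      have p1' : E3.α P = sA := by
        rw [g3.frame _ hP, p1]
        rw [p1]; exact fun h' => h.s₀_mem (hWV h')
      have p2' : E3.α (E3.σ P) = nC := by
        rw [hσ, g3.frame _ hP', p2]
        rw [p2]; exact fun h' => h.n₁_mem (hWV h')
      rw [← hσ] at k1 k2
      refine ⟨E3, A3, P, C3, (g.mono le_rfl).trans (g3.mono hWV), fun ho => ?_, fun he => ?_⟩
      · have := k2 (by rw [Nat.odd_add_one, Nat.not_odd_iff_even] at ho; exact ho)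
        exact this.cons hV' hP p1' p2' h.s₁_mem h.n₂_mem h.s₂_mem h.n₀_mem h.s₀_mem h.n₁_mem
      · have := k1 (by rw [Nat.even_add_one, Nat.not_even_iff_odd] at he; exact he)
        exact (this.rot.rot.cons hV' hP p1' p2' h.s₁_mem h.n₂_mem h.s₂_mem h.n₀_mem
          h.s₀_mem h.n₁_mem).rot

end Tri

end Diagram

namespace Diagram

variable {X : Type*} {E E' : Diagram X} {V : Set X}

/-! ### Renaming darts -/

section Relabel

variable (e : Perm X)

theorem relabel_σ (x : X) : (E.relabel e).σ (e x) = e (E.σ x) := by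
  change (e * E.σ * e⁻¹) (e x) = _
  simp [Perm.mul_apply]

theorem relabel_α (x : X) : (E.relabel e).α (e x) = e (E.α x) := by
  change (e * E.α * e⁻¹) (e x) = _
  simp [Perm.mul_apply]

theorem relabel_φ : (E.relabel e).φ = e * E.φ * e⁻¹ := by
  change (e * E.σ * e⁻¹)⁻¹ * (e * E.α * e⁻¹) = e * (E.σ⁻¹ * E.α) * e⁻¹
  group

theorem relabel_isOver (x : X) : (E.relabel e).isOver (e x) = E.isOver x := by
  change E.isOver (e⁻¹ (e x)) = _
  simp

theorem relabel_sameVertex {x y : X} :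
    (E.relabel e).SameVertex (e x) (e y) ↔ E.SameVertex x y := by
  change (e * E.σ * e⁻¹).SameCycle _ _ ↔ E.σ.SameCycle _ _
  rw [Perm.sameCycle_conj]
  simp

theorem relabel_rowDart (l : X) (i : ℕ) :
    (E.relabel e).rowDart (e l) i = e (E.rowDart l i) := by
  induction i with
  | zero => rfl
  | succ i ih => simp only [rowDart_succ, ih, relabel_σ, relabel_α]

theorem relabel_twistDarts {l x : X} {k : ℕ} :
    e x ∈ (E.relabel e).twistDarts (e l) k ↔ x ∈ E.twistDarts l k := by
  simp only [mem_twistDarts, relabel_rowDart, relabel_sameVertex]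

theorem relabel_se (l : X) (k : ℕ) : (E.relabel e).se (e l) k = e (E.se l k) := by
  simp only [se, relabel_rowDart, relabel_σ]

theorem relabel_ne (l : X) (k : ℕ) : (E.relabel e).ne (e l) k = e (E.ne l k) := by
  simp only [ne, relabel_rowDart, relabel_σ]

variable {e}

theorem IsTwist.relabel {l : X} {k : ℕ} (h : E.IsTwist l k) : (E.relabel e).IsTwist (e l) k := by
  refine (isTwist_iff _ _ _).2 ⟨h.pos, fun i hi => ?_, fun i j hi hj hs => ?_⟩
  · simp only [relabel_rowDart, relabel_σ, relabel_α, h.α_se hi]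
  · rw [relabel_rowDart, relabel_rowDart, relabel_sameVertex] at hs
    exact h.inj hi hj hs

theorem relabel_disjoint {l l' : X} {k k' : ℕ}
    (h : Disjoint (E.twistDarts l k) (E.twistDarts l' k')) :
    Disjoint ((E.relabel e).twistDarts (e l) k) ((E.relabel e).twistDarts (e l') k') := by
  refine Set.disjoint_left.2 fun x hx hx' => ?_
  obtain ⟨y, rfl⟩ := e.surjective x
  rw [relabel_twistDarts] at hx hx'
  exact Set.disjoint_left.1 h hx hx'

theorem Tri.relabel {l₀ l₁ l₂ : X} {k₀ k₁ k₂ : ℕ} {n₀ s₀ n₁ s₁ n₂ s₂ : X}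
    (h : Tri E V l₀ k₀ l₁ k₁ l₂ k₂ n₀ s₀ n₁ s₁ n₂ s₂) (he : ∀ x, x ∉ V → e x = x) :
    Tri (E.relabel e) V (e l₀) k₀ (e l₁) k₁ (e l₂) k₂ n₀ s₀ n₁ s₁ n₂ s₂ := by
  have hm : ∀ x, e x ∈ V ↔ x ∈ V := by
    intro x
    constructor
    · intro hx
      by_contra hx'
      exact hx' (by rwa [he x hx'] at hx)
    · intro hx
      by_contra hx'
      have := e.injective (he _ hx')
      exact hx' (by rwa [this])
  refine ⟨⟨h.twist₀.relabel, h.rot.twist₀.relabel, h.rot.rot.twist₀.relabel,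
    relabel_disjoint h.disj₀₁, relabel_disjoint h.rot.disj₀₁, relabel_disjoint h.rot.rot.disj₀₁,
    ?_, ?_, ?_⟩, ?_, ?_, ?_, ?_, ?_, ?_, ?_, h.n₀_mem, h.s₀_mem, h.n₁_mem, h.s₁_mem, h.n₂_mem,
    h.s₂_mem⟩
  · rw [relabel_se, relabel_ne, relabel_α, h.α_se₀]
  · rw [relabel_se, relabel_ne, relabel_α, h.rot.α_se₀]
  · rw [relabel_se, relabel_ne, relabel_α, h.rot.rot.α_se₀]
  · ext x
    obtain ⟨y, rfl⟩ := e.surjective x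
    simp only [Set.mem_union, relabel_twistDarts]
    rw [hm, h.V_eq]; rfl
  · rw [relabel_α, h.nw₀, he _ h.n₀_mem]
  · rw [relabel_σ, relabel_α, h.sw₀, he _ h.s₀_mem]
  · rw [relabel_α, h.nw₁, he _ h.n₁_mem]
  · rw [relabel_σ, relabel_α, h.sw₁, he _ h.s₁_mem]
  · rw [relabel_α, h.nw₂, he _ h.n₂_mem]
  · rw [relabel_σ, relabel_α, h.sw₂, he _ h.s₂_mem]

theorem IsReducedAlternatingPrime.relabel (h : E.IsReducedAlternatingPrime) :
    (E.relabel e).IsReducedAlternatingPrime := by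
  refine ⟨h.nonempty, ?_, ?_, fun x => ?_, fun x => ?_⟩
  · rw [CMap.EulerSphere, relabel_φ]
    change Nat.card (Quotient (Perm.SameCycle.setoid (e * E.σ * e⁻¹))) + _ =
      Nat.card (Quotient (Perm.SameCycle.setoid (e * E.α * e⁻¹))) + 2
    rw [Perm.card_cycles_conj, Perm.card_cycles_conj, Perm.card_cycles_conj]
    exact h.sphere
  · refine CMap.threeEdgeConnected_of_colour fun c a b hσ hα x y => ?_
    obtain ⟨a, rfl⟩ := e.surjective a
    obtain ⟨b, rfl⟩ := e.surjective b
    obtain ⟨x, rfl⟩ := e.surjective x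
    obtain ⟨y, rfl⟩ := e.surjective y
    refine h.prime.colour_eq (c := fun z => c (e z)) a b (fun z => ?_) (fun z h1 h2 h3 h4 => ?_) x y
    · rw [← relabel_σ, hσ]
    · by_contra hc
      have := hα (e z) (by rwa [relabel_α])
      simp only [relabel_α, e.apply_eq_iff_eq] at this
      tauto
  · obtain ⟨y, rfl⟩ := e.surjective x
    rw [relabel_α, relabel_isOver, relabel_isOver, h.alternating]
  · obtain ⟨y, rfl⟩ := e.surjective x
    rw [relabel_σ, relabel_σ, relabel_φ, Perm.sameCycle_conj]
    simpa using h.reduced y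

end Relabel

/-- `σ` acts freely with orbits of length four, so the darts at a family of different crossings are
parametrised by the crossing and a residue modulo 4. -/
theorem pow_rot_injective {J : Type*} {r : J → X}
    (hr : ∀ i j, E.SameVertex (r i) (r j) → i = j) :
    Function.Injective (fun p : J × Fin 4 => (E.σ ^ (p.2 : ℕ)) (r p.1)) := by
  have sv : ∀ (n : ℕ) (x : X), E.SameVertex x ((E.σ ^ n) x) := fun n x => ⟨n, by simp⟩
  have free : ∀ (x : X) (m : ℕ), 0 < m → m < 4 → (E.σ ^ m) x ≠ x := by
    intro x m h0 h4
    interval_cases m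
    · simp
    · simp [pow_succ]
    · simp [pow_succ]
  have key : ∀ (x : X) (m n : ℕ), m ≤ n → n < 4 → (E.σ ^ m) x = (E.σ ^ n) x → m = n := by
    intro x m n hmn hn he
    by_contra hne
    obtain ⟨d, rfl⟩ := Nat.exists_eq_add_of_le hmn
    rw [pow_add, Perm.mul_apply] at he
    exact free x d (by omega) (by omega) ((E.σ ^ m).injective he).symm
  rintro ⟨i, m⟩ ⟨j, n⟩ h
  dsimp only at h
  obtain rfl : i = j := hr i j (SameVertex.trans (sv m _)
    (by rw [h]; exact SameVertex.symm (sv n _)))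
  rcases le_total (m : ℕ) n with hmn | hmn
  · rw [Prod.mk.injEq]
    exact ⟨rfl, Fin.ext (key _ _ _ hmn n.2 h)⟩
  · rw [Prod.mk.injEq]
    exact ⟨rfl, Fin.ext (key _ _ _ hmn m.2 h.symm).symm⟩

theorem mem_range_pow_rot {J : Type*} {r : J → X} (hV : ∀ x, x ∈ V ↔ ∃ j, E.SameVertex (r j) x) :
    Set.range (fun p : J × Fin 4 => (E.σ ^ (p.2 : ℕ)) (r p.1)) = V := by
  ext x
  rw [hV]
  constructor
  · rintro ⟨⟨j, m⟩, rfl⟩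
    exact ⟨j, ⟨m, by simp⟩⟩
  · rintro ⟨j, hj⟩
    rcases (E.sameVertex_iff _ _).1 hj with rfl | rfl | rfl | rfl
    · exact ⟨(j, 0), by simp⟩
    · exact ⟨(j, 1), by simp⟩
    · exact ⟨(j, 2), by simp [pow_succ]⟩
    · exact ⟨(j, 3), by simp [pow_succ]⟩

/-- The crossings of a tangle can be permuted arbitrarily by a renaming of their darts. -/
theorem exists_relabel {J : Type*} {r r' : J → X}
    (hr : ∀ i j, E.SameVertex (r i) (r j) → i = j) (hr' : ∀ i j, E.SameVertex (r' i) (r' j) → i = j)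
    (hV : ∀ x, x ∈ V ↔ ∃ j, E.SameVertex (r j) x)
    (hV' : ∀ x, x ∈ V ↔ ∃ j, E.SameVertex (r' j) x) :
    ∃ e : Perm X, (∀ x, e (E.σ x) = E.σ (e x)) ∧ (∀ j, e (r' j) = r j) ∧ ∀ x, x ∉ V → e x = x := by
  classical
  let f := fun p : J × Fin 4 => (E.σ ^ (p.2 : ℕ)) (r p.1)
  let f' := fun p : J × Fin 4 => (E.σ ^ (p.2 : ℕ)) (r' p.1)
  let g : J × Fin 4 ≃ {x // x ∈ V} :=
    (Equiv.ofInjective f (pow_rot_injective hr)).trans (Equiv.setCongr (mem_range_pow_rot hV))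
  let g' : J × Fin 4 ≃ {x // x ∈ V} :=
    (Equiv.ofInjective f' (pow_rot_injective hr')).trans (Equiv.setCongr (mem_range_pow_rot hV'))
  let e : Perm X := Perm.ofSubtype (g'.symm.trans g)
  have he : ∀ p, e (f' p) = f p := by
    intro p
    have h1 : f' p = (g' p : X) := rfl
    rw [h1, Perm.ofSubtype_apply_coe]
    simp [g, f]
  have hout : ∀ x, x ∉ V → e x = x := fun x hx => Perm.ofSubtype_apply_of_not_mem _ hx
  have hVσ : ∀ x, E.σ x ∈ V ↔ x ∈ V := by
    intro x; rw [hV, hV]; simp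
  have key : ∀ (j : J) (m : ℕ), e ((E.σ ^ m) (r' j)) = (E.σ ^ m) (r j) := by
    have h4 : ∀ (m : ℕ) (y : X), (E.σ ^ m) y = (E.σ ^ (m % 4)) y := by
      intro m y
      have : E.σ ^ 4 = 1 := by ext z; simp [pow_succ]
      conv_lhs => rw [← Nat.mod_add_div m 4, pow_add, pow_mul, this, one_pow, mul_one]
    intro j m
    rw [h4 m, h4 m]
    exact he (j, ⟨m % 4, Nat.mod_lt _ (by norm_num)⟩)
  refine ⟨e, fun x => ?_, fun j => key j 0, hout⟩
  by_cases hx : x ∈ V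
  · rw [← mem_range_pow_rot hV'] at hx
    obtain ⟨⟨j, m⟩, rfl⟩ := hx
    dsimp only
    have := key j (m + 1)
    rw [pow_succ', Perm.mul_apply, Perm.mul_apply] at this
    rw [this, key]
  · rw [hout x hx, hout _ (by rwa [hVσ])]

theorem relabel_σ_eq {e : Perm X} (he : ∀ x, e (E.σ x) = E.σ (e x)) : (E.relabel e).σ = E.σ := by
  ext x
  obtain ⟨y, rfl⟩ := e.surjective x
  rw [relabel_σ, he]

/-- The crossings of three disjoint twists. -/
def tripleDart (E : Diagram X) (l₀ : X) (k₀ : ℕ) (l₁ : X) (k₁ : ℕ) (l₂ : X) (k₂ : ℕ) :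
    Fin k₀ ⊕ Fin k₁ ⊕ Fin k₂ → X :=
  Sum.elim (fun i => E.rowDart l₀ i) (Sum.elim (fun i => E.rowDart l₁ i) fun i => E.rowDart l₂ i)

theorem tripleDart_inj {l₀ l₁ l₂ : X} {k₀ k₁ k₂ : ℕ} (h0 : E.IsTwist l₀ k₀) (h1 : E.IsTwist l₁ k₁)
    (h2 : E.IsTwist l₂ k₂) (h01 : Disjoint (E.twistDarts l₀ k₀) (E.twistDarts l₁ k₁))
    (h12 : Disjoint (E.twistDarts l₁ k₁) (E.twistDarts l₂ k₂))
    (h20 : Disjoint (E.twistDarts l₂ k₂) (E.twistDarts l₀ k₀)) (i j : Fin k₀ ⊕ Fin k₁ ⊕ Fin k₂)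
    (hij : E.SameVertex (E.tripleDart l₀ k₀ l₁ k₁ l₂ k₂ i) (E.tripleDart l₀ k₀ l₁ k₁ l₂ k₂ j)) :
    i = j := by
  have key : ∀ {l l' : X} {k k' : ℕ}, Disjoint (E.twistDarts l k) (E.twistDarts l' k') →
      ∀ (i : Fin k) (j : Fin k'), ¬ E.SameVertex (E.rowDart l i) (E.rowDart l' j) :=
    fun hd i j hs => Set.disjoint_left.1 hd ⟨i, i.2, hs⟩ (E.rowDart_mem j.2)
  rcases i with i | i | i <;> rcases j with j | j | j <;>
    simp only [tripleDart, Sum.elim_inl, Sum.elim_inr] at hij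
  · rw [Fin.ext (h0.inj i.2 j.2 hij)]
  · exact (key h01 _ _ hij).elim
  · exact (key h20.symm _ _ hij).elim
  · exact (key h01.symm _ _ hij).elim
  · rw [Fin.ext (h1.inj i.2 j.2 hij)]
  · exact (key h12 _ _ hij).elim
  · exact (key h20 _ _ hij).elim
  · exact (key h12.symm _ _ hij).elim
  · rw [Fin.ext (h2.inj i.2 j.2 hij)]

theorem mem_tripleDart {l₀ l₁ l₂ : X} {k₀ k₁ k₂ : ℕ} (x : X) :
    (∃ j, E.SameVertex (E.tripleDart l₀ k₀ l₁ k₁ l₂ k₂ j) x) ↔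
      x ∈ E.twistDarts l₀ k₀ ∪ E.twistDarts l₁ k₁ ∪ E.twistDarts l₂ k₂ := by
  simp only [Sum.exists, tripleDart, Sum.elim_inl, Sum.elim_inr, Set.mem_union, mem_twistDarts,
    Fin.exists_iff, exists_prop, or_assoc]

/-- The result of the transformation, with the original names of the crossings. -/
theorem Tri.exists_transformed [DecidableEq X] [Fintype X] {A B C nA sA nB sB nC sC : X} {b c : ℕ}
    (h : Tri E V A 1 B b C c nA sA nB sB nC sC) :
    ∃ E' : Diagram X, E.Transforms V E' ∧
      (E.IsReducedAlternatingPrime → E'.IsReducedAlternatingPrime) ∧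
      E'.σ = E.σ ∧ (∀ x, x ∉ V → E'.isOver x = E.isOver x) ∧
      (∀ x, x ∉ V → E.α x ∉ V → E'.α x = E.α x) ∧
      (∀ i < b, E'.rowDart B i = E.rowDart B i) ∧ (∀ i < c, E'.rowDart C i = E.rowDart C i) ∧
      (Odd b → Tri E' V A 1 B b C c sB nC sC nA sA nB) ∧
      (Even b → Tri E' V A 1 C c B b sA nB sB nC sC nA) := by
  obtain ⟨b, rfl⟩ := Nat.exists_eq_add_of_le' h.rot.twist₀.pos
  obtain ⟨E1, A', B', C', g, t1, t2⟩ := (transform b E V A B C nA sA nB sB nC sC).1 h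
  have hσ := g.σ_eq
  have hr' : ∀ i j, E1.SameVertex (E1.tripleDart A' 1 B' (b + 1) C' c i)
      (E1.tripleDart A' 1 B' (b + 1) C' c j) → i = j := by
    rcases Nat.even_or_odd (b + 1) with hb | hb
    · have t := t2 hb
      exact tripleDart_inj t.twist₀ t.rot.rot.twist₀ t.rot.twist₀ t.rot.rot.disj₀₁.symm
        t.rot.disj₀₁.symm t.disj₀₁.symm
    · have t := t1 hb
      exact tripleDart_inj t.twist₀ t.rot.twist₀ t.rot.rot.twist₀ t.disj₀₁ t.rot.disj₀₁
        t.rot.rot.disj₀₁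
  have hV' : ∀ x, x ∈ V ↔ ∃ j, E1.SameVertex (E1.tripleDart A' 1 B' (b + 1) C' c j) x := by
    intro x
    rw [mem_tripleDart]
    rcases Nat.even_or_odd (b + 1) with hb | hb
    · rw [(t2 hb).V_eq]; simp only [Set.mem_union]; tauto
    · rw [(t1 hb).V_eq]
  have hr : ∀ i j, E1.SameVertex (E.tripleDart A 1 B (b + 1) C c i)
      (E.tripleDart A 1 B (b + 1) C c j) → i = j := by
    intro i j hij
    rw [sameVertex_congr hσ] at hij
    exact tripleDart_inj h.twist₀ h.rot.twist₀ h.rot.rot.twist₀ h.disj₀₁ h.rot.disj₀₁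
        h.rot.rot.disj₀₁ i j hij
  have hV : ∀ x, x ∈ V ↔ ∃ j, E1.SameVertex (E.tripleDart A 1 B (b + 1) C c j) x := by
    intro x
    simp only [sameVertex_congr hσ, mem_tripleDart]
    rw [h.V_eq]
  -- The renaming carries the crossing number `i` of each new twist to the crossing number `i` of
  -- the old one. It commutes with `σ`, so the relabelled diagram has the original `σ`.
  obtain ⟨e, e1, e2, e3⟩ := exists_relabel hr hr' hV hV'
  have eA : e A' = A := e2 (Sum.inl 0)
  have eB' : ∀ i < b + 1, e (E1.rowDart B' i) = E.rowDart B i :=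
    fun i hi => e2 (Sum.inr (Sum.inl ⟨i, hi⟩))
  have eC' : ∀ i < c, e (E1.rowDart C' i) = E.rowDart C i :=
    fun i hi => e2 (Sum.inr (Sum.inr ⟨i, hi⟩))
  have eB : e B' = B := eB' 0 (by omega)
  have eC : e C' = C := eC' 0 h.rot.rot.twist₀.pos
  have hover : ∀ x, x ∉ V → (E1.relabel e).isOver x = E.isOver x := by
    intro x hx
    conv_lhs => rw [← e3 x hx]
    rw [relabel_isOver, g.isOver_eq x hx]
  refine ⟨E1.relabel e, g.transforms.tail (Move.isotopy E1 e e3), fun hE => (g.prime hE).relabel,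
    (relabel_σ_eq e1).trans hσ, hover, fun x hx hx' => ?_, fun i hi => ?_, fun i hi => ?_,
    fun ho => ?_, fun he => ?_⟩
  · conv_lhs => rw [← e3 x hx]
    rw [relabel_α, g.frame x hx hx', e3 _ hx']
  · conv_lhs => rw [← eB]
    rw [relabel_rowDart, eB' i hi]
  · conv_lhs => rw [← eC]
    rw [relabel_rowDart, eC' i hi]
  · have := (t1 ho).relabel e3
    rwa [eA, eB, eC] at this
  · have := (t2 he).relabel e3
    rwa [eA, eB, eC] at this

end Diagram

namespace Diagram

variable {X : Type*} {E E' : Diagram X}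

/-! ### Groups -/

section Legs

variable {l : X} {k : ℕ}

/-- A twist of which two legs lie inside it is everything. -/
theorem IsTwist.mem_of_legs (h : E.IsTwist l k) (hp : E.ThreeEdgeConnected) {e f : X}
    (he : ∀ x, x = l ∨ x = E.σ l ∨ x = E.se l k ∨ x = E.ne l k →
      x = e ∨ x = f ∨ E.α x ∈ E.twistDarts l k) (x : X) : x ∈ E.twistDarts l k := by
  have key : ∀ z, z ≠ e → z ≠ f → z ∈ E.twistDarts l k → E.α z ∈ E.twistDarts l k := by
    intro z h1 h2 hz
    have := he z
    rcases h.dart_cases hz with hz | hz | hz | hz | ⟨i, hi, hz⟩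
    · tauto
    · tauto
    · tauto
    · tauto
    · exact h.α_mem_of_inner hi hz
  have := hp.colour_eq (c := fun z => z ∈ E.twistDarts l k) e f (fun z => by simp)
    (fun z h1 h2 h3 h4 => propext ⟨fun hz => ?_, key z h1 h3⟩) l x
  · exact (iff_of_eq this).1 (E.start_mem h.pos)
  · have := key _ (fun h => h2 (E.α_eq_iff.1 h)) (fun h => h4 (E.α_eq_iff.1 h)) hz
    rwa [E.α_α] at this

/-- If two crossings in a row are closed up along one long side, 3-edge-connectivity leaves no room
for the other two legs but to be joined to each other. This makes a bigon beyond the left end. -/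
theorem IsTwist.bigon_of_two (h : E.IsTwist l 2) (hp : E.ThreeEdgeConnected)
    (hl : E.α l = E.ne l 2 ∨ E.α (E.σ l) = E.se l 2) : E.IsBigon l := by
  have n01 : ¬ E.SameVertex l (E.rowDart l 1) := fun hs => by
    have := h.inj (i := 0) (j := 1) (by omega) (by omega) hs
    omega
  have n10 : ¬ E.SameVertex (E.rowDart l 1) l := fun hs => n01 hs.symm
  have n : ∀ {x y}, E.SameVertex l x → E.SameVertex (E.rowDart l 1) y → x ≠ y := by
    rintro x _ h1 h2 rfl
    exact n01 (h1.trans h2.symm)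
  have r : ∀ x : X, E.SameVertex x x := SameVertex.refl
  have a0 := h.α_se (i := 0) (by omega)
  have a1 := E.α_ne_rowDart l 0
  simp only [rowDart_zero, zero_add] at a0 a1
  have b0 : E.α (E.σ (E.rowDart l 1)) = E.σ (E.σ l) := by rw [← a0, E.α_α]
  have b1 : E.α (E.rowDart l 1) = E.σ (E.σ (E.σ l)) := by rw [← a1, E.α_α]
  have both : E.α l = E.ne l 2 ∧ E.α (E.σ l) = E.se l 2 := by
    simp only [ne_succ, se_succ] at hl ⊢
    rcases hl with hl | hl
    · refine ⟨hl, ?_⟩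
      have hl' := E.α_eq_iff.1 hl
      have hm := h.mem_of_legs hp (e := E.σ l) (f := E.se l 2) (by
        simp only [se_succ, ne_succ]
        rintro x (rfl | rfl | rfl | rfl)
        · right; right; rw [hl]; simpa using E.rowDart_mem (by omega)
        · simp
        · simp
        · right; right; rw [← hl']; exact E.start_mem h.pos) (E.α (E.σ l))
      rcases h.dart_cases hm with g | g | g | g | ⟨i, hi, g⟩
      · exact absurd (hl.symm.trans (E.α_eq_iff.1 g).symm) (n (by simp [r]) (by simp [r])).symm
      · exact absurd g (E.α_ne _)
      · exact g
      · rw [ne_succ, E.α_eq_iff, ← hl'] at g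
        exact absurd g (E.σ_ne_self l)
      · obtain rfl : i = 0 := by omega
        simp only [rowDart_zero, zero_add] at g
        rcases g with g | g | g | g <;> rw [E.α_eq_iff] at g
        · rw [a0] at g; exact absurd g (n (by simp [r]) (by simp [r]))
        · rw [a1] at g; exact absurd g (n (by simp [r]) (by simp [r]))
        · rw [b1] at g; exact absurd (E.σ.injective g).symm (E.σσ_ne_self _)
        · rw [b0] at g; exact absurd g.symm (E.σ_ne_self _)
    · refine ⟨?_, hl⟩
      have hl' := E.α_eq_iff.1 hl
      have hm := h.mem_of_legs hp (e := l) (f := E.ne l 2) (by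
        simp only [se_succ, ne_succ]
        rintro x (rfl | rfl | rfl | rfl)
        · simp
        · right; right; rw [hl]; simpa using E.rowDart_mem (by omega)
        · right; right; rw [← hl']; simpa using E.start_mem h.pos
        · simp) (E.α l)
      rcases h.dart_cases hm with g | g | g | g | ⟨i, hi, g⟩
      · exact absurd g (E.α_ne _)
      · exact absurd (hl.symm.trans (E.α_eq_iff.1 g).symm) (n (by simp [r]) (by simp [r])).symm
      · rw [se_succ, E.α_eq_iff, ← hl'] at g
        exact absurd g.symm (E.σ_ne_self l)
      · exact g
      · obtain rfl : i = 0 := by omega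
        simp only [rowDart_zero, zero_add] at g
        rcases g with g | g | g | g <;> rw [E.α_eq_iff] at g
        · rw [a0] at g; exact absurd g (n (by simp [r]) (by simp [r]))
        · rw [a1] at g; exact absurd g (n (by simp [r]) (by simp [r]))
        · rw [b1] at g; exact absurd g.symm (E.σσσ_ne_self _)
        · rw [b0] at g; exact absurd g.symm (E.σσ_ne_self _)
  rw [isBigon_iff, both.1, both.2]
  exact ⟨rfl, fun hs => n01 (by simpa using hs)⟩

theorem IsGroup.reverse (h : E.IsGroup l k) : E.IsGroup (E.se l k) k := by
  obtain ⟨h1, h2, h3, h4⟩ := h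
  refine ⟨h1.reverse, h3, by rwa [h1.se_se], ?_⟩
  rintro rfl y hy
  exact h4 rfl y (by simpa using hy)

/-- Maximality only excludes a bigon beyond the end of the row. A bigon beside a long side would
close up the row: for two crossings `bigon_of_two` applies, in a longer row a crossing would be
repeated. -/
theorem IsGroup.start_notMem (h : E.IsGroup l k) (hp : E.ThreeEdgeConnected) :
    l ∉ E.bigonDarts ∧ E.σ l ∉ E.bigonDarts := by
  obtain ⟨ht, h2, h3, h4⟩ := h
  simp only [mem_bigonDarts_iff, E.σ_four, not_or, h2, not_false_eq_true, true_and, and_true]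
  obtain hk | hk : k = 1 ∨ 2 ≤ k := by have := ht.pos; omega
  · exact ⟨h4 hk _ (by simp [SameVertex.refl]), h4 hk _ (by simp [SameVertex.refl])⟩
  have a0 := ht.α_se (i := 0) (by omega)
  have a1 := E.α_ne_rowDart l 0
  simp only [rowDart_zero, zero_add] at a0 a1
  have key : 2 < k → ¬ E.SameVertex l (E.rowDart l 2) := fun hk2 hs => by
    have := ht.inj (i := 0) (j := 2) (by omega) (by omega) hs
    omega
  refine ⟨fun hb => ?_, fun hb => ?_⟩
  · have hb1 := ((E.isBigon_iff _).1 hb).1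
    rw [E.σ_four, a1] at hb1
    have hb2 : E.α l = E.σ (E.σ (E.σ (E.rowDart l 1))) := by rw [hb1, E.σ_four]
    obtain rfl | hk2 : k = 2 ∨ 2 < k := by omega
    · exact h2 (ht.bigon_of_two hp (Or.inl hb2))
    · have := E.α_ne_rowDart l 1
      rw [← hb2, E.α_α] at this
      exact key hk2 (by rw [← this]; exact SameVertex.refl _)
  · have hb1 := ((E.isBigon_iff _).1 hb).1
    rw [a0] at hb1
    obtain rfl | hk2 : k = 2 ∨ 2 < k := by omega
    · exact h2 (ht.bigon_of_two hp (Or.inr hb1))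
    · have := ht.α_se (i := 1) (by omega)
      rw [← hb1, E.α_α] at this
      exact key hk2 (by rw [← sameVertex_σ_right, ← this]; simp [SameVertex.refl])

/-- The four legs of a group lie on no bigon. -/
theorem IsGroup.leg_notMem (h : E.IsGroup l k) (hp : E.ThreeEdgeConnected) :
    l ∉ E.bigonDarts ∧ E.σ l ∉ E.bigonDarts ∧ E.se l k ∉ E.bigonDarts ∧
      E.ne l k ∉ E.bigonDarts :=
  ⟨(h.start_notMem hp).1, (h.start_notMem hp).2, h.reverse.start_notMem hp⟩

theorem IsTwist.inner_mem (h : E.IsTwist l k) {i : ℕ} (hi : i + 1 < k) {x : X}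
    (hx : x = E.σ (E.σ (E.rowDart l i)) ∨ x = E.σ (E.σ (E.σ (E.rowDart l i))) ∨
      x = E.rowDart l (i + 1) ∨ x = E.σ (E.rowDart l (i + 1))) : x ∈ E.bigonDarts := by
  have hb := h.2.1 i hi
  have h0 : E.σ (E.σ (E.rowDart l i)) ∈ E.bigonDarts := mem_bigonDarts_iff.2 (Or.inl hb)
  have h1 : E.σ (E.σ (E.σ (E.rowDart l i))) ∈ E.bigonDarts :=
    mem_bigonDarts_iff.2 (Or.inr (by rwa [E.σ_four]))
  rcases hx with rfl | rfl | rfl | rfl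
  · exact h0
  · exact h1
  · rwa [← α_ne_rowDart, α_mem_bigonDarts]
  · rwa [← h.α_se hi, α_mem_bigonDarts]

/-- The darts of a group that lie on no bigon are its legs. -/
theorem IsTwist.leg_cases (h : E.IsTwist l k) {x : X} (hx : x ∈ E.twistDarts l k)
    (hx' : x ∉ E.bigonDarts) : x = l ∨ x = E.σ l ∨ x = E.se l k ∨ x = E.ne l k := by
  rcases h.dart_cases hx with g | g | g | g | ⟨i, hi, g⟩
  · exact Or.inl g
  · exact Or.inr (Or.inl g)
  · exact Or.inr (Or.inr (Or.inl g))
  · exact Or.inr (Or.inr (Or.inr g))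
  · exact absurd (h.inner_mem hi g) hx'

/-- The legs of a group lie on no bigon, so an edge of a bigon is either an inner edge of the group
or disjoint from it. -/
theorem IsGroup.α_mem (h : E.IsGroup l k) (hp : E.ThreeEdgeConnected) {x : X}
    (hx : x ∈ E.bigonDarts) : E.α x ∈ E.twistDarts l k ↔ x ∈ E.twistDarts l k := by
  have key : ∀ y ∈ E.bigonDarts, y ∈ E.twistDarts l k → E.α y ∈ E.twistDarts l k := by
    intro y hy hm
    obtain ⟨n1, n2, n3, n4⟩ := h.leg_notMem hp
    rcases h.1.dart_cases hm with rfl | rfl | rfl | rfl | ⟨i, hi, g⟩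
    · exact absurd hy n1
    · exact absurd hy n2
    · exact absurd hy n3
    · exact absurd hy n4
    · exact h.1.α_mem_of_inner hi g
  refine ⟨fun hm => ?_, key x hx⟩
  have := key (E.α x) (α_mem_bigonDarts.2 hx) hm
  rwa [E.α_α] at this

/-- The point is that the crossing behind the last bigon is new. If the row returned to its start
`l`, there would be a bigon at the left end; all other coincidences contradict the known partners of
inner darts or the two distinct vertices of the last bigon. -/
theorem IsTwist.succ (h : E.IsTwist l k) (hb : ¬ E.IsBigon l) (hb' : E.IsBigon (E.se l k)) :
    E.IsTwist l (k + 1) := by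
  obtain ⟨k, rfl⟩ := Nat.exists_eq_add_of_le' h.pos
  have hb1 := (E.isBigon_iff _).1 hb'
  rw [se_succ, α_ne_rowDart] at hb1
  have a0 : E.α (E.rowDart l (k + 1)) = E.σ (E.σ (E.σ (E.rowDart l k))) := E.α_rowDart_succ l k
  have a1 : E.α (E.σ (E.rowDart l (k + 1))) = E.σ (E.σ (E.rowDart l k)) := by
    rw [← hb1.1, E.α_α]
  have r : ∀ x : X, E.SameVertex x x := SameVertex.refl
  have inj : ∀ {i j x}, i < k + 1 → j < k + 1 → E.SameVertex (E.rowDart l i) x →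
      E.SameVertex (E.rowDart l j) x → i = j := fun hi hj h1 h2 =>
    h.inj hi hj (h1.trans h2.symm)
  have key : ∀ i < k + 1, ¬ E.SameVertex (E.rowDart l i) (E.rowDart l (k + 1)) := by
    intro i hi hs
    rcases Nat.lt_succ_iff_lt_or_eq.1 hi with hi' | rfl
    · rcases (E.sameVertex_iff _ _).1 hs with g | g | g | g
      · rcases i with _ | i
        · rw [rowDart_zero] at g
          refine hb ((E.isBigon_iff _).2 ⟨?_, ?_⟩)
          · rw [← g, a0, a1]
          · intro hs'
            rw [← g, a0, g] at hs'
            have := inj (i := 0) (j := k) (x := l) (by omega) (by omega) (r _)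
              (by simpa using SameVertex.symm hs')
            omega
        · rw [g, α_rowDart_succ] at a0
          have := inj (by omega) (by omega) (x := E.σ (E.σ (E.σ (E.rowDart l i)))) (i := i)
            (j := k) (by simp [r]) (by rw [a0]; simp [r])
          omega
      · have a2 := h.α_se (i := i) (by omega)
        rw [g, a2] at a1
        have hik : i + 1 = k := inj (by omega) (by omega) (x := E.σ (E.rowDart l (i + 1)))
          (by simp [r]) (by rw [a1]; simp [r])
        rw [hik] at a1
        exact E.σ_ne_self _ (E.σ.injective a1).symm
      · have a2 := h.α_se (i := i) (by omega)
        rw [g, a2] at a0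
        have hik : i + 1 = k := inj (by omega) (by omega) (x := E.σ (E.rowDart l (i + 1)))
          (by simp [r]) (by rw [a0]; simp [r])
        rw [hik] at a0
        exact E.σσ_ne_self _ (E.σ.injective a0).symm
      · have a2 := E.α_ne_rowDart l i
        rw [g, a2] at a0
        have hik : i + 1 = k := inj (by omega) (by omega) (x := E.rowDart l (i + 1))
          (by simp [r]) (by rw [a0]; simp [r])
        rw [hik] at a0
        exact E.σσσ_ne_self _ a0.symm
    · apply hb1.2
      rw [hb1.1]
      simpa using hs
  refine ⟨by omega, fun i hi => ?_, fun i j hi hj hs => ?_⟩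
  · rcases Nat.lt_succ_iff_lt_or_eq.1 hi with hi' | hi'
    · exact h.2.1 i hi'
    · obtain rfl : i = k := by omega
      exact hb'
  · rcases Nat.lt_succ_iff_lt_or_eq.1 hi with hi' | rfl <;>
      rcases Nat.lt_succ_iff_lt_or_eq.1 hj with hj' | rfl
    · exact h.inj hi' hj' hs
    · exact absurd hs (key i hi')
    · exact absurd hs.symm (key j hj')
    · rfl

theorem IsTwist.le_card [Fintype X] (h : E.IsTwist l k) : k ≤ Fintype.card X := by
  have : Function.Injective fun i : Fin k => E.rowDart l i := fun i j hij =>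
    Fin.ext (h.inj i.2 j.2 (by simp only at hij; rw [hij]; exact SameVertex.refl _))
  simpa using Fintype.card_le_of_injective _ this

theorem exists_twist_maximal [Fintype X] (hb : ¬ E.IsBigon l) :
    ∃ k, E.IsTwist l k ∧ ¬ E.IsBigon (E.se l k) := by
  by_contra! hc
  have : ∀ k, E.IsTwist l (k + 1) := by
    intro k
    induction k with
    | zero => exact E.isTwist_one l
    | succ k ih => exact ih.succ hb (hc _ ih)
  have := (this (Fintype.card X)).le_card
  omega

/-- Every dart that lies on no bigon is a left leg of a group. -/
theorem exists_group [Fintype X] {x : X} (hx : x ∉ E.bigonDarts) :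
    ∃ l k, E.IsGroup l k ∧ (x = l ∨ x = E.σ l) := by
  rw [mem_bigonDarts_iff, not_or] at hx
  -- The faces at `x` and `σ³ x` are no bigons. If the face at `σ x` is one, the row extends in its
  -- direction and `x` is its lower left end; otherwise the row is started at `x` itself.
  by_cases h1 : E.IsBigon (E.σ x)
  · obtain ⟨k, hk, hk'⟩ := exists_twist_maximal hx.2
    refine ⟨E.σ (E.σ (E.σ x)), k, ⟨hk, hx.2, hk', ?_⟩, Or.inr (by rw [E.σ_four])⟩
    rintro rfl
    rw [se_one, E.σ_four] at hk'
    exact absurd h1 hk'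
  · obtain ⟨k, hk, hk'⟩ := exists_twist_maximal hx.1
    refine ⟨x, k, ⟨hk, hx.1, hk', ?_⟩, Or.inl rfl⟩
    rintro rfl y hy
    rw [se_one] at hk'
    rcases (E.sameVertex_iff _ _).1 hy with rfl | rfl | rfl | rfl
    · exact hx.1
    · exact h1
    · exact hk'
    · exact hx.2

end Legs

/-! ### The vertices of the condensation -/

section Condensation

theorem rest_notMem (x : E.Rest E.bigonDarts) : x.1 ∉ E.bigonDarts := rest_iff.1 x.2

/-- The dart of the condensation given by a dart that lies on no bigon. -/
def toRest (x : X) (hx : x ∉ E.bigonDarts) : E.Rest E.bigonDarts := ⟨x, rest_iff.2 hx⟩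

@[simp] theorem toRest_val (x : X) (hx : x ∉ E.bigonDarts) : (toRest x hx).1 = x := rfl

variable [Finite X]

/-- A surviving dart is fixed by `crossPerm`, so the walk round the merged vertex begins at `σ x`.
-/
theorem condensation_σ_runs {x : E.Rest E.bigonDarts} {y : X}
    (h : Runs (E.σ * E.crossPerm E.bigonDarts)
      (fun x => ¬ (x ∈ E.bigonDarts ∨ E.α x ∈ E.bigonDarts)) (E.σ x.1) y) :
    (E.condensation.σ x).1 = y := by
  refine firstReturn_eq_of_runs (x := x) ?_
  have : E.crossPerm E.bigonDarts x.1 = x.1 := if_neg x.2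
  rwa [Perm.mul_apply, this]

theorem condensation_α (x : E.Rest E.bigonDarts) : (E.condensation.α x).1 = E.α x.1 := rfl

theorem condensation_σ_of_notMem {x : E.Rest E.bigonDarts} (h : E.σ x.1 ∉ E.bigonDarts) :
    (E.condensation.σ x).1 = E.σ x.1 :=
  condensation_σ_runs (Runs.refl (rest_iff.2 h))

variable {l : X} {k : ℕ}

/-- From the lower left leg the walk round the group follows the lower inner edges until it reaches
the lower right leg. -/
theorem IsGroup.condensation_sw (h : E.IsGroup l k) (hp : E.ThreeEdgeConnected)
    {x : E.Rest E.bigonDarts} (hx : x.1 = E.σ l) : (E.condensation.σ x).1 = E.se l k := by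
  apply condensation_σ_runs
  rw [hx]
  have key : ∀ m i, i + m + 1 = k → Runs (E.σ * E.crossPerm E.bigonDarts)
      (fun x => ¬ (x ∈ E.bigonDarts ∨ E.α x ∈ E.bigonDarts)) (E.σ (E.σ (E.rowDart l i)))
      (E.se l k) := by
    intro m
    induction m with
    | zero =>
      rintro i rfl
      exact Runs.refl (rest_iff.2 (h.leg_notMem hp).2.2.1)
    | succ m ih =>
      intro i hi
      have hm : E.σ (E.σ (E.rowDart l i)) ∈ E.bigonDarts :=
        h.1.inner_mem (i := i) (by omega) (Or.inl rfl)
      refine Runs.step (fun hn => hn (Or.inl hm)) ?_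
      have : E.crossPerm E.bigonDarts (E.σ (E.σ (E.rowDart l i))) =
          E.α (E.σ (E.σ (E.rowDart l i))) := if_pos (Or.inl hm)
      rw [Perm.mul_apply, this, h.1.α_se (by omega)]
      exact ih (i + 1) (by omega)
  exact key (k - 1) 0 (by have := h.1.pos; omega)

theorem IsGroup.condensation_nw (h : E.IsGroup l k) (hp : E.ThreeEdgeConnected)
    {x : E.Rest E.bigonDarts} (hx : x.1 = l) : (E.condensation.σ x).1 = E.σ l := by
  rw [condensation_σ_of_notMem] <;> rw [hx]
  exact (h.leg_notMem hp).2.1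

theorem IsGroup.condensation_se (h : E.IsGroup l k) (hp : E.ThreeEdgeConnected)
    {x : E.Rest E.bigonDarts} (hx : x.1 = E.se l k) : (E.condensation.σ x).1 = E.ne l k :=
  h.reverse.condensation_nw hp hx

theorem IsGroup.condensation_ne (h : E.IsGroup l k) (hp : E.ThreeEdgeConnected)
    {x : E.Rest E.bigonDarts} (hx : x.1 = E.ne l k) : (E.condensation.σ x).1 = l := by
  rw [h.reverse.condensation_sw hp hx, h.1.se_se]

theorem sameVertex_condensation {x y : E.Rest E.bigonDarts} (h : E.SameVertex x.1 y.1) :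
    E.condensation.SameVertex x y := by
  have hx := rest_notMem x
  have hy := rest_notMem y
  have step : ∀ {x y : E.Rest E.bigonDarts}, y.1 = E.σ x.1 → E.condensation.SameVertex x y := by
    intro x y h
    have : y = E.condensation.σ x := Subtype.ext (by
      rw [condensation_σ_of_notMem (by rw [← h]; exact rest_notMem y), h])
    rw [this]
    exact (Perm.SameCycle.refl _ _).apply_right
  rcases (E.sameVertex_iff _ _).1 h with g | g | g | g
  · rw [Subtype.ext g]; exact Perm.SameCycle.refl _ _
  · exact step g
  -- If neither `x` nor `σ² x` lies on a bigon, none of the four corners of the crossing belongs to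
  -- one.
  · have hz : E.σ x.1 ∉ E.bigonDarts := by
      rw [mem_bigonDarts_iff] at hx hy ⊢
      rw [E.σ_four]
      rw [g, E.σ_four] at hy
      tauto
    exact (step (y := toRest _ hz) rfl).trans (step g)
  · exact (step (by rw [g, E.σ_four])).symm

theorem IsGroup.σ_mem (h : E.IsGroup l k) (hp : E.ThreeEdgeConnected) (x : E.Rest E.bigonDarts) :
    (E.condensation.σ x).1 ∈ E.twistDarts l k ↔ x.1 ∈ E.twistDarts l k := by
  have hτ : ∀ z, (E.σ * E.crossPerm E.bigonDarts) z ∈ E.twistDarts l k ↔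
      z ∈ E.twistDarts l k := by
    intro z
    rw [Perm.mul_apply, σ_mem_twistDarts]
    by_cases hz : z ∈ E.bigonDarts
    · have : E.crossPerm E.bigonDarts z = E.α z := if_pos (Or.inl hz)
      rw [this, h.α_mem hp hz]
    · have : E.crossPerm E.bigonDarts z = z := if_neg (rest_iff.2 hz)
      rw [this]
  have := (runs_firstReturn (E.σ * E.crossPerm E.bigonDarts) _ x).sameCycle.map_eq
    (h := fun z => z ∈ E.twistDarts l k) (fun z => propext (hτ z))
  rw [← hτ x.1]
  exact (iff_of_eq this).symm

/-- The darts of the condensation at the vertex that represents a group. -/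
theorem IsGroup.sameVertex_iff (h : E.IsGroup l k) (hp : E.ThreeEdgeConnected)
    {x y : E.Rest E.bigonDarts} (hx : x.1 ∈ E.twistDarts l k) :
    E.condensation.SameVertex x y ↔ y.1 ∈ E.twistDarts l k := by
  constructor
  · intro hs
    have := hs.map_eq (h := fun z : E.Rest E.bigonDarts => z.1 ∈ E.twistDarts l k)
      (fun z => propext (h.σ_mem hp z))
    exact (iff_of_eq this).1 hx
  · intro hy
    have key : ∀ z : E.Rest E.bigonDarts, z.1 ∈ E.twistDarts l k →
        E.condensation.SameVertex (toRest l (h.leg_notMem hp).1) z := by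
      intro z hz
      have r := (Perm.SameCycle.refl E.condensation.σ (toRest l (h.leg_notMem hp).1)).apply_right
      have r1 := h.condensation_nw hp (x := toRest l (h.leg_notMem hp).1) rfl
      have r2 := h.condensation_sw hp r1
      have r3 := h.condensation_se hp r2
      rcases h.1.leg_cases hz (rest_notMem z) with g | g | g | g
      · rw [show z = toRest l (h.leg_notMem hp).1 from Subtype.ext g]
        exact Perm.SameCycle.refl _ _
      · rw [Subtype.ext (g.trans r1.symm)]; exact r
      · rw [Subtype.ext (g.trans r2.symm)]; exact r.apply_right
      · rw [Subtype.ext (g.trans r3.symm)]; exact r.apply_right.apply_right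
    exact (key x hx).symm.trans (key y hy)

/-- From a common crossing one walks back along the first row; its inner edges lie on bigons and
cannot leave the second group. So the start of the first row would belong to both groups, and they
would give the same vertex. -/
theorem IsGroup.disjoint {l' : X} {k' : ℕ} (h : E.IsGroup l k) (h' : E.IsGroup l' k')
    (hp : E.ThreeEdgeConnected) {x y : E.Rest E.bigonDarts} (hx : x.1 ∈ E.twistDarts l k)
    (hy : y.1 ∈ E.twistDarts l' k') (hxy : ¬ E.condensation.SameVertex x y) :
    Disjoint (E.twistDarts l k) (E.twistDarts l' k') := by
  rw [Set.disjoint_left]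
  rintro z ⟨i, hi, hz⟩ hz'
  have hi' : E.rowDart l i ∈ E.twistDarts l' k' := by
    obtain ⟨j, hj, hz'⟩ := hz'
    exact ⟨j, hj, hz'.trans hz.symm⟩
  have key : ∀ j ≤ i, E.rowDart l (i - j) ∈ E.twistDarts l' k' := by
    intro j
    induction j with
    | zero => exact fun _ => hi'
    | succ j ih =>
      intro hj
      have := ih (by omega)
      rw [show i - j = i - (j + 1) + 1 by omega, rowDart_succ, h'.α_mem hp
        (h.1.inner_mem (i := i - (j + 1)) (by omega) (Or.inr (Or.inl rfl)))] at this
      simpa using this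
  have hl := key i le_rfl
  rw [Nat.sub_self, rowDart_zero] at hl
  let w := toRest l (h.leg_notMem hp).1
  exact hxy (((h.sameVertex_iff hp (x := x) (y := w) hx).2 (E.start_mem h.1.pos)).trans
    ((h'.sameVertex_iff hp (x := w) hl).2 hy))

end Condensation

end Diagram

/-! ### Transport along isomorphisms of maps -/

namespace CMap

variable {X Y Z : Type*}

theorem Iso.symm {M : CMap X} {N : CMap Y} (h : M.Iso N) : N.Iso M := by
  obtain ⟨e, h1, h2⟩ := h
  exact ⟨e.symm, fun x => by rw [e.symm_apply_eq, h1, e.apply_symm_apply],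
    fun x => by rw [e.symm_apply_eq, h2, e.apply_symm_apply]⟩

theorem Iso.trans {M : CMap X} {N : CMap Y} {K : CMap Z} (h : M.Iso N) (h' : N.Iso K) :
    M.Iso K := by
  obtain ⟨e, h1, h2⟩ := h
  obtain ⟨f, h3, h4⟩ := h'
  exact ⟨e.trans f, fun x => by simp [h1, h3], fun x => by simp [h2, h4]⟩

section Transport

variable {M : CMap X} {N : CMap Y} {f : X ≃ Y}

theorem sameVertex_map (hσ : ∀ x, f (M.σ x) = N.σ (f x)) {x y : X} : N.SameVertex (f x) (f y) ↔ M.SameVertex x y := by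
  have h : N.σ = f.permCongr M.σ := by
    ext y
    rw [Equiv.permCongr_apply, hσ, f.apply_symm_apply]
  rw [SameVertex, h]
  constructor
  · rintro ⟨n, hn⟩
    refine ⟨n, f.injective ?_⟩
    rw [← hn]
    have : (f.permCongr M.σ) ^ n = f.permCongr (M.σ ^ n) := (map_zpow f.permCongrHom M.σ n).symm
    rw [this, Equiv.permCongr_apply, f.symm_apply_apply]
  · rintro ⟨n, rfl⟩
    refine ⟨n, ?_⟩
    have : (f.permCongr M.σ) ^ n = f.permCongr (M.σ ^ n) := (map_zpow f.permCongrHom M.σ n).symm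
    rw [this, Equiv.permCongr_apply, f.symm_apply_apply]

theorem φ_map (hσ : ∀ x, f (M.σ x) = N.σ (f x))
    (hα : ∀ x, f (M.α x) = N.α (f x)) (x : X) : f (M.φ x) = N.φ (f x) := by
  rw [φ, φ, Perm.mul_apply, Perm.mul_apply, Perm.eq_inv_iff_eq, ← hσ, ← Perm.mul_apply, mul_inv_cancel, Perm.one_apply, hα]

theorem IsSimple.map (hσ : ∀ x, f (M.σ x) = N.σ (f x))
    (hα : ∀ x, f (M.α x) = N.α (f x)) (h : M.IsSimple) : N.IsSimple := by
  refine ⟨fun y hy => ?_, fun y y' hy hy' => ?_⟩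
  · obtain ⟨x, rfl⟩ := f.surjective y
    rw [← hα, sameVertex_map hσ] at hy
    exact h.1 x hy
  · obtain ⟨x, rfl⟩ := f.surjective y
    obtain ⟨x', rfl⟩ := f.surjective y'
    rw [← hα, ← hα, sameVertex_map hσ] at hy'
    rw [sameVertex_map hσ] at hy
    rw [h.2 x x' hy hy']

theorem ots_map [DecidableEq X] [DecidableEq Y] (hσ : ∀ x, f (M.σ x) = N.σ (f x))
    (hα : ∀ x, f (M.α x) = N.α (f x)) (t : X) : (M.ots t).Iso (N.ots (f t)) := by
  have hρ : ∀ x, f (M.otsPerm t x) = N.otsPerm (f t) (f x) := by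
    intro x
    simp only [otsPerm, Perm.mul_apply, ← φ_map hσ hα, ← hσ, f.injective.map_swap]
  have hρ' : ∀ x, f ((M.otsPerm t)⁻¹ x) = (N.otsPerm (f t))⁻¹ (f x) := by
    intro x
    rw [Perm.eq_inv_iff_eq, ← hρ, ← Perm.mul_apply, mul_inv_cancel, Perm.one_apply]
  refine ⟨f, hσ, fun x => ?_⟩
  change f ((M.otsPerm t * M.α * (M.otsPerm t)⁻¹) x) =
    (N.otsPerm (f t) * N.α * (N.otsPerm (f t))⁻¹) (f x)
  simp only [Perm.mul_apply, hρ, hα, hρ']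

end Transport

/-- In a simple graph the triangles are `ots`-triangles. -/
theorem IsSimple.isOtsTriangle {M : CMap X} (h : M.IsSimple) {t : X} (ht : M.φ (M.φ (M.φ t)) = t)
    (h0 : ¬ M.SameVertex t (M.φ t)) (h1 : ¬ M.SameVertex (M.φ t) (M.φ (M.φ t)))
    (h2 : ¬ M.SameVertex (M.φ (M.φ t)) t) : M.IsOtsTriangle t := by
  have key : ∀ x y, ¬ M.MultiplyConnected x y := by
    rintro x y ⟨u, v, huv, h1, h2, h3, h4⟩
    exact huv (h.2 u v (h1.symm.trans h2) (h3.symm.trans h4))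
  exact ⟨ht, h0, h1, h2, key _ _, key _ _, key _ _⟩

end CMap

namespace Diagram

variable {X : Type*} {E E' : Diagram X} {V S : Set X}

theorem IsTwist.legs_nodup {l : X} {k : ℕ} (h : E.IsTwist l k) :
    [l, E.σ l, E.se l k, E.ne l k].Nodup := by
  have key : ∀ {x y : X}, E.SameVertex l x → E.SameVertex (E.rowDart l (k - 1)) y →
      (k = 1 → x ≠ y) → x ≠ y := by
    rintro x y h1 h2 h3 rfl
    have := h.inj (i := 0) (j := k - 1) h.pos (by have := h.pos; omega) (h1.trans h2.symm)
    exact h3 (by have := h.pos; omega) rfl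
  have r : ∀ x : X, E.SameVertex x x := SameVertex.refl
  have h1 : l ≠ E.se l k := key (r l) (by simp [Diagram.se, r]) (by
    rintro rfl h; exact E.σσ_ne_self l h.symm)
  have h2 : l ≠ E.ne l k := key (r l) (by simp [Diagram.ne, r]) (by
    rintro rfl h; exact E.σσσ_ne_self l h.symm)
  have h3 : E.σ l ≠ E.se l k := key (by simp [r]) (by simp [Diagram.se, r]) (by
    rintro rfl h; exact E.σ_ne_self _ h.symm)
  have h4 : E.σ l ≠ E.ne l k := key (by simp [r]) (by simp [Diagram.ne, r]) (by
    rintro rfl h; exact E.σσ_ne_self _ h.symm)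
  have h5 : E.se l k ≠ E.ne l k := (E.σ_ne_self _).symm
  simp [h1, h2, h3, h4, h5, (E.σ_ne_self l).symm]

/-! ### Simple condensations -/

section Simple

variable [Finite X] {l l' : X} {k k' : ℕ} {x y : X}

theorem IsGroup.α_notMem (h : E.IsGroup l k) (hp : E.ThreeEdgeConnected)
    (hG : E.condensation.IsSimple) (hx : x ∈ E.twistDarts l k) (hx' : x ∉ E.bigonDarts) :
    E.α x ∉ E.twistDarts l k := fun hm =>
  hG.1 (toRest x hx') ((h.sameVertex_iff hp (x := toRest x hx') hx).2 hm)

theorem IsGroup.eq_of_joined (h : E.IsGroup l k) (h' : E.IsGroup l' k')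
    (hp : E.ThreeEdgeConnected) (hG : E.condensation.IsSimple) (hx : x ∈ E.twistDarts l k)
    (hx' : x ∉ E.bigonDarts) (hy : y ∈ E.twistDarts l k) (hy' : y ∉ E.bigonDarts)
    (hαx : E.α x ∈ E.twistDarts l' k') (hαy : E.α y ∈ E.twistDarts l' k') : x = y :=
  congrArg Subtype.val (hG.2 (toRest x hx') (toRest y hy')
    ((h.sameVertex_iff hp (x := toRest x hx') hx).2 hy)
    ((h'.sameVertex_iff hp (x := E.condensation.α (toRest x hx')) hαx).2 hαy))

/-- Simplicity keeps the legs outside the tangle: a leg returning to its own group would be a loop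
of the condensation, and one arriving at another group would be parallel to a side of the triangle.
-/
theorem Tri.of_groups {l₀ l₁ l₂ : X} {k₀ k₁ k₂ : ℕ} (hp : E.ThreeEdgeConnected)
    (hG : E.condensation.IsSimple) (h0 : E.IsGroup l₀ k₀) (h1 : E.IsGroup l₁ k₁)
    (h2 : E.IsGroup l₂ k₂) (h : E.IsTriangle l₀ k₀ l₁ k₁ l₂ k₂) :
    Tri E (E.twistDarts l₀ k₀ ∪ E.twistDarts l₁ k₁ ∪ E.twistDarts l₂ k₂) l₀ k₀ l₁ k₁ l₂ k₂
      (E.α l₀) (E.α (E.σ l₀)) (E.α l₁) (E.α (E.σ l₁)) (E.α l₂) (E.α (E.σ l₂)) := by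
  have key : ∀ {l₀ l₁ l₂ : X} {k₀ k₁ k₂ : ℕ}, E.IsGroup l₀ k₀ → E.IsGroup l₁ k₁ →
      E.IsGroup l₂ k₂ → E.α (E.se l₀ k₀) = E.ne l₁ k₁ → E.α (E.ne l₀ k₀) = E.se l₂ k₂ →
      (E.α l₀ ∉ E.twistDarts l₀ k₀ ∧ E.α l₀ ∉ E.twistDarts l₁ k₁ ∧
        E.α l₀ ∉ E.twistDarts l₂ k₂) ∧ E.α (E.σ l₀) ∉ E.twistDarts l₀ k₀ ∧
        E.α (E.σ l₀) ∉ E.twistDarts l₁ k₁ ∧ E.α (E.σ l₀) ∉ E.twistDarts l₂ k₂ := by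
    intro l₀ l₁ l₂ k₀ k₁ k₂ h0 h1 h2 a1 a2
    obtain ⟨n1, n2, n3, n4⟩ := h0.leg_notMem hp
    have hd := h0.1.legs_nodup
    simp only [List.nodup_cons, List.mem_cons, List.not_mem_nil, or_false, not_or] at hd
    have m0 := E.start_mem (l := l₀) h0.1.pos
    have m0' : E.σ l₀ ∈ E.twistDarts l₀ k₀ := by simpa using m0
    have m1 := E.se_mem (l := l₀) h0.1.pos
    have m2 := E.ne_mem (l := l₀) h0.1.pos
    have b1 : E.α (E.se l₀ k₀) ∈ E.twistDarts l₁ k₁ := a1 ▸ E.ne_mem h1.1.pos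
    have b2 : E.α (E.ne l₀ k₀) ∈ E.twistDarts l₂ k₂ := a2 ▸ E.se_mem h2.1.pos
    exact ⟨⟨h0.α_notMem hp hG m0 n1,
      fun hm => hd.1.2.1 (h0.eq_of_joined h1 hp hG m0 n1 m1 n3 hm b1),
      fun hm => hd.1.2.2 (h0.eq_of_joined h2 hp hG m0 n1 m2 n4 hm b2)⟩,
      h0.α_notMem hp hG m0' n2,
      fun hm => hd.2.1.1 (h0.eq_of_joined h1 hp hG m0' n2 m1 n3 hm b1),
      fun hm => hd.2.1.2 (h0.eq_of_joined h2 hp hG m0' n2 m2 n4 hm b2)⟩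
  obtain ⟨-, -, -, -, -, -, a0, a1, a2⟩ := id h
  have c0 := key h0 h1 h2 a0 (E.α_eq_iff.2 a2.symm)
  have c1 := key h1 h2 h0 a1 (E.α_eq_iff.2 a0.symm)
  have c2 := key h2 h0 h1 a2 (E.α_eq_iff.2 a1.symm)
  refine ⟨h, rfl, rfl, rfl, rfl, rfl, rfl, rfl, ?_, ?_, ?_, ?_, ?_, ?_⟩ <;>
    simp only [Set.mem_union, not_or] <;> tauto

end Simple

/-! ### Isomorphisms with collapsed diagrams -/

/-- `N` has the cyclic orders of the collapse of `E`, but its own edges; it will be the condensation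
or its image under `ots`. The cyclic orders depend only on `σ` and the shrunken edges, so they agree
for `E` and `E'`, and only the involutions have to be matched by `e`. -/
theorem exists_collapse_equiv [Finite X] (hσ : E'.σ = E.σ) (hS : ∀ x ∈ S, E'.α x = E.α x)
    (hα : ∀ x, E.α x ∈ S ↔ x ∈ S) (N : CMap (E.Rest S)) (hN : N.σ = (E.collapse S).σ)
    (e : Perm (E.Rest S)) (he : ∀ x, e (N.σ x) = N.σ (e x))
    (he' : ∀ x, (e (N.α x)).1 = E'.α (e x).1) :
    ∃ f : E.Rest S ≃ E'.Rest S, (∀ x, f (N.σ x) = (E'.collapse S).σ (f x)) ∧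
      (∀ x, f (N.α x) = (E'.collapse S).α (f x)) ∧ ∀ x, (f x).1 = (e x).1 := by
  have hα' : ∀ x, E'.α x ∈ S ↔ x ∈ S := fun x => by
    constructor
    · intro h
      have := hS _ h
      rw [E'.α_α] at this
      rw [this, hα]
      exact h
    · intro h
      rwa [hS x h, hα]
  have hp : ∀ x, ¬ (x ∈ S ∨ E.α x ∈ S) ↔ ¬ (x ∈ S ∨ E'.α x ∈ S) := fun x => by
    rw [hα, hα']
  have hc : E'.crossPerm S = E.crossPerm S := by
    ext x
    by_cases h : x ∈ S
    · have e1 : E'.crossPerm S x = E'.α x := if_pos (Or.inl h)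
      have e2 : E.crossPerm S x = E.α x := if_pos (Or.inl h)
      rw [e1, e2, hS x h]
    · have e1 : E'.crossPerm S x = x := if_neg (by rwa [hα', or_self])
      have e2 : E.crossPerm S x = x := if_neg (by rwa [hα, or_self])
      rw [e1, e2]
  let f0 : E.Rest S ≃ E'.Rest S := Equiv.subtypeEquivRight hp
  have f0v : ∀ x, (f0 x).1 = x.1 := fun x => rfl
  have hf0 : ∀ x, f0 ((E.collapse S).σ x) = (E'.collapse S).σ (f0 x) := by
    intro x
    refine Subtype.ext ?_
    rw [f0v]
    refine (firstReturn_eq_of_runs (x := f0 x) ?_).symm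
    obtain ⟨n, h1, h2, h3⟩ :=
      runs_firstReturn (E.σ * E.crossPerm S) (fun x => ¬ (x ∈ S ∨ E.α x ∈ S)) x
    rw [hσ, hc]
    exact ⟨n, h1, (hp _).1 h2, fun m hm h => h3 m hm ((hp _).2 h)⟩
  refine ⟨e.trans f0, fun x => ?_, fun x => Subtype.ext (he' x), fun x => rfl⟩
  rw [Equiv.trans_apply, Equiv.trans_apply, he, hN, hf0]

/-- The bigons near a triangle of twists: a new one appears where neighbouring legs of one twist
arrive at neighbouring darts. -/
theorem Tri.bigon_cases {l₀ l₁ l₂ : X} {k₀ k₁ k₂ : ℕ} {n₀ s₀ n₁ s₁ n₂ s₂ x : X}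
    (h : Tri E V l₀ k₀ l₁ k₁ l₂ k₂ n₀ s₀ n₁ s₁ n₂ s₂) (hx : E.IsBigon x) :
    (x ∉ V ∧ E.α x ∉ V ∧ E.σ x ∉ V ∧ E.α (E.σ x) ∉ V) ∨
    (x ∈ E.twistDarts l₀ k₀ ∧ E.α x ∈ E.twistDarts l₀ k₀) ∨
    (x ∈ E.twistDarts l₁ k₁ ∧ E.α x ∈ E.twistDarts l₁ k₁) ∨
    (x ∈ E.twistDarts l₂ k₂ ∧ E.α x ∈ E.twistDarts l₂ k₂) ∨
    n₀ = E.σ s₀ ∨ n₁ = E.σ s₁ ∨ n₂ = E.σ s₂ := by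
  -- If `x` leaves the tangle, so does `σ x`. Both are then outer legs of one twist, hence `x = l₀`,
  -- and the bigon compares their far ends.
  have out₀ : ∀ {l₀ l₁ l₂ : X} {k₀ k₁ k₂ : ℕ} {n₀ s₀ n₁ s₁ n₂ s₂ x : X},
      Tri E V l₀ k₀ l₁ k₁ l₂ k₂ n₀ s₀ n₁ s₁ n₂ s₂ → E.IsBigon x → x ∈ E.twistDarts l₀ k₀ →
      E.α x ∉ V → n₀ = E.σ s₀ := by
    intro l₀ l₁ l₂ k₀ k₁ k₂ n₀ s₀ n₁ s₁ n₂ s₂ x h hx hm ho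
    have hb := ((E.isBigon_iff x).1 hx).1
    have ho' : E.α (E.σ x) ∉ V := by rwa [hb, h.closed] at ho
    have c1 : x = l₀ ∨ x = E.σ l₀ := by
      rcases h.inner₀ hm with g | g | g
      · exact Or.inl g
      · exact Or.inr g
      · exact absurd g ho
    have c2 : E.σ x = l₀ ∨ E.σ x = E.σ l₀ := by
      rcases h.inner₀ (x := E.σ x) (by simpa using hm) with g | g | g
      · exact Or.inl g
      · exact Or.inr g
      · exact absurd g ho'
    have : x = l₀ := by
      rcases c1 with g | g
      · exact g
      · rcases c2 with g' | g'
        · rw [g] at g'; exact absurd g' (E.σσ_ne_self _)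
        · exact E.σ.injective g'
    rw [this, h.nw₀, h.sw₀] at hb
    exact hb
  have out : ∀ {x : X}, E.IsBigon x → x ∈ V → E.α x ∉ V → n₀ = E.σ s₀ ∨ n₁ = E.σ s₁ ∨ n₂ = E.σ s₂ := by
    intro x hx hm ho
    rcases h.mem_cases hm with g | g | g
    · exact Or.inl (out₀ h hx g ho)
    · exact Or.inr (Or.inl (out₀ h.rot hx g ho))
    · exact Or.inr (Or.inr (out₀ h.rot.rot hx g ho))
  -- A bigon between two twists would use both right ends of one of them, but these lead to two
  -- disjoint twists.
  have inn₀ : ∀ {l₀ l₁ l₂ : X} {k₀ k₁ k₂ : ℕ} {n₀ s₀ n₁ s₁ n₂ s₂ x : X},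
      Tri E V l₀ k₀ l₁ k₁ l₂ k₂ n₀ s₀ n₁ s₁ n₂ s₂ → E.IsBigon x → x ∈ E.twistDarts l₀ k₀ →
      E.α x ∈ V → E.α x ∈ E.twistDarts l₀ k₀ := by
    intro l₀ l₁ l₂ k₀ k₁ k₂ n₀ s₀ n₁ s₁ n₂ s₂ x h hx hm ho
    have hb := ((E.isBigon_iff x).1 hx).1
    have hm1 : E.σ x ∈ E.twistDarts l₀ k₀ := by simpa using hm
    have cl : ∀ z ∈ E.twistDarts l₀ k₀, E.α z ∈ V → E.α z ∉ E.twistDarts l₀ k₀ →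
        z = E.se l₀ k₀ ∨ z = E.ne l₀ k₀ := by
      intro z hz hz1 hz2
      rcases h.twist₀.dart_cases hz with g | g | g | g | ⟨i, hi, g⟩
      · rw [g, h.nw₀] at hz1; exact absurd hz1 h.n₀_mem
      · rw [g, h.sw₀] at hz1; exact absurd hz1 h.s₀_mem
      · exact Or.inl g
      · exact Or.inr g
      · exact absurd (h.twist₀.α_mem_of_inner hi g) hz2
    by_contra hc
    have hc' : E.α (E.σ x) ∉ E.twistDarts l₀ k₀ := by rwa [hb, σ_mem_twistDarts] at hc
    have ho' : E.α (E.σ x) ∈ V := by rwa [hb, h.closed] at ho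
    have hnext : E.σ x = E.σ (E.se l₀ k₀) := by
      rcases cl _ hm1 ho' hc' with g | g
      · rcases cl _ hm ho hc with g' | g'
        · rw [g'] at g; exact absurd g (E.σ_ne_self _)
        · rw [g', ne_eq_σ_se] at g; exact absurd g (E.σσ_ne_self _)
      · rw [g, ne_eq_σ_se]
    have hse : x = E.se l₀ k₀ := E.σ.injective hnext
    rw [hnext, ← ne_eq_σ_se, h.α_ne₀, hse, h.α_se₀] at hb
    exact h.rot.ne_of_mem₀₁ (x := E.ne l₁ k₁) (y := E.σ (E.se l₂ k₂)) (E.ne_mem h.rot.twist₀.pos)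
      (by simpa using E.se_mem h.rot.rot.twist₀.pos) hb
  have hb := ((E.isBigon_iff x).1 hx).1
  by_cases hm : x ∈ V
  · by_cases ho : E.α x ∈ V
    · rcases h.mem_cases hm with g | g | g
      · exact Or.inr (Or.inl ⟨g, inn₀ h hx g ho⟩)
      · exact Or.inr (Or.inr (Or.inl ⟨g, inn₀ h.rot hx g ho⟩))
      · exact Or.inr (Or.inr (Or.inr (Or.inl ⟨g, inn₀ h.rot.rot hx g ho⟩)))
    · have := out hx hm ho
      tauto
  · by_cases ho : E.α x ∈ V
    · have hm' : E.α (E.σ x) ∈ V := by rwa [hb, h.closed] at ho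
      have := out (bigon_other hx) hm' (by rwa [E.α_α, h.closed])
      tauto
    · exact Or.inl ⟨hm, ho, by rwa [h.closed], by rwa [hb, h.closed] at ho⟩

end Diagram

/-- Serves to exchange two vertices of degree four dart by dart. -/
theorem Equiv.Perm.exists_four_swaps {Y : Type*} [DecidableEq Y] {a b c d a' b' c' d' : Y}
    (h : [a, b, c, d, a', b', c', d'].Nodup) :
    ∃ e : Perm Y, e a = a' ∧ e b = b' ∧ e c = c' ∧ e d = d' ∧ e a' = a ∧ e b' = b ∧ e c' = c ∧
      e d' = d ∧ ∀ x, x ∉ [a, b, c, d, a', b', c', d'] → e x = x := by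
  simp only [List.nodup_cons, List.mem_cons, List.not_mem_nil, or_false, not_or, not_false_eq_true,
    List.nodup_nil, and_true] at h
  refine ⟨swap a a' * (swap b b' * (swap c c' * swap d d')), ?_, ?_, ?_, ?_, ?_, ?_, ?_, ?_, ?_⟩
  case refine_9 =>
    intro x hx
    simp only [List.mem_cons, List.not_mem_nil, or_false, not_or] at hx
    simp only [Perm.mul_apply]
    have key : ∀ {y z : Y}, x ≠ y → x ≠ z → swap y z x = x := swap_apply_of_ne_of_ne
    rw [key hx.2.2.2.1 hx.2.2.2.2.2.2.2, key hx.2.2.1 hx.2.2.2.2.2.2.1, key hx.2.1 hx.2.2.2.2.2.1,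
      key hx.1 hx.2.2.2.2.1]
  all_goals
    simp only [Perm.mul_apply, swap_apply_def]
    grind

namespace Diagram

variable {X : Type*} {E E' : Diagram X} {V S : Set X}

/-! ### The legs of a group in the condensation -/

section Legs

variable [Finite X] {l l' : X} {k k' : ℕ}

theorem IsGroup.toRest_nw (h : E.IsGroup l k) (hp : E.ThreeEdgeConnected) (h1 h2) :
    E.condensation.σ (toRest l h1) = toRest (E.σ l) h2 :=
  Subtype.ext (h.condensation_nw hp rfl)

theorem IsGroup.toRest_sw (h : E.IsGroup l k) (hp : E.ThreeEdgeConnected) (h1 h2) :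
    E.condensation.σ (toRest (E.σ l) h1) = toRest (E.se l k) h2 :=
  Subtype.ext (h.condensation_sw hp rfl)

theorem IsGroup.toRest_se (h : E.IsGroup l k) (hp : E.ThreeEdgeConnected) (h1 h2) :
    E.condensation.σ (toRest (E.se l k) h1) = toRest (E.ne l k) h2 :=
  Subtype.ext (h.condensation_se hp rfl)

theorem IsGroup.toRest_ne (h : E.IsGroup l k) (hp : E.ThreeEdgeConnected) (h1 h2) :
    E.condensation.σ (toRest (E.ne l k) h1) = toRest l h2 :=
  Subtype.ext (h.condensation_ne hp rfl)

theorem toRest_α {x y : X} (h : E.α x = y) (hx hy) :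
    E.condensation.α (toRest x hx) = toRest y hy := Subtype.ext h

theorem IsGroup.toRest_φ (h' : E.IsGroup l' k') (hp : E.ThreeEdgeConnected)
    (hα : E.α (E.se l k) = E.ne l' k') (h1 h2) :
    E.condensation.φ (toRest (E.se l k) h1) = toRest (E.se l' k') h2 := by
  rw [CMap.φ, Perm.mul_apply, Perm.inv_eq_iff_eq, h'.toRest_se hp _ (h'.leg_notMem hp).2.2.2]
  exact toRest_α hα _ _

end Legs

theorem Tri.legs_nodup {l₀ l₁ l₂ : X} {k₀ k₁ k₂ : ℕ} {n₀ s₀ n₁ s₁ n₂ s₂ : X}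
    (h : Tri E V l₀ k₀ l₁ k₁ l₂ k₂ n₀ s₀ n₁ s₁ n₂ s₂) :
    [l₀, E.σ l₀, l₁, E.σ l₁, l₂, E.σ l₂].Nodup := by
  have m0 := E.start_mem (l := l₀) h.twist₀.pos
  have m1 := E.start_mem (l := l₁) h.rot.twist₀.pos
  have m2 := E.start_mem (l := l₂) h.rot.rot.twist₀.pos
  have m0' : E.σ l₀ ∈ E.twistDarts l₀ k₀ := by simpa using m0
  have m1' : E.σ l₁ ∈ E.twistDarts l₁ k₁ := by simpa using m1
  have m2' : E.σ l₂ ∈ E.twistDarts l₂ k₂ := by simpa using m2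
  have d01 : ∀ {x y : X}, x ∈ E.twistDarts l₀ k₀ → y ∈ E.twistDarts l₁ k₁ → x ≠ y :=
    h.ne_of_mem₀₁
  have d12 : ∀ {x y : X}, x ∈ E.twistDarts l₁ k₁ → y ∈ E.twistDarts l₂ k₂ → x ≠ y :=
    h.rot.ne_of_mem₀₁
  have d02 : ∀ {x y : X}, x ∈ E.twistDarts l₀ k₀ → y ∈ E.twistDarts l₂ k₂ → x ≠ y :=
    fun hx hy => (h.rot.rot.ne_of_mem₀₁ hy hx).symm
  simp [(E.σ_ne_self l₀).symm, (E.σ_ne_self l₁).symm, (E.σ_ne_self l₂).symm, d01 m0 m1', d01 m0' m1,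
    d02 m0 m2', d02 m0' m2, d12 m1 m2', d12 m1' m2, d01 m0 m1, d02 m0 m2, d12 m1 m2]

/-- Twists with the same crossings have the same inner edges. -/
theorem IsTwist.α_inner_eq {l x : X} {k : ℕ} (hσ : E'.σ = E.σ) (h : E.IsTwist l k)
    (h' : E'.IsTwist l k) (hr : ∀ i < k, E'.rowDart l i = E.rowDart l i)
    (hx : x ∈ E.twistDarts l k) (hx' : x ≠ l ∧ x ≠ E.σ l ∧ x ≠ E.se l k ∧ x ≠ E.ne l k) :
    E'.α x = E.α x := by
  rcases h.dart_cases hx with g | g | g | g | ⟨i, hi, g⟩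
  · exact absurd g hx'.1
  · exact absurd g hx'.2.1
  · exact absurd g hx'.2.2.1
  · exact absurd g hx'.2.2.2
  have a := h'.α_se hi
  have a' := h'.α_sw hi
  have b := E'.α_ne_rowDart l i
  have b' := E'.α_rowDart_succ l i
  rw [hσ, hr i (by omega), hr _ hi] at a a' b b'
  rcases g with rfl | rfl | rfl | rfl
  · rw [a, h.α_se hi]
  · rw [b, α_ne_rowDart]
  · rw [b', α_rowDart_succ]
  · rw [a', h.α_sw hi]

theorem se_eq_of_rows {l : X} {k : ℕ} (hk : 1 ≤ k) (hσ : E'.σ = E.σ)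
    (hr : ∀ i < k, E'.rowDart l i = E.rowDart l i) : E'.se l k = E.se l k := by
  rw [se, se, hσ, hr _ (by omega)]

theorem twistDarts_eq_of_rows {l : X} {k : ℕ} (hσ : E'.σ = E.σ)
    (hr : ∀ i < k, E'.rowDart l i = E.rowDart l i) : E'.twistDarts l k = E.twistDarts l k := by
  ext x
  simp only [mem_twistDarts]
  refine exists_congr fun i => and_congr_right fun hi => ?_
  rw [hr i hi, sameVertex_congr hσ]

theorem bigonDarts_subset (hσ : E'.σ = E.σ) (hS : ∀ x ∈ E.bigonDarts, E'.α x = E.α x) :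
    E.bigonDarts ⊆ E'.bigonDarts := by
  have key : ∀ x, E.IsBigon x → E'.IsBigon x := by
    intro x hx
    have h1 : x ∈ E.bigonDarts := Or.inl hx
    have h2 : E.σ x ∈ E.bigonDarts := mem_bigonDarts_iff.2 (Or.inr (by rwa [E.σ_four]))
    rw [isBigon_iff] at hx ⊢
    rw [hσ, hS _ h1, hS _ h2, sameVertex_congr hσ]
    exact hx
  intro x hx
  rw [mem_bigonDarts_iff] at hx ⊢
  rw [hσ]
  exact hx.imp (key _) (key _)

/-! ### Comparison of the collapsed diagram with the graph `ots(G)` -/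

section Main

variable [Finite X] {A B C nA sA nB sB nC sC : X} {a b c : ℕ}

theorem Tri.isOtsTriangle (h : Tri E V A a B b C c nA sA nB sB nC sC)
    (hp : E.ThreeEdgeConnected) (hG : E.condensation.IsSimple) (gA : E.IsGroup A a)
    (gB : E.IsGroup B b) (gC : E.IsGroup C c) :
    E.condensation.IsOtsTriangle (toRest (E.se A a) (gA.leg_notMem hp).2.2.1) := by
  have f0 := gB.toRest_φ hp h.α_se₀ (gA.leg_notMem hp).2.2.1 (gB.leg_notMem hp).2.2.1
  have f1 := gC.toRest_φ hp h.rot.α_se₀ (gB.leg_notMem hp).2.2.1 (gC.leg_notMem hp).2.2.1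
  have f2 := gA.toRest_φ hp h.rot.rot.α_se₀ (gC.leg_notMem hp).2.2.1 (gA.leg_notMem hp).2.2.1
  have key : ∀ {l l' : X} {k k' : ℕ} (g : E.IsGroup l k) (g' : E.IsGroup l' k'),
      Disjoint (E.twistDarts l k) (E.twistDarts l' k') →
      ¬ E.condensation.SameVertex (toRest (E.se l k) (g.leg_notMem hp).2.2.1)
        (toRest (E.se l' k') (g'.leg_notMem hp).2.2.1) := by
    intro l l' k k' g g' hd hs
    rw [g.sameVertex_iff hp (E.se_mem g.1.pos)] at hs
    exact Set.disjoint_left.1 hd hs (E.se_mem g'.1.pos)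
  apply hG.isOtsTriangle
  · rw [f0, f1, f2]
  · rw [f0]; exact key gA gB h.disj₀₁
  · rw [f0, f1]; exact key gB gC h.rot.disj₀₁
  · rw [f0, f1]; exact key gC gA h.rot.rot.disj₀₁

/-- Expresses the condition by the far ends of the legs, the form in which `Tri.bigon_cases` detects
new bigons. -/
theorem Tri.hasMeetingLegs_iff (h : Tri E V A a B b C c nA sA nB sB nC sC)
    (hp : E.ThreeEdgeConnected) (gA : E.IsGroup A a) (gB : E.IsGroup B b) (gC : E.IsGroup C c) :
    E.HasMeetingLegs (toRest (E.se A a) (gA.leg_notMem hp).2.2.1) ↔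
      E.σ nB = sA ∨ E.σ nC = sB ∨ E.σ nA = sC := by
  have f0 := gB.toRest_φ hp h.α_se₀ (gA.leg_notMem hp).2.2.1 (gB.leg_notMem hp).2.2.1
  have f1 := gC.toRest_φ hp h.rot.α_se₀ (gB.leg_notMem hp).2.2.1 (gC.leg_notMem hp).2.2.1
  have f2 := gA.toRest_φ hp h.rot.rot.α_se₀ (gC.leg_notMem hp).2.2.1 (gA.leg_notMem hp).2.2.1
  have key : ∀ {l : X} {k : ℕ} (g : E.IsGroup l k),
      (E.condensation.σ (E.condensation.σ (toRest (E.se l k) (g.leg_notMem hp).2.2.1))).1 = l ∧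
      (E.condensation.σ (E.condensation.σ (E.condensation.σ
        (toRest (E.se l k) (g.leg_notMem hp).2.2.1)))).1 = E.σ l := by
    intro l k g
    obtain ⟨n1, n2, n3, n4⟩ := g.leg_notMem hp
    rw [g.toRest_se hp _ n4, g.toRest_ne hp _ n1, g.toRest_nw hp _ n2]
    exact ⟨rfl, rfl⟩
  simp only [HasMeetingLegs]
  rw [f0, f1, f2, (key gA).1, (key gB).1, (key gC).1, (key gA).2, (key gB).2, (key gC).2, h.nw₀,
    h.sw₀, h.nw₁, h.sw₁, h.nw₂, h.sw₂]

/-- A criterion for the collapse of `E'` to be the result of an `ots` operation. -/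
theorem Tri.collapse_iso [DecidableEq X] (h : Tri E V A a B b C c nA sA nB sB nC sC)
    (hp : E.ThreeEdgeConnected) (gA : E.IsGroup A a) (gB : E.IsGroup B b) (gC : E.IsGroup C c)
    (hσ : E'.σ = E.σ) (hS : ∀ x ∈ E.bigonDarts, E'.α x = E.α x)
    (hfr : ∀ x, x ∉ V → E.α x ∉ V → E'.α x = E.α x) (e : Perm (E.Rest E.bigonDarts))
    (he : ∀ x, e (E.condensation.σ x) = E.condensation.σ (e x))
    (he' : ∀ x, x.1 ∉ V → e x = x)
    (hleg : ∀ x : E.Rest E.bigonDarts, (x.1 = A → E'.α (e x).1 = sB) ∧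
      (x.1 = E.σ A → E'.α (e x).1 = nC) ∧ (x.1 = B → E'.α (e x).1 = sC) ∧
      (x.1 = E.σ B → E'.α (e x).1 = nA) ∧ (x.1 = C → E'.α (e x).1 = sA) ∧
      (x.1 = E.σ C → E'.α (e x).1 = nB))
    (hin : ∀ x y : E.Rest E.bigonDarts, (x.1 = E.se A a → y.1 = E.ne B b → E'.α (e x).1 = (e y).1) ∧
      (x.1 = E.se B b → y.1 = E.ne C c → E'.α (e x).1 = (e y).1) ∧
      (x.1 = E.se C c → y.1 = E.ne A a → E'.α (e x).1 = (e y).1)) :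
    (E'.collapse E.bigonDarts).Iso
      (E.condensation.ots (toRest (E.se A a) (gA.leg_notMem hp).2.2.1)) := by
  have f0 := gB.toRest_φ hp h.α_se₀ (gA.leg_notMem hp).2.2.1 (gB.leg_notMem hp).2.2.1
  have f1 := gC.toRest_φ hp h.rot.α_se₀ (gB.leg_notMem hp).2.2.1 (gC.leg_notMem hp).2.2.1
  obtain ⟨nA1, nA2, nA3, nA4⟩ := gA.leg_notMem hp
  obtain ⟨nB1, nB2, nB3, nB4⟩ := gB.leg_notMem hp
  obtain ⟨nC1, nC2, nC3, nC4⟩ := gC.leg_notMem hp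
  set t := toRest (E.se A a) (gA.leg_notMem hp).2.2.1 with ht
  set G := E.condensation with hGdef
  have hρ : G.otsPerm t = swap (toRest A nA1) (toRest (E.σ B) nB2) *
      swap (toRest B nB1) (toRest (E.σ C) nC2) * swap (toRest C nC1) (toRest (E.σ A) nA2) := by
    simp only [CMap.otsPerm]
    rw [f0, f1, ht, gA.toRest_se hp _ nA4, gA.toRest_ne hp _ nA1, gA.toRest_nw hp _ nA2,
      gB.toRest_se hp _ nB4, gB.toRest_ne hp _ nB1, gB.toRest_nw hp _ nB2,
      gC.toRest_se hp _ nC4, gC.toRest_ne hp _ nC1, gC.toRest_nw hp _ nC2]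
  have hnd : [toRest A nA1, toRest (E.σ A) nA2, toRest B nB1, toRest (E.σ B) nB2, toRest C nC1,
      toRest (E.σ C) nC2].Nodup := by
    apply List.Nodup.of_map Subtype.val
    exact h.legs_nodup
  obtain ⟨r1, r2, r3, r4, r5, r6, rfix⟩ := Equiv.Perm.three_swaps hnd
  rw [← hρ] at r1 r2 r3 r4 r5 r6 rfix
  set ρ := G.otsPerm t
  have hfix : ∀ x : E.Rest E.bigonDarts, x.1 ∉ V ∨ E.α x.1 ∈ V → ρ x = x := by
    intro x hx
    have m : ∀ {y : X} (hy : y ∉ E.bigonDarts), y ∈ V → E.α y ∉ V → x ≠ toRest y hy := by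
      rintro y hy h1 h2 rfl
      exact hx.elim (fun h => h h1) h2
    have k0 := h.start_mem₀
    have k1 := h.rot.start_mem₀
    have k2 := h.rot.rot.start_mem₀
    exact rfix x (m _ k0 (h.nw₀ ▸ h.n₀_mem)) (m _ ((h.closed _).2 k0) (h.sw₀ ▸ h.s₀_mem))
      (m _ k1 (h.nw₁ ▸ h.n₁_mem)) (m _ ((h.closed _).2 k1) (h.sw₁ ▸ h.s₁_mem))
      (m _ k2 (h.nw₂ ▸ h.n₂_mem)) (m _ ((h.closed _).2 k2) (h.sw₂ ▸ h.s₂_mem))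
  have hN : ∀ x, (G.ots t).α (ρ x) = ρ (G.α x) := fun x => by
    change (ρ * G.α * ρ⁻¹) (ρ x) = _
    simp [Perm.mul_apply]
  -- The property passes from one end of an edge of `ots(G)` to the other, so every edge is checked
  -- at one end only.
  let P : E.Rest E.bigonDarts → Prop := fun x => (e ((G.ots t).α x)).1 = E'.α (e x).1
  have hP : ∀ x, P x → P ((G.ots t).α x) := by
    intro x hx
    change (e ((G.ots t).α ((G.ots t).α x))).1 = E'.α (e ((G.ots t).α x)).1
    rw [hx, E'.α_α, (G.ots t).α_invol]
  have hleg1 : ∀ x y : E.Rest E.bigonDarts, ρ y = x → E.α y.1 ∉ V → E'.α (e x).1 = E.α y.1 →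
      P x ∧ P (G.α y) := by
    intro x y hxy hy hx
    have e1 : (G.ots t).α x = G.α y := by rw [← hxy, hN]; exact hfix _ (Or.inl hy)
    have p1 : P x := by
      change (e ((G.ots t).α x)).1 = _
      rw [e1, he' _ hy, hx]; rfl
    exact ⟨p1, e1 ▸ hP x p1⟩
  have hin1 : ∀ x y : E.Rest E.bigonDarts, x.1 ∈ V → y.1 ∈ V → E.α x.1 = y.1 →
      E'.α (e x).1 = (e y).1 → P x ∧ P y := by
    intro x y hx hy hxy hxy'
    have e0 : G.α x = y := Subtype.ext hxy
    have e1 : (G.ots t).α x = y := by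
      rw [← hfix x (Or.inr (hxy ▸ hy)), hN, e0]
      exact hfix y (Or.inr (by rwa [← hxy, E.α_α]))
    have p1 : P x := by
      change (e ((G.ots t).α x)).1 = _
      rw [e1, hxy']
    exact ⟨p1, e1 ▸ hP x p1⟩
  -- By the half turn of the legs, the dart `A` receives the edge that was at `σ B`; the other five
  -- legs follow the same pattern.
  have lA1 := hleg1 _ (toRest (E.σ B) nB2) r2 (by rw [toRest_val, h.sw₁]; exact h.s₁_mem)
    (((hleg (toRest A nA1)).1 rfl).trans h.sw₁.symm)
  have lA2 := hleg1 _ (toRest C nC1) r5 (by rw [toRest_val, h.nw₂]; exact h.n₂_mem)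
    (((hleg (toRest (E.σ A) nA2)).2.1 rfl).trans h.nw₂.symm)
  have lB1 := hleg1 _ (toRest (E.σ C) nC2) r4 (by rw [toRest_val, h.sw₂]; exact h.s₂_mem)
    (((hleg (toRest B nB1)).2.2.1 rfl).trans h.sw₂.symm)
  have lB2 := hleg1 _ (toRest A nA1) r1 (by rw [toRest_val, h.nw₀]; exact h.n₀_mem)
    (((hleg (toRest (E.σ B) nB2)).2.2.2.1 rfl).trans h.nw₀.symm)
  have lC1 := hleg1 _ (toRest (E.σ A) nA2) r6 (by rw [toRest_val, h.sw₀]; exact h.s₀_mem)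
    (((hleg (toRest C nC1)).2.2.2.2.1 rfl).trans h.sw₀.symm)
  have lC2 := hleg1 _ (toRest B nB1) r3 (by rw [toRest_val, h.nw₁]; exact h.n₁_mem)
    (((hleg (toRest (E.σ C) nC2)).2.2.2.2.2 rfl).trans h.nw₁.symm)
  have iA := hin1 (toRest _ nA3) (toRest _ nB4) (h.sub₀ (E.se_mem gA.1.pos))
    (h.rot.sub₀ (E.ne_mem gB.1.pos)) h.α_se₀ ((hin _ _).1 rfl rfl)
  have iB := hin1 (toRest _ nB3) (toRest _ nC4) (h.rot.sub₀ (E.se_mem gB.1.pos))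
    (h.rot.rot.sub₀ (E.ne_mem gC.1.pos)) h.rot.α_se₀ ((hin _ _).2.1 rfl rfl)
  have iC := hin1 (toRest _ nC3) (toRest _ nA4) (h.rot.rot.sub₀ (E.se_mem gC.1.pos))
    (h.sub₀ (E.ne_mem gA.1.pos)) h.rot.rot.α_se₀ ((hin _ _).2.2 rfl rfl)
  have hall : ∀ x, P x := by
    intro x
    have hx := rest_notMem x
    have conv : ∀ {y : X} (hy : y ∉ E.bigonDarts), x.1 = y → P (toRest y hy) → P x := by
      rintro y hy rfl h; exact h
    by_cases hV : x.1 ∈ V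
    · rcases h.mem_cases hV with hm | hm | hm
      · rcases gA.1.leg_cases hm hx with g | g | g | g
        · exact conv _ g lA1.1
        · exact conv _ g lA2.1
        · exact conv _ g iA.1
        · exact conv _ g iC.2
      · rcases gB.1.leg_cases hm hx with g | g | g | g
        · exact conv _ g lB1.1
        · exact conv _ g lB2.1
        · exact conv _ g iB.1
        · exact conv _ g iA.2
      · rcases gC.1.leg_cases hm hx with g | g | g | g
        · exact conv _ g lC1.1
        · exact conv _ g lC2.1
        · exact conv _ g iC.1
        · exact conv _ g iB.2
    · by_cases hV' : E.α x.1 ∈ V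
      · have conv' : ∀ {y z : X} (hy : y ∉ E.bigonDarts), x.1 = z → E.α y = z →
            P (G.α (toRest y hy)) → P x := by
          intro y z hy h1 h2 h3
          rwa [show x = G.α (toRest y hy) from Subtype.ext (h1.trans h2.symm)]
        rcases h.out_cases hV hV' with g | g | g | g | g | g
        · exact conv' _ g h.nw₀ lB2.2
        · exact conv' _ g h.sw₀ lC1.2
        · exact conv' _ g h.nw₁ lC2.2
        · exact conv' _ g h.sw₁ lA1.2
        · exact conv' _ g h.nw₂ lA2.2
        · exact conv' _ g h.sw₂ lB1.2
      · have e1 : (G.ots t).α x = G.α x := by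
          conv_lhs => rw [← hfix x (Or.inl hV)]
          rw [hN]
          exact hfix _ (Or.inl hV')
        change (e ((G.ots t).α x)).1 = _
        rw [e1, he' _ hV, he' _ hV', hfr _ hV hV']; rfl
  obtain ⟨f, hf1, hf2, -⟩ := exists_collapse_equiv hσ hS (fun x => α_mem_bigonDarts) (G.ots t) rfl
    e he hall
  exact CMap.Iso.symm ⟨f, hf1, hf2⟩

end Main

end Diagram

/-! ### Bigons after the transformation; the explicit configurations -/

namespace Diagram

variable {X : Type*} {E E' : Diagram X} {V S : Set X}

theorem Tri.not_leg {l₀ l₁ l₂ : X} {k₀ k₁ k₂ : ℕ} {n₀ s₀ n₁ s₁ n₂ s₂ x : X}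
    (h : Tri E V l₀ k₀ l₁ k₁ l₂ k₂ n₀ s₀ n₁ s₁ n₂ s₂) (hx' : E.α x ∈ E.twistDarts l₀ k₀) :
    x ≠ l₀ ∧ x ≠ E.σ l₀ ∧ x ≠ E.se l₀ k₀ ∧ x ≠ E.ne l₀ k₀ := by
  refine ⟨?_, ?_, ?_, ?_⟩ <;> rintro rfl
  · rw [h.nw₀] at hx'; exact h.n₀_mem (h.sub₀ hx')
  · rw [h.sw₀] at hx'; exact h.s₀_mem (h.sub₀ hx')
  · rw [h.α_se₀] at hx'; exact h.ne_of_mem₀₁ hx' (E.ne_mem h.rot.twist₀.pos) rfl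
  · rw [h.α_ne₀] at hx'; exact h.rot.rot.ne_of_mem₀₁ (E.se_mem h.rot.rot.twist₀.pos) hx' rfl

/-- The set of bigon darts occurs in the type of the collapse, so it is substituted rather than
rewritten. -/
theorem condensation_iso_of_eq [Finite X] {Y : Type*} {N : CMap Y} (h : E'.bigonDarts = S)
    (hi : (E'.collapse S).Iso N) : E'.condensation.Iso N := by
  subst h; exact hi

/-- Outside the tangle nothing has changed, and a bigon inside a twist of `E'` uses only inner
darts, which were bigon darts before. The remaining possibility in `Tri.bigon_cases` is excluded by
`hm`. -/
theorem Tri.bigonDarts_eq {l₀ l₁ l₂ l₀' l₁' l₂' : X} {k₀ k₁ k₂ k₀' k₁' k₂' : ℕ}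
    {n₀ s₀ n₁ s₁ n₂ s₂ n₀' s₀' n₁' s₁' n₂' s₂' : X}
    (h : Tri E V l₀ k₀ l₁ k₁ l₂ k₂ n₀ s₀ n₁ s₁ n₂ s₂)
    (h' : Tri E' V l₀' k₀' l₁' k₁' l₂' k₂' n₀' s₀' n₁' s₁' n₂' s₂') (hσ : E'.σ = E.σ)
    (hS : ∀ x ∈ E.bigonDarts, E'.α x = E.α x)
    (hfr : ∀ x, x ∉ V → E.α x ∉ V → E'.α x = E.α x)
    (hs : ∀ x, (x = n₀ ∨ x = s₀ ∨ x = n₁ ∨ x = s₁ ∨ x = n₂ ∨ x = s₂) →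
      (x = n₀' ∨ x = s₀' ∨ x = n₁' ∨ x = s₁' ∨ x = n₂' ∨ x = s₂'))
    (hin : ∀ x l k, (l = l₀' ∧ k = k₀' ∨ l = l₁' ∧ k = k₁' ∨ l = l₂' ∧ k = k₂') →
      x ∈ E'.twistDarts l k →
      x ≠ l ∧ x ≠ E'.σ l ∧ x ≠ E'.se l k ∧ x ≠ E'.ne l k → x ∈ E.bigonDarts)
    (hm : n₀' ≠ E'.σ s₀' ∧ n₁' ≠ E'.σ s₁' ∧ n₂' ≠ E'.σ s₂') :
    E'.bigonDarts = E.bigonDarts := by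
  have hfr' : ∀ x, x ∉ V → E'.α x ∉ V → E.α x = E'.α x := by
    intro x hx hx'
    refine (hfr x hx fun hV => hx' ?_).symm
    exact h'.α_out (hs x (h.out_cases hx hV))
  have key : ∀ x, E'.IsBigon x → x ∈ E.bigonDarts ∧ E.σ x ∈ E.bigonDarts := by
    intro x hx
    have hb := (E'.isBigon_iff x).1 hx
    have tw : ∀ l k, (l = l₀' ∧ k = k₀' ∨ l = l₁' ∧ k = k₁' ∨ l = l₂' ∧ k = k₂') →
        (∀ z, E'.α z ∈ E'.twistDarts l k →
          z ≠ l ∧ z ≠ E'.σ l ∧ z ≠ E'.se l k ∧ z ≠ E'.ne l k) →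
        x ∈ E'.twistDarts l k → E'.α x ∈ E'.twistDarts l k →
        x ∈ E.bigonDarts ∧ E.σ x ∈ E.bigonDarts := by
      intro l k hlk hleg h1 h2
      refine ⟨hin x l k hlk h1 (hleg x h2), ?_⟩
      rw [← hσ]
      refine hin _ l k hlk (by simpa using h1) (hleg _ ?_)
      rwa [hb.1, σ_mem_twistDarts] at h2
    rcases h'.bigon_cases hx with ⟨g1, g2, g3, g4⟩ | ⟨g1, g2⟩ | ⟨g1, g2⟩ | ⟨g1, g2⟩ | g | g | g
    · have : E.IsBigon x := by
        rw [isBigon_iff, hfr' x g1 g2, ← hσ, hfr' _ g3 g4, ← sameVertex_congr hσ]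
        exact hb
      exact ⟨Or.inl this, mem_bigonDarts_iff.2 (Or.inr (by rwa [E.σ_four]))⟩
    · exact tw _ _ (by tauto) (fun z hz => h'.not_leg hz) g1 g2
    · exact tw _ _ (by tauto) (fun z hz => h'.rot.not_leg hz) g1 g2
    · exact tw _ _ (by tauto) (fun z hz => h'.rot.rot.not_leg hz) g1 g2
    · exact absurd g hm.1
    · exact absurd g hm.2.1
    · exact absurd g hm.2.2
  refine Set.Subset.antisymm (fun x hx => ?_) (bigonDarts_subset hσ hS)
  rcases mem_bigonDarts_iff.1 hx with g | g
  · exact (key _ g).1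
  · have := (key _ g).2
    rwa [hσ, E.σ_four] at this

/-- The explicit configurations. -/
theorem exists_of_isTriangle [Fintype X] [DecidableEq X] {A B C : X} {b c : ℕ}
    (hD : E.IsReducedAlternatingPrime) (hG : E.condensation.IsSimple) (gA : E.IsGroup A 1)
    (gB : E.IsGroup B b) (gC : E.IsGroup C c) (h : E.IsTriangle A 1 B b C c)
    {t : E.Rest E.bigonDarts} (ht : t.1 = E.se A 1) :
    ∃ E' : Diagram X, E.condensation.IsOtsTriangle t ∧
      E.Transforms (E.twistDarts A 1 ∪ E.twistDarts B b ∪ E.twistDarts C c) E' ∧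
      E'.IsReducedAlternatingPrime ∧
      E.AgreesOutside (E.twistDarts A 1 ∪ E.twistDarts B b ∪ E.twistDarts C c) E' ∧
      (Odd b → E'.IsTriangle A 1 B b C c ∧
        E'.α (E'.nw A) = E.leg A B C 3 ∧ E'.α (E'.sw A) = E.leg A B C 2 ∧
        E'.α (E'.nw B) = E.leg A B C 1 ∧ E'.α (E'.sw B) = E.leg A B C 0 ∧
        E'.α (E'.nw C) = E.leg A B C 5 ∧ E'.α (E'.sw C) = E.leg A B C 4) ∧
      (Even b → E'.IsTriangle A 1 C c B b ∧
        E'.α (E'.nw A) = E.leg A B C 5 ∧ E'.α (E'.sw A) = E.leg A B C 4 ∧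
        E'.α (E'.nw C) = E.leg A B C 3 ∧ E'.α (E'.sw C) = E.leg A B C 2 ∧
        E'.α (E'.nw B) = E.leg A B C 1 ∧ E'.α (E'.sw B) = E.leg A B C 0) ∧
      (E'.collapse E.bigonDarts).Iso (E.condensation.ots t) ∧
      (¬ E.HasMeetingLegs t → E'.condensation.Iso (E.condensation.ots t)) := by
  have hp := hD.prime
  have T := Tri.of_groups hp hG gA gB gC h
  obtain rfl : t = toRest (E.se A 1) (gA.leg_notMem hp).2.2.1 := Subtype.ext ht
  obtain ⟨E', htr, hprime, hσ, hover, hfr, hrB, hrC, hodd, heven⟩ := T.exists_transformed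
  set V := E.twistDarts A 1 ∪ E.twistDarts B b ∪ E.twistDarts C c with hV
  have hrA : ∀ i < 1, E'.rowDart A i = E.rowDart A i := by
    intro i hi
    obtain rfl : i = 0 := by omega
    rfl
  have tB' : E'.IsTwist B b := by
    rcases Nat.even_or_odd b with hb | hb
    · exact (heven hb).rot.rot.twist₀
    · exact (hodd hb).rot.twist₀
  have tC' : E'.IsTwist C c := by
    rcases Nat.even_or_odd b with hb | hb
    · exact (heven hb).rot.twist₀
    · exact (hodd hb).rot.rot.twist₀
  have ne_of : ∀ {x y : X}, x ∈ E.bigonDarts → y ∉ E.bigonDarts → x ≠ y := by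
    rintro x _ h1 h2 rfl; exact h2 h1
  have inner : ∀ {l k}, E.IsGroup l k → E'.IsTwist l k →
      (∀ i < k, E'.rowDart l i = E.rowDart l i) → ∀ x ∈ E.bigonDarts, x ∈ E.twistDarts l k →
      E'.α x = E.α x := by
    intro l k g t' hr x hx hm
    obtain ⟨n1, n2, n3, n4⟩ := g.leg_notMem hp
    exact g.1.α_inner_eq hσ t' hr hm ⟨ne_of hx n1, ne_of hx n2, ne_of hx n3, ne_of hx n4⟩
  -- A bigon edge meeting the tangle is an inner edge of one of the groups, whose rows have kept
  -- their darts; all others belong to the unchanged outside.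
  have hS : ∀ x ∈ E.bigonDarts, E'.α x = E.α x := by
    intro x hx
    by_cases hm : x ∈ V
    · rcases T.mem_cases hm with hm | hm | hm
      · exact inner gA (E'.isTwist_one A) hrA x hx hm
      · exact inner gB tB' hrB x hx hm
      · exact inner gC tC' hrC x hx hm
    · refine hfr x hm fun hm' => hm ?_
      rw [hV] at hm' ⊢
      rcases hm' with (hm' | hm') | hm'
      · exact Or.inl (Or.inl ((gA.α_mem hp hx).1 hm'))
      · exact Or.inl (Or.inr ((gB.α_mem hp hx).1 hm'))
      · exact Or.inr ((gC.α_mem hp hx).1 hm')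
  have sA' : E'.se A 1 = E.se A 1 := se_eq_of_rows le_rfl hσ hrA
  have sB' : E'.se B b = E.se B b := se_eq_of_rows gB.1.pos hσ hrB
  have sC' : E'.se C c = E.se C c := se_eq_of_rows gC.1.pos hσ hrC
  have nA' : E'.ne A 1 = E.ne A 1 := by rw [ne_eq_σ_se, ne_eq_σ_se, sA', hσ]
  have nB' : E'.ne B b = E.ne B b := by rw [ne_eq_σ_se, ne_eq_σ_se, sB', hσ]
  have nC' : E'.ne C c = E.ne C c := by rw [ne_eq_σ_se, ne_eq_σ_se, sC', hσ]
  have hiso : (E'.collapse E.bigonDarts).Iso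
      (E.condensation.ots (toRest (E.se A 1) (gA.leg_notMem hp).2.2.1)) := by
    -- For even `b` the legs that `ots(G)` attaches to the vertex of `A` are found at `C` and
    -- conversely, so the isomorphism exchanges these two vertices. For odd `b` it is the identity.
    rcases Nat.even_or_odd b with hb | hb
    · have T' := heven hb
      have dA := gA.1.legs_nodup
      have dC := gC.1.legs_nodup
      obtain ⟨nA1, nA2, nA3, nA4⟩ := gA.leg_notMem hp
      obtain ⟨nC1, nC2, nC3, nC4⟩ := gC.leg_notMem hp
      have hnd : ([toRest A nA1, toRest _ nA2, toRest _ nA3, toRest _ nA4, toRest C nC1,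
          toRest _ nC2, toRest _ nC3, toRest _ nC4] : List (E.Rest E.bigonDarts)).Nodup := by
        apply List.Nodup.of_map Subtype.val
        change ([A, E.σ A, E.se A 1, E.ne A 1] ++ [C, E.σ C, E.se C c, E.ne C c]).Nodup
        refine dA.append dC ?_
        intro x hx hx'
        have m1 : x ∈ E.twistDarts A 1 := by
          simp only [List.mem_cons, List.not_mem_nil, or_false] at hx
          rcases hx with rfl | rfl | rfl | rfl
          · exact E.start_mem le_rfl
          · simp [SameVertex.refl]
          · exact E.se_mem le_rfl
          · exact E.ne_mem le_rfl
        have m2 : x ∈ E.twistDarts C c := by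
          simp only [List.mem_cons, List.not_mem_nil, or_false] at hx'
          rcases hx' with rfl | rfl | rfl | rfl
          · exact E.start_mem gC.1.pos
          · simpa using E.start_mem gC.1.pos
          · exact E.se_mem gC.1.pos
          · exact E.ne_mem gC.1.pos
        exact T.rot.rot.ne_of_mem₀₁ m2 m1 rfl
      obtain ⟨e, e1, e2, e3, e4, e5, e6, e7, e8, efix⟩ := Equiv.Perm.exists_four_swaps hnd
      simp only [List.mem_cons, List.not_mem_nil, or_false, not_or] at efix
      have efix' : ∀ x : E.Rest E.bigonDarts, x.1 ∉ E.twistDarts A 1 → x.1 ∉ E.twistDarts C c →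
          e x = x := by
        intro x h1 h2
        have m : ∀ {W : Set X} {y : X} (hy : y ∉ E.bigonDarts), y ∈ W → x.1 ∉ W →
            x ≠ toRest y hy := by
          rintro W y hy hW hW' rfl; exact hW' hW
        exact efix x ⟨m _ (E.start_mem le_rfl) h1, m _ (by simp [SameVertex.refl]) h1,
          m _ (E.se_mem le_rfl) h1, m _ (E.ne_mem le_rfl) h1, m _ (E.start_mem gC.1.pos) h2,
          m _ (by simpa using E.start_mem gC.1.pos) h2, m _ (E.se_mem gC.1.pos) h2,
          m _ (E.ne_mem gC.1.pos) h2⟩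
      have a1 := gA.toRest_nw hp nA1 nA2
      have a2 := gA.toRest_sw hp nA2 nA3
      have a3 := gA.toRest_se hp nA3 nA4
      have a4 := gA.toRest_ne hp nA4 nA1
      have c1 := gC.toRest_nw hp nC1 nC2
      have c2 := gC.toRest_sw hp nC2 nC3
      have c3 := gC.toRest_se hp nC3 nC4
      have c4 := gC.toRest_ne hp nC4 nC1
      have he : ∀ x, e (E.condensation.σ x) = E.condensation.σ (e x) := by
        intro x
        by_cases hA : x.1 ∈ E.twistDarts A 1
        · rcases gA.1.leg_cases hA (rest_notMem x) with g | g | g | g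
          · obtain rfl : x = toRest A nA1 := Subtype.ext g
            rw [a1, e1, e2, c1]
          · obtain rfl : x = toRest _ nA2 := Subtype.ext g
            rw [a2, e2, e3, c2]
          · obtain rfl : x = toRest _ nA3 := Subtype.ext g
            rw [a3, e3, e4, c3]
          · obtain rfl : x = toRest _ nA4 := Subtype.ext g
            rw [a4, e4, e1, c4]
        by_cases hC : x.1 ∈ E.twistDarts C c
        · rcases gC.1.leg_cases hC (rest_notMem x) with g | g | g | g
          · obtain rfl : x = toRest C nC1 := Subtype.ext g
            rw [c1, e5, e6, a1]
          · obtain rfl : x = toRest _ nC2 := Subtype.ext g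
            rw [c2, e6, e7, a2]
          · obtain rfl : x = toRest _ nC3 := Subtype.ext g
            rw [c3, e7, e8, a3]
          · obtain rfl : x = toRest _ nC4 := Subtype.ext g
            rw [c4, e8, e5, a4]
        · rw [efix' x hA hC, efix' _ (by rwa [gA.σ_mem hp]) (by rwa [gC.σ_mem hp])]
      have memB : ∀ x : E.Rest E.bigonDarts, x.1 ∈ E.twistDarts B b → e x = x := fun x hx =>
        efix' x (fun hA => T.ne_of_mem₀₁ hA hx rfl) (fun hC => T.rot.ne_of_mem₀₁ hx hC rfl)
      have hB := E.start_mem (l := B) gB.1.pos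
      refine T.collapse_iso hp gA gB gC hσ hS hfr e he (fun x hx => ?_) (fun x => ?_)
        (fun x y => ?_)
      · exact efix' x (fun hA => hx (Or.inl (Or.inl hA))) (fun hC => hx (Or.inr hC))
      · refine ⟨fun g => ?_, fun g => ?_, fun g => ?_, fun g => ?_, fun g => ?_, fun g => ?_⟩
        · obtain rfl : x = toRest A nA1 := Subtype.ext g
          rw [e1]; exact T'.nw₁
        · obtain rfl : x = toRest _ nA2 := Subtype.ext g
          rw [e2, toRest_val, ← hσ]; exact T'.sw₁
        · rw [memB x (g ▸ hB), g]; exact T'.nw₂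
        · rw [memB x (g ▸ by simpa using hB), g, ← hσ]; exact T'.sw₂
        · obtain rfl : x = toRest C nC1 := Subtype.ext g
          rw [e5]; exact T'.nw₀
        · obtain rfl : x = toRest _ nC2 := Subtype.ext g
          rw [e6, toRest_val, ← hσ]; exact T'.sw₀
      · refine ⟨fun g g' => ?_, fun g g' => ?_, fun g g' => ?_⟩
        · obtain rfl : x = toRest _ nA3 := Subtype.ext g
          rw [e3, memB y (g' ▸ E.ne_mem gB.1.pos), g', toRest_val, ← sC', ← nB']
          exact T'.rot.α_se₀
        · obtain rfl : y = toRest _ nC4 := Subtype.ext g'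
          rw [e8, memB x (g ▸ E.se_mem gB.1.pos), g, toRest_val, ← sB', ← nA']
          exact T'.rot.rot.α_se₀
        · obtain rfl : x = toRest _ nC3 := Subtype.ext g
          obtain rfl : y = toRest _ nA4 := Subtype.ext g'
          rw [e4, e7, toRest_val, toRest_val, ← sA', ← nC']
          exact T'.α_se₀
    · have T' := hodd hb
      refine T.collapse_iso hp gA gB gC hσ hS hfr 1 (fun x => rfl) (fun x _ => rfl) (fun x => ?_)
        (fun x y => ?_)
      · simp only [Perm.one_apply]
        refine ⟨fun g => ?_, fun g => ?_, fun g => ?_, fun g => ?_, fun g => ?_, fun g => ?_⟩ <;>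
          rw [g]
        · exact T'.nw₀
        · rw [← hσ]; exact T'.sw₀
        · exact T'.nw₁
        · rw [← hσ]; exact T'.sw₁
        · exact T'.nw₂
        · rw [← hσ]; exact T'.sw₂
      · simp only [Perm.one_apply]
        refine ⟨fun g g' => ?_, fun g g' => ?_, fun g g' => ?_⟩ <;> rw [g, g']
        · rw [← sA', ← nB']; exact T'.α_se₀
        · rw [← sB', ← nC']; exact T'.rot.α_se₀
        · rw [← sC', ← nA']; exact T'.rot.rot.α_se₀
  have legs : ∀ {l k}, E.IsGroup l k → E'.twistDarts l k = E.twistDarts l k →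
      E'.se l k = E.se l k → E'.ne l k = E.ne l k → ∀ x ∈ E'.twistDarts l k,
      x ≠ l ∧ x ≠ E'.σ l ∧ x ≠ E'.se l k ∧ x ≠ E'.ne l k → x ∈ E.bigonDarts := by
    intro l k g h1 h2 h3 x hx hx'
    rw [h1] at hx
    rw [h2, h3, hσ] at hx'
    by_contra hn
    have := g.1.leg_cases hx hn
    tauto
  have lA := legs gA (twistDarts_eq_of_rows hσ hrA) sA' nA'
  have lB := legs gB (twistDarts_eq_of_rows hσ hrB) sB' nB'
  have lC := legs gC (twistDarts_eq_of_rows hσ hrC) sC' nC'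
  refine ⟨E', T.isOtsTriangle hp hG gA gB gC, htr, hprime hD, ⟨hσ, hS, hover, hfr⟩, fun hb => ?_,
    fun hb => ?_, hiso, fun hm => condensation_iso_of_eq ?_ hiso⟩
  · have T' := hodd hb
    exact ⟨T'.tri, T'.nw₀, T'.sw₀, T'.nw₁, T'.sw₁, T'.nw₂, T'.sw₂⟩
  · have T' := heven hb
    exact ⟨T'.tri, T'.nw₀, T'.sw₀, T'.nw₁, T'.sw₁, T'.nw₂, T'.sw₂⟩
  · rw [T.hasMeetingLegs_iff hp gA gB gC] at hm
    simp only [not_or] at hm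
    obtain ⟨m1, m2, m3⟩ := hm
    rcases Nat.even_or_odd b with hb | hb
    · refine T.bigonDarts_eq (heven hb) hσ hS hfr (fun x => by tauto) ?_ ?_
      · rintro x l k (⟨rfl, rfl⟩ | ⟨rfl, rfl⟩ | ⟨rfl, rfl⟩)
        · exact lA x
        · exact lC x
        · exact lB x
      · rw [hσ]
        exact ⟨Ne.symm m1, Ne.symm m2, Ne.symm m3⟩
    · refine T.bigonDarts_eq (hodd hb) hσ hS hfr (fun x => by tauto) ?_ ?_
      · rintro x l k (⟨rfl, rfl⟩ | ⟨rfl, rfl⟩ | ⟨rfl, rfl⟩)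
        · exact lA x
        · exact lB x
        · exact lC x
      · rw [hσ]
        exact ⟨Ne.symm m2, Ne.symm m3, Ne.symm m1⟩

end Diagram

/-! ### Triangles in simple 4-regular maps -/

namespace CMap

variable {X : Type*} {M : CMap X}

theorem φ_eq_iff {x y : X} : M.φ x = y ↔ M.α x = M.σ y := by
  rw [φ, Perm.mul_apply, Perm.inv_eq_iff_eq]

/-- In a simple graph the legs of a triangle do not return to the triangle. -/
theorem IsOtsTriangle.not_sameVertex_leg {t s r p : X} (h : M.IsOtsTriangle t) (hG : M.IsSimple)
    (h4 : ∀ x, M.σ (M.σ (M.σ (M.σ x))) = x ∧ M.σ (M.σ x) ≠ x)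
    (hs : s = t ∨ s = M.φ t ∨ s = M.φ (M.φ t)) (hr : r = t ∨ r = M.φ t ∨ r = M.φ (M.φ t))
    (hp : p = M.σ (M.σ s) ∨ p = M.σ (M.σ (M.σ s))) : ¬ M.SameVertex (M.α p) r := by
  have hs3 : M.φ (M.φ (M.φ s)) = s := by
    rcases hs with rfl | rfl | rfl <;> simp only [h.1]
  have hr' : r = s ∨ r = M.φ s ∨ r = M.φ (M.φ s) := by
    rcases hs with rfl | rfl | rfl
    · exact hr
    · rw [h.1]; tauto
    · rw [h.1]; tauto
  have h1 : M.σ s ≠ s := fun h' => (h4 s).2 (by rw [h', h'])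
  have h3 : M.σ (M.σ (M.σ s)) ≠ s := fun h' => h1 (by
    have := (h4 s).1
    rwa [h'] at this)
  -- The darts `s` and `σ s` are the two sides of the triangle at this vertex. A leg ending at
  -- another vertex of the triangle would be parallel to one of them, and a leg ending at its own
  -- vertex would be a loop.
  have e0 : M.α s = M.σ (M.φ s) := φ_eq_iff.1 rfl
  have e1 : M.α (M.φ (M.φ s)) = M.σ s := φ_eq_iff.1 hs3
  have e2 : M.α (M.σ s) = M.φ (M.φ s) := by rw [← e1, M.α_invol]
  have hps : M.SameVertex p s := by
    rcases hp with rfl | rfl <;> simp [SameVertex, Perm.sameCycle_apply_left, Perm.SameCycle.refl]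
  intro hc
  rcases hr' with rfl | rfl | rfl
  · exact hG.1 p (hps.trans hc.symm)
  · have : p = s := hG.2 p s hps (hc.trans (by
      rw [e0]; simp [Perm.sameCycle_apply_right, Perm.SameCycle.refl]))
    rcases hp with rfl | rfl
    · exact (h4 s).2 this
    · exact h3 this
  · have : p = M.σ s := hG.2 p (M.σ s) (hps.trans (by
      simp [Perm.sameCycle_apply_right, Perm.SameCycle.refl])) (by rw [e2]; exact hc)
    rcases hp with rfl | rfl
    · exact h1 (M.σ.injective this)
    · exact (h4 s).2 (M.σ.injective this)

theorem IsOtsTriangle.map {Y : Type*} {N : CMap Y} {f : X ≃ Y}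
    (hσ : ∀ x, f (M.σ x) = N.σ (f x)) (hα : ∀ x, f (M.α x) = N.α (f x)) (hG : M.IsSimple) {t : X}
    (h : M.IsOtsTriangle t) : N.IsOtsTriangle (f t) := by
  obtain ⟨h0, h1, h2, h3, -⟩ := h
  apply (hG.map hσ hα).isOtsTriangle <;> simp only [← φ_map hσ hα, sameVertex_map hσ]
  · rw [h0]
  · exact h1
  · exact h2
  · exact h3

end CMap

/-! ### Turning groups; realisation for every triangle with a loner -/

namespace Diagram

variable {X : Type*} {E E' : Diagram X} {V S : Set X}

/-- The four distinct legs of a group, in their cyclic order, are the darts at its vertex. -/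
theorem condensation_four [Fintype X] (hp : E.ThreeEdgeConnected) (x : E.Rest E.bigonDarts) :
    E.condensation.σ (E.condensation.σ (E.condensation.σ (E.condensation.σ x))) = x ∧
      E.condensation.σ (E.condensation.σ x) ≠ x := by
  obtain ⟨l, k, g, hx⟩ := exists_group (rest_notMem x)
  obtain ⟨n1, n2, n3, n4⟩ := g.leg_notMem hp
  have hd := g.1.legs_nodup
  simp only [List.nodup_cons, List.mem_cons, List.not_mem_nil, or_false, not_or] at hd
  have a1 := g.toRest_nw hp n1 n2
  have a2 := g.toRest_sw hp n2 n3
  have a3 := g.toRest_se hp n3 n4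
  have a4 := g.toRest_ne hp n4 n1
  rcases hx with hx | hx
  · obtain rfl : x = toRest l n1 := Subtype.ext hx
    rw [a1, a2, a3, a4]
    exact ⟨rfl, fun h => hd.1.2.1 (congrArg Subtype.val h).symm⟩
  · obtain rfl : x = toRest _ n2 := Subtype.ext hx
    rw [a2, a3, a4, a1]
    exact ⟨rfl, fun h => hd.2.1.2 (congrArg Subtype.val h).symm⟩

/-- Groups are determined by the bigons and the edges on them. -/
theorem IsGroup.congr {l : X} {k : ℕ} (h : E.IsGroup l k) (hσ : E'.σ = E.σ)
    (hS : ∀ x ∈ E.bigonDarts, E'.α x = E.α x) (hb : ∀ x, E'.IsBigon x ↔ E.IsBigon x) :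
    E'.IsGroup l k ∧ E'.se l k = E.se l k := by
  obtain ⟨h1, h2, h3, h4⟩ := h
  have a1 : ∀ i, i + 1 < k → E'.α (E.σ (E.σ (E.rowDart l i))) = E.α (E.σ (E.σ (E.rowDart l i))) :=
    fun i hi => hS _ (h1.inner_mem hi (Or.inl rfl))
  have a2 : ∀ i, i + 1 < k → E'.α (E.σ (E.σ (E.σ (E.rowDart l i)))) =
      E.α (E.σ (E.σ (E.σ (E.rowDart l i)))) :=
    fun i hi => hS _ (h1.inner_mem hi (Or.inr (Or.inl rfl)))
  have hse := se_congr hσ h1.pos a2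
  refine ⟨⟨h1.congr hσ a1 a2, by rwa [hb], by rwa [hse, hb], fun hk y hy => ?_⟩, hse⟩
  rw [hb]
  exact h4 hk y (by rwa [sameVertex_congr hσ] at hy)

theorem exists_equiv_of_bigonDarts_eq [Finite X] {Y : Type*} {N : CMap Y} {g : Y → X}
    (h : E'.bigonDarts = S) {f : Y ≃ E'.Rest S} (h1 : ∀ x, f (N.σ x) = (E'.collapse S).σ (f x))
    (h2 : ∀ x, f (N.α x) = (E'.collapse S).α (f x)) (h3 : ∀ x, (f x).1 = g x) :
    ∃ f : Y ≃ E'.Rest E'.bigonDarts, (∀ x, f (N.σ x) = E'.condensation.σ (f x)) ∧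
      (∀ x, f (N.α x) = E'.condensation.α (f x)) ∧ ∀ x, (f x).1 = g x := by
  subst h
  exact ⟨f, h1, h2, h3⟩

section Turn

variable [Fintype X] {l : X} {k : ℕ}

theorem IsGroup.row (g : E.IsGroup l k) (hp : E.ThreeEdgeConnected)
    (hG : E.condensation.IsSimple) :
    Row E (E.twistDarts l k) l k (E.α l) (E.α (E.σ l)) (E.α (E.se l k)) (E.α (E.ne l k)) := by
  obtain ⟨n1, n2, n3, n4⟩ := g.leg_notMem hp
  have hl := E.start_mem (l := l) g.1.pos
  exact ⟨g.1, rfl, rfl, rfl, rfl, rfl, g.α_notMem hp hG hl n1,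
    g.α_notMem hp hG (by simpa using hl) n2, g.α_notMem hp hG (E.se_mem g.1.pos) n3,
    g.α_notMem hp hG (E.ne_mem g.1.pos) n4⟩

variable [DecidableEq X]

/-- Turning a group does not change the condensation, if this is simple. -/
theorem IsGroup.turn_spec (g : E.IsGroup l k) (hk : 2 ≤ k) (hp : E.ThreeEdgeConnected)
    (hG : E.condensation.IsSimple) :
    Good (E.twistDarts l k) E (E.turn l k) ∧
    Row (E.turn l k) (E.twistDarts l k) l k (E.α (E.ne l k)) (E.α l) (E.α (E.σ l))
      (E.α (E.se l k)) ∧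
    (∀ x ∈ E.bigonDarts, (E.turn l k).α x = E.α x) ∧
    (∀ x, (E.turn l k).IsBigon x ↔ E.IsBigon x) ∧
    ∃ f : E.Rest E.bigonDarts ≃ (E.turn l k).Rest (E.turn l k).bigonDarts,
      (∀ x, f (E.condensation.σ x) = (E.turn l k).condensation.σ (f x)) ∧
      (∀ x, f (E.condensation.α x) = (E.turn l k).condensation.α (f x)) ∧
      ∀ x, x.1 ∉ E.twistDarts l k → (f x).1 = x.1 := by
  have R := g.row hp hG
  obtain ⟨hgood, R', hrow⟩ := R.turn hk g.2.1 g.2.2.1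
  obtain ⟨n1, n2, n3, n4⟩ := g.leg_notMem hp
  set E' := E.turn l k
  set V := E.twistDarts l k with hV
  have hσ := hgood.σ_eq
  have hfr := hgood.frame
  have hse : E'.se l k = E.se l k := se_eq_of_rows g.1.pos hσ hrow
  have hne : E'.ne l k = E.ne l k := by rw [ne_eq_σ_se, ne_eq_σ_se, hse, hσ]
  have hS : ∀ x ∈ E.bigonDarts, E'.α x = E.α x := by
    intro x hx
    by_cases hm : x ∈ V
    · have ne_of : ∀ {y : X}, y ∉ E.bigonDarts → x ≠ y := by rintro _ h rfl; exact h hx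
      exact g.1.α_inner_eq hσ R'.twist hrow hm ⟨ne_of n1, ne_of n2, ne_of n3, ne_of n4⟩
    · exact hfr x hm (by rwa [g.α_mem hp hx])
  have hin : ∀ x ∈ V, E'.α x ∈ V → E'.α x = E.α x := by
    intro x hx hx'
    apply hS
    by_contra hn
    rcases g.1.leg_cases hx hn with rfl | rfl | rfl | rfl
    · rw [R'.nw] at hx'; exact R'.n_mem hx'
    · rw [← hσ, R'.sw] at hx'; exact R'.s_mem hx'
    · rw [← hse, R'.se] at hx'; exact R'.u_mem hx'
    · rw [← hne, R'.ne] at hx'; exact R'.v_mem hx'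
  have hout : ∀ x, x ∉ V → (E'.α x ∈ V ↔ E.α x ∈ V) := fun x hx =>
    ⟨fun h => R.α_out (by have := R'.out_cases hx h; tauto),
      fun h => R'.α_out (by have := R.out_cases hx h; tauto)⟩
  have hfr' : ∀ x, x ∉ V → E'.α x ∉ V → E'.α x = E.α x := fun x hx hx' =>
    hfr x hx (by rwa [← hout x hx])
  -- A bigon between the group and an outer crossing would need two neighbouring edges from that
  -- crossing to the group, which would be parallel edges of the condensation.
  have hcross : ∀ x, E'.IsBigon x → x ∉ V → E'.α x ∉ V := by
    intro x hx hm hm'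
    have hb := ((E'.isBigon_iff x).1 hx).1
    have hm1 : E.σ x ∉ V := by rwa [R.closed]
    have hm1' : E'.α (E.σ x) ∈ V := by rwa [hb, R'.closed, hσ] at hm'
    rw [hout x hm] at hm'
    rw [hout _ hm1] at hm1'
    have hx1 : x ∉ E.bigonDarts := fun h => hm ((g.α_mem hp h).1 hm')
    have hx2 : E.σ x ∉ E.bigonDarts := fun h => hm1 ((g.α_mem hp h).1 hm1')
    have := hG.2 (toRest x hx1) (toRest _ hx2) (sameVertex_condensation (by simp [SameVertex.refl]))
      ((g.sameVertex_iff hp (x := E.condensation.α (toRest x hx1)) hm').2 hm1')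
    exact E.σ_ne_self x (congrArg Subtype.val this).symm
  have hbig : ∀ x, E'.IsBigon x ↔ E.IsBigon x := by
    have key : ∀ x, E'.α x = E.α x → E'.α (E.σ x) = E.α (E.σ x) →
        (E'.IsBigon x ↔ E.IsBigon x) := by
      intro x h1 h2
      rw [isBigon_iff, isBigon_iff, hσ, h1, h2, sameVertex_congr hσ]
    intro x
    constructor
    · intro hx
      have hb := ((E'.isBigon_iff x).1 hx).1
      rw [hσ] at hb
      refine (key x ?_ ?_).1 hx <;> by_cases hm : x ∈ V
      · refine hin x hm ?_
        by_contra hc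
        refine hcross _ (bigon_other hx) ?_ ?_
        · rw [hσ, ← R.closed, ← hb]; exact hc
        · rwa [E'.α_α, hσ, R.closed]
      · exact hfr' x hm (hcross x hx hm)
      · refine hin _ ((R.closed x).2 hm) ?_
        by_contra hc
        refine hcross _ (bigon_other hx) ?_ ?_
        · rwa [hσ]
        · rwa [E'.α_α, hσ, R.closed]
      · refine hfr' _ (by rwa [R.closed]) ?_
        have := hcross x hx hm
        rwa [hb, R.closed] at this
    · intro hx
      refine (key x ?_ ?_).2 hx
      · exact hS _ (Or.inl hx)
      · exact hS _ (mem_bigonDarts_iff.2 (Or.inr (by rwa [E.σ_four])))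
  have hS' : E'.bigonDarts = E.bigonDarts := by
    ext x
    rw [mem_bigonDarts_iff, mem_bigonDarts_iff, hσ, hbig, hbig]
  refine ⟨hgood, R', hS, hbig, ?_⟩
  classical
  -- A quarter turn of the vertex that represents the group, the identity at all other vertices.
  let e : Perm (E.Rest E.bigonDarts) :=
    Perm.ofSubtype (E.condensation.σ.subtypePerm (p := fun x => x.1 ∈ V) (fun x => g.σ_mem hp x))
  have e1 : ∀ x : E.Rest E.bigonDarts, x.1 ∈ V → e x = E.condensation.σ x := fun x hx => by
    have := Perm.ofSubtype_apply_of_mem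
      (E.condensation.σ.subtypePerm (p := fun x => x.1 ∈ V) (fun x => g.σ_mem hp x)) hx
    exact this
  have e2 : ∀ x : E.Rest E.bigonDarts, x.1 ∉ V → e x = x := fun x hx =>
    Perm.ofSubtype_apply_of_not_mem _ hx
  have he : ∀ x, e (E.condensation.σ x) = E.condensation.σ (e x) := by
    intro x
    by_cases hx : x.1 ∈ V
    · rw [e1 x hx, e1 _ ((g.σ_mem hp x).2 hx)]
    · rw [e2 x hx, e2 _ (by rwa [g.σ_mem hp x])]
  have hleg : ∀ x : E.Rest E.bigonDarts, x.1 ∈ V →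
      E'.α (E.condensation.σ x).1 = E.α x.1 := by
    intro x hx
    rcases g.1.leg_cases hx (rest_notMem x) with h | h | h | h
    · rw [g.condensation_nw hp h, h, ← hσ]; exact R'.sw
    · rw [g.condensation_sw hp h, h, ← hse]; exact R'.se
    · rw [g.condensation_se hp h, h, ← hne]; exact R'.ne
    · rw [g.condensation_ne hp h, h]; exact R'.nw
  have he' : ∀ x, (e (E.condensation.α x)).1 = E'.α (e x).1 := by
    intro x
    by_cases hx : x.1 ∈ V
    · have : (E.condensation.α x).1 ∉ V := g.α_notMem hp hG hx (rest_notMem x)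
      rw [e1 x hx, e2 _ this, hleg x hx]; rfl
    · by_cases hx' : (E.condensation.α x).1 ∈ V
      · have := hleg _ hx'
        rw [e1 _ hx', e2 x hx]
        rw [condensation_α, E.α_α, E'.α_eq_iff] at this
        exact this
      · rw [e2 _ hx', e2 x hx, hfr _ hx hx']; rfl
  obtain ⟨f, f1, f2, f3⟩ := exists_collapse_equiv hσ hS (fun x => α_mem_bigonDarts)
    E.condensation rfl e he he'
  obtain ⟨f, f1, f2, f3⟩ := exists_equiv_of_bigonDarts_eq hS' f1 f2 f3
  exact ⟨f, f1, f2, fun x hx => by rw [f3, e2 x hx]⟩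

/-- The operation `ots` at the triangle `t` of the condensation is realised by `T` and `OTS`
operations. -/
def OtsRealizable (E : Diagram X) (t : E.Rest E.bigonDarts) : Prop :=
  ∃ E' : Diagram X, E.Transforms Set.univ E' ∧ E'.IsReducedAlternatingPrime ∧
    E.bigonDarts ⊆ E'.bigonDarts ∧
    (E'.collapse E.bigonDarts).Iso (E.condensation.ots t) ∧
    (¬ E.HasMeetingLegs t → E'.condensation.Iso (E.condensation.ots t))

theorem OtsRealizable.of_map {t : E.Rest E.bigonDarts}
    {f : E.Rest E.bigonDarts ≃ E'.Rest E'.bigonDarts} (h : E'.OtsRealizable (f t))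
    (hg : Good V E E') (hb : ∀ x, E'.IsBigon x ↔ E.IsBigon x)
    (hσ : ∀ x, f (E.condensation.σ x) = E'.condensation.σ (f x))
    (hα : ∀ x, f (E.condensation.α x) = E'.condensation.α (f x))
    (hm : E'.HasMeetingLegs (f t) → E.HasMeetingLegs t) : E.OtsRealizable t := by
  obtain ⟨D, h1, h2, h3, h4, h5⟩ := h
  have hS : E'.bigonDarts = E.bigonDarts := by
    ext x
    rw [mem_bigonDarts_iff, mem_bigonDarts_iff, hg.σ_eq, hb, hb]
  have hi := (CMap.ots_map hσ hα t).symm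
  have h4' : (D.collapse E.bigonDarts).Iso (E.condensation.ots t) := by
    have := h4.trans hi
    rwa [hS] at this
  refine ⟨D, ((hg.mono (Set.subset_univ V)).transforms).trans h1, h2, hS ▸ h3, h4', fun hn => ?_⟩
  exact (h5 fun h => hn (hm h)).trans hi

/-- Besides the isomorphism of condensations, the condition on meeting legs has to be carried back.
In a simple condensation the legs of the triangle end outside the turned group, so their far ends
are the same darts before and after the turn. -/
theorem IsGroup.otsRealizable_of_turn (g : E.IsGroup l k) (hk : 2 ≤ k)
    (hp : E.ThreeEdgeConnected) (hG : E.condensation.IsSimple) {t r : E.Rest E.bigonDarts}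
    (ht : E.condensation.IsOtsTriangle t)
    (hr : r = E.condensation.φ t ∨ r = E.condensation.φ (E.condensation.φ t))
    (hrV : r.1 ∈ E.twistDarts l k)
    (h : ∀ f : E.Rest E.bigonDarts ≃ (E.turn l k).Rest (E.turn l k).bigonDarts,
      (∀ x, f (E.condensation.σ x) = (E.turn l k).condensation.σ (f x)) →
      (∀ x, f (E.condensation.α x) = (E.turn l k).condensation.α (f x)) →
      (∀ x, x.1 ∉ E.twistDarts l k → (f x).1 = x.1) →
      (E.turn l k).OtsRealizable (f t)) : E.OtsRealizable t := by
  obtain ⟨hg, -, -, hb, f, f1, f2, f3⟩ := g.turn_spec hk hp hG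
  refine (h f f1 f2 f3).of_map hg hb f1 f2 ?_
  set G := E.condensation with hGdef
  have hnot : ∀ s p, (s = t ∨ s = G.φ t ∨ s = G.φ (G.φ t)) →
      (p = G.σ (G.σ s) ∨ p = G.σ (G.σ (G.σ s))) →
      ((E.turn l k).α (f p).1) = E.α p.1 := by
    intro s p hs hp'
    have h1 := ht.not_sameVertex_leg hG (condensation_four hp) hs
      (r := r) (Or.inr hr) hp'
    have h2 : (G.α p).1 ∉ E.twistDarts l k := fun hc =>
      h1 ((g.sameVertex_iff hp hc).2 hrV)
    have h3 := f3 _ h2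
    rw [f2] at h3
    exact h3
  have meet : ∀ s, (s = t ∨ s = G.φ t ∨ s = G.φ (G.φ t)) →
      (E.turn l k).σ ((E.turn l k).α
        ((E.turn l k).condensation.σ ((E.turn l k).condensation.σ
          ((E.turn l k).condensation.φ (f s)))).1) =
        (E.turn l k).α ((E.turn l k).condensation.σ ((E.turn l k).condensation.σ
          ((E.turn l k).condensation.σ (f s)))).1 →
      E.σ (E.α (G.σ (G.σ (G.φ s))).1) = E.α (G.σ (G.σ (G.σ s))).1 := by
    intro s hs he
    have hs' : G.φ s = t ∨ G.φ s = G.φ t ∨ G.φ s = G.φ (G.φ t) := by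
      rcases hs with rfl | rfl | rfl
      · simp
      · simp
      · left; exact ht.1
    rw [← CMap.φ_map f1 f2, ← f1, ← f1, ← f1, ← f1, ← f1, hg.σ_eq,
      hnot _ _ hs' (Or.inl rfl), hnot _ _ hs (Or.inr rfl)] at he
    exact he
  simp only [HasMeetingLegs]
  rintro (h | h | h)
  · exact Or.inl (meet t (by simp) h)
  · rw [← CMap.φ_map f1 f2] at h
    exact Or.inr (Or.inl (meet _ (Or.inr (Or.inl rfl)) h))
  · rw [← CMap.φ_map f1 f2, ← CMap.φ_map f1 f2] at h
    exact Or.inr (Or.inr (meet _ (Or.inr (Or.inr rfl)) h))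

/-- Here `B` and `C` are already joined to `A` in the right position. The third side closes up
because the face has degree three, so the explicit configuration applies. -/
theorem otsRealizable_of_groups {A B C : X} {b c : ℕ} (hD : E.IsReducedAlternatingPrime)
    (hG : E.condensation.IsSimple) (gA : E.IsGroup A 1) (gB : E.IsGroup B b) (gC : E.IsGroup C c)
    {t : E.Rest E.bigonDarts} (ht : t.1 = E.se A 1) (h : E.condensation.IsOtsTriangle t)
    (hB : E.α (E.se A 1) = E.ne B b) (hC : E.α (E.ne A 1) = E.se C c) : E.OtsRealizable t := by
  have hp := hD.prime
  obtain ⟨-, -, nA3, nA4⟩ := gA.leg_notMem hp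
  obtain ⟨-, -, nB3, nB4⟩ := gB.leg_notMem hp
  obtain ⟨-, -, nC3, nC4⟩ := gC.leg_notMem hp
  obtain rfl : t = toRest _ nA3 := Subtype.ext ht
  obtain ⟨h0, h1, h2, h3, -⟩ := id h
  have f0 := gB.toRest_φ hp hB nA3 nB3
  have f1 : E.condensation.φ (toRest _ nB3) = toRest _ nC3 := by
    rw [f0] at h0
    rw [CMap.φ_eq_iff, gA.toRest_se hp nA3 nA4] at h0
    rw [← E.condensation.α_invol (E.condensation.φ _), h0]
    exact toRest_α hC _ _
  rw [f0] at h1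
  rw [f0, f1] at h2 h3
  have hBC : E.α (E.se B b) = E.ne C c := by
    rw [CMap.φ_eq_iff, gC.toRest_se hp nC3 nC4] at f1
    exact congrArg Subtype.val f1
  have mA := E.se_mem (l := A) (k := 1) le_rfl
  have mB := E.se_mem (l := B) gB.1.pos
  have mC := E.se_mem (l := C) gC.1.pos
  have htri : E.IsTriangle A 1 B b C c :=
    ⟨gA.1, gB.1, gC.1, gA.disjoint gB hp (x := toRest _ nA3) (y := toRest _ nB3) mA mB h1,
      gB.disjoint gC hp (x := toRest _ nB3) (y := toRest _ nC3) mB mC h2,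
      gC.disjoint gA hp (x := toRest _ nC3) (y := toRest _ nA3) mC mA h3,
      hB, hBC, E.α_eq_iff.2 hC.symm⟩
  obtain ⟨E', -, p1, p2, p3, -, -, p6, p7⟩ := exists_of_isTriangle hD hG gA gB gC htri ht
  refine ⟨E', Relation.ReflTransGen.mono (fun _ _ hm => hm.mono (Set.subset_univ _)) _ _ p1, p2,
    bigonDarts_subset p3.1 p3.2.1, p6, p7⟩

/-- It remains to place the third group. If an end of it points to the face, reading it backwards
suffices; if a long side does, the group is turned, or merely renamed if it is a single crossing. -/
theorem otsRealizable_of_left {A B : X} {b : ℕ} (hD : E.IsReducedAlternatingPrime)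
    (hG : E.condensation.IsSimple) (gA : E.IsGroup A 1) (gB : E.IsGroup B b)
    {t : E.Rest E.bigonDarts} (ht : t.1 = E.se A 1) (h : E.condensation.IsOtsTriangle t)
    (hB : E.α (E.se A 1) = E.ne B b) : E.OtsRealizable t := by
  have hp := hD.prime
  obtain ⟨-, -, nA3, nA4⟩ := gA.leg_notMem hp
  obtain ⟨-, -, nB3, nB4⟩ := gB.leg_notMem hp
  have nz : E.α (E.ne A 1) ∉ E.bigonDarts := by rwa [α_mem_bigonDarts]
  obtain ⟨l, k, g, hz⟩ := exists_group nz
  rcases hz with hz | hz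
  · exact otsRealizable_of_groups hD hG gA gB g.reverse ht h hB (by rw [hz, g.1.se_se])
  obtain hk | hk : k = 1 ∨ 2 ≤ k := by have := g.1.pos; omega
  · subst hk
    have g' : E.IsGroup (E.σ (E.σ (E.σ l))) 1 :=
      ⟨E.isTwist_one _, g.2.2.2 rfl _ (by simp [SameVertex.refl]),
        g.2.2.2 rfl _ (by simp [SameVertex.refl]),
        fun _ y hy => g.2.2.2 rfl y (by simpa using hy)⟩
    exact otsRealizable_of_groups hD hG gA gB g' ht h hB (by rw [hz, se_one, E.σ_four])
  obtain rfl : t = toRest _ nA3 := Subtype.ext ht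
  have f0 := gB.toRest_φ hp hB nA3 nB3
  have f1 : E.condensation.φ (toRest _ nB3) = toRest _ nz := by
    have h0 := h.1
    rw [f0, CMap.φ_eq_iff, gA.toRest_se hp nA3 nA4] at h0
    rw [← E.condensation.α_invol (E.condensation.φ _), h0]
    exact toRest_α rfl _ _
  have hzV : E.α (E.ne A 1) ∈ E.twistDarts l k := by
    rw [hz]; simpa using E.start_mem g.1.pos
  have nV : ∀ y : E.Rest E.bigonDarts, ¬ E.condensation.SameVertex (toRest _ nz) y →
      y.1 ∉ E.twistDarts l k := fun y hy hc =>
    hy ((g.sameVertex_iff hp (x := toRest _ nz) hzV).2 hc)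
  have h2 := h.2.2.1
  have h3 := h.2.2.2.1
  rw [f0, f1] at h2 h3
  have tV : E.se A 1 ∉ E.twistDarts l k := nV _ h3
  have bV : E.ne B b ∉ E.twistDarts l k := by
    rw [ne_eq_σ_se, σ_mem_twistDarts]
    exact nV (toRest _ nB3) fun hc => h2 hc.symm
  refine g.otsRealizable_of_turn hk hp hG h (r := toRest _ nz) (Or.inr (by rw [f0, f1])) hzV
    fun f c1 c2 c3 => ?_
  obtain ⟨hg, R, hS, hb, -⟩ := g.turn_spec hk hp hG
  obtain ⟨gA', sA⟩ := gA.congr hg.σ_eq hS hb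
  obtain ⟨gB', sB⟩ := gB.congr hg.σ_eq hS hb
  obtain ⟨g', -⟩ := g.congr hg.σ_eq hS hb
  refine otsRealizable_of_groups (hg.prime hD) (hG.map c1 c2) gA' gB' g' ?_ (h.map c1 c2 hG) ?_ ?_
  · rw [c3 _ tV, sA]; rfl
  · rw [sA, hg.frame _ tV (by rw [hB]; exact bV), hB, ne_eq_σ_se, ne_eq_σ_se, sB, hg.σ_eq]
  · rw [(E.turn l k).α_eq_iff, R.se, ← hz, E.α_α, ne_eq_σ_se, ne_eq_σ_se, sA, hg.σ_eq]

/-- Every triangle of the condensation with a loner as a node can be changed by `ots`. -/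
theorem otsRealizable_of_isLoner (hD : E.IsReducedAlternatingPrime)
    (hG : E.condensation.IsSimple) {t : E.Rest E.bigonDarts}
    (h : E.condensation.IsOtsTriangle t) (hl : E.IsLoner t.1) : E.OtsRealizable t := by
  have hp := hD.prime
  have gA : E.IsGroup (E.σ (E.σ t.1)) 1 :=
    ⟨E.isTwist_one _, hl _ (by simp [SameVertex.refl]), hl _ (by simp [SameVertex.refl]),
      fun _ y hy => hl y (by simpa using hy)⟩
  have ht : t.1 = E.se (E.σ (E.σ t.1)) 1 := by rw [se_one, E.σ_four]
  have ny : E.α t.1 ∉ E.bigonDarts := by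
    rw [α_mem_bigonDarts]; exact rest_notMem t
  obtain ⟨l, k, g, hy⟩ := exists_group ny
  -- In the first case the face runs along the long side of the second group, which is therefore
  -- turned unless it is a single crossing. In the second case its end already faces the triangle.
  rcases hy with hy | hy
  · obtain hk | hk : k = 1 ∨ 2 ≤ k := by have := g.1.pos; omega
    · subst hk
      have g' : E.IsGroup (E.σ l) 1 :=
        ⟨E.isTwist_one _, g.2.2.2 rfl _ (by simp [SameVertex.refl]),
          g.2.2.2 rfl _ (by simp [SameVertex.refl]),
          fun _ y hy => g.2.2.2 rfl y (by simpa using hy)⟩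
      exact otsRealizable_of_left hD hG gA g' ht h (by rw [← ht, hy, ne_one, E.σ_four])
    have g' := g.reverse
    have hyV : E.α t.1 ∈ E.twistDarts (E.se l k) k := by
      rw [hy, g.1.twistDarts_reverse]; exact E.start_mem g.1.pos
    have hφ : (E.condensation.φ t).1 ∈ E.twistDarts (E.se l k) k := by
      rw [← g'.σ_mem hp, ← CMap.φ_eq_iff.1 rfl]; exact hyV
    have tV : t.1 ∉ E.twistDarts (E.se l k) k := fun hc =>
      h.2.1 ((g'.sameVertex_iff hp hc).2 hφ)
    refine g'.otsRealizable_of_turn hk hp hG h (r := E.condensation.φ t) (Or.inl rfl) hφ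
      fun f c1 c2 c3 => ?_
    obtain ⟨hg, R, hS, hb, -⟩ := g'.turn_spec hk hp hG
    obtain ⟨gA', sA⟩ := gA.congr hg.σ_eq hS hb
    obtain ⟨gB', -⟩ := g'.congr hg.σ_eq hS hb
    refine otsRealizable_of_left (hg.prime hD) (hG.map c1 c2) gA' gB' ?_ (h.map c1 c2 hG) ?_
    · rw [c3 _ tV, sA]; exact ht
    · rw [sA, ← ht, (E.turn _ k).α_eq_iff, R.ne, g.1.se_se, ← hy, E.α_α]
  · exact otsRealizable_of_left hD hG gA g.reverse ht h (by rw [← ht, hy, g.1.ne_se])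

end Turn

end Diagram

theorem mainTheorem3 {X : Type*} [Fintype X] [DecidableEq X] (D : Diagram X)
    (hD : D.IsReducedAlternatingPrime) (hG : D.condensation.IsSimple) :
    -- realisation of the graph operation, for every triangle with a loner as a node
    (∀ t : D.Rest D.bigonDarts, D.condensation.IsOtsTriangle t → D.IsLoner t.1 →
      ∃ D' : Diagram X, D.Transforms Set.univ D' ∧ D'.IsReducedAlternatingPrime ∧
        D.bigonDarts ⊆ D'.bigonDarts ∧
        (D'.collapse D.bigonDarts).Iso (D.condensation.ots t) ∧
        (¬ D.HasMeetingLegs t → D'.condensation.Iso (D.condensation.ots t))) ∧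
    -- the explicit configurations
    (∀ (A B C : X) (b c : ℕ), D.IsGroup A 1 → D.IsGroup B b → D.IsGroup C c →
      D.IsTriangle A 1 B b C c →
      ∃ (t : D.Rest D.bigonDarts) (D' : Diagram X),
        t.1 = D.se A 1 ∧ D.condensation.IsOtsTriangle t ∧
        D.Transforms (D.twistDarts A 1 ∪ D.twistDarts B b ∪ D.twistDarts C c) D' ∧
        D'.IsReducedAlternatingPrime ∧
        D.AgreesOutside (D.twistDarts A 1 ∪ D.twistDarts B b ∪ D.twistDarts C c) D' ∧
        (Odd b → D'.IsTriangle A 1 B b C c ∧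
          -- leg numbers (0-based) at the three groups after the operations
          D'.α (D'.nw A) = D.leg A B C 3 ∧ D'.α (D'.sw A) = D.leg A B C 2 ∧
          D'.α (D'.nw B) = D.leg A B C 1 ∧ D'.α (D'.sw B) = D.leg A B C 0 ∧
          D'.α (D'.nw C) = D.leg A B C 5 ∧ D'.α (D'.sw C) = D.leg A B C 4) ∧
        (Even b → D'.IsTriangle A 1 C c B b ∧
          D'.α (D'.nw A) = D.leg A B C 5 ∧ D'.α (D'.sw A) = D.leg A B C 4 ∧
          D'.α (D'.nw C) = D.leg A B C 3 ∧ D'.α (D'.sw C) = D.leg A B C 2 ∧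
          D'.α (D'.nw B) = D.leg A B C 1 ∧ D'.α (D'.sw B) = D.leg A B C 0) ∧
        (D'.collapse D.bigonDarts).Iso (D.condensation.ots t) ∧
        (¬ D.HasMeetingLegs t → D'.condensation.Iso (D.condensation.ots t))) := by
  refine ⟨fun t ht hl => Diagram.otsRealizable_of_isLoner hD hG ht hl, fun A B C b c gA gB gC h => ?_⟩
  obtain ⟨D', h'⟩ := Diagram.exists_of_isTriangle hD hG gA gB gC h
    (t := Diagram.toRest (D.se A 1) (gA.leg_notMem hD.prime).2.2.1) rfl
  exact ⟨_, D', rfl, h'⟩
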